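/- Conventions. Fix a universe and let $\mathrm{Cat}$ be the 2-category of categories in it. A 2-category is a $\mathrm{Cat}$-enriched category (its objects may form a larger collection), and $\mathcal S$ is small if its objects, 1-cells and 2-cells lie in the universe. $[\mathcal S,\mathcal K]_{PS}$ is the 2-category of pseudofunctors $\mathcal S\to\mathcal K$, pseudonatural transformations and modifications; a pseudonatural equivalence $\simeq$ is an equivalence in such a 2-category. $(-)^{op}$ reverses 1-cells only. A pseudofunctor $R:\mathcal A\to\mathcal B$ is right biadjoint to $E:\mathcal B\to\mathcal A$ if there are pseudonatural transformations $\rho:\mathrm{Id}_{\mathcal B}\to RE$, $\varepsilon:ER\to\mathrm{Id}_{\mathcal A}$ and invertible modifications $v:\mathrm{id}_E\Rightarrow(\varepsilon E)(E\rho)$, $w:(R\varepsilon)(\rho R)\Rightarrow\mathrm{id}_R$ satisfying the two coherence (swallowtail) axioms: for every $x\in\mathcal B$ the pasting of $v_x$, $\rho_{\rho_x}^{-1}$ and $w_{Ex}$ is the identity of $\rho_x$, and for every $A\in\mathcal A$ the pasting of $v_{RA}$, $\varepsilon_{\varepsilon_A}^{-1}$ and $w_A$ is the identity of $\varepsilon_A$.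 $R$ is right biadjoint if it is right biadjoint to some $E$. For pseudofunctors $\mathcal W:\mathcal S\to\mathrm{Cat}$ and $\mathcal D:\mathcal S\to\mathcal K$, the weighted bilimit $\{\mathcal W,\mathcal D\}_{bi}$, if it exists, is an object of $\mathcal K$ with an equivalence $\mathcal K(X,\{\mathcal W,\mathcal D\}_{bi})\simeq[\mathcal S,\mathrm{Cat}]_{PS}(\mathcal W,\mathcal K(X,\mathcal D-))$ pseudonatural in $X$. For $\mathcal D:\mathcal S^{op}\to\mathcal A$, the weighted bicolimit $\mathcal W\ast_{bi}\mathcal D$, if it exists, is an object of $\mathcal A$ with an equivalence $\mathcal A(\mathcal W\ast_{bi}\mathcal D,X)\simeq[\mathcal S,\mathrm{Cat}]_{PS}(\mathcal W,\mathcal A(\mathcal D-,X))$ pseudonatural in $X$. Theorem. Let $\mathcal S$ be a small 2-category, $\mathcal A,\mathcal B,\mathcal C$ 2-categories, $\mathcal W:\mathcal S\to\mathrm{Cat}$ a pseudofunctor, $R:\mathcal A\to\mathcal B$ a right biadjoint pseudofunctor and $J:\mathcal A\to\mathcal C$ a pseudofunctor. Let $\mathcal S_0$ be the discrete 2-category on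 the objects of $\mathcal S$. Suppose that for each object $y$ of $\mathcal C$ there is given a pseudofunctor $\mathfrak D_y:\mathcal S\times\mathcal A\to\mathrm{Cat}$ such that (a) there are a pseudofunctor $\mathfrak D_y':\mathcal S_0\to\mathcal B^{op}$ and a pseudonatural equivalence between the restriction of $\mathfrak D_y$ to $\mathcal S_0\times\mathcal A$ and $\mathcal B(-,R-)\circ(\mathfrak D_y'\times\mathrm{Id}_{\mathcal A})$; (b) $\{\mathcal W,\mathfrak D_y(-,A)\}_{bi}\simeq\mathcal C(y,JA)$ pseudonaturally in $A\in\mathcal A$, that is, there is an equivalence $\mathrm{Cat}(X,\mathcal C(y,JA))\simeq[\mathcal S,\mathrm{Cat}]_{PS}(\mathcal W,\mathrm{Cat}(X,\mathfrak D_y(-,A)))$ pseudonatural in $X\in\mathrm{Cat}$ and $A\in\mathcal A$. Then for each object $y$ of $\mathcal C$ there are a pseudofunctor $\mathcal A_y:\mathcal S^{op}\to\mathcal A$ and a pseudonatural equivalence $\mathfrak D_y\simeq\mathcal A(\mathcal A_y-,-)$. Moreover, for any choice of pseudofunctors $\mathcal A_y$ with $\mathfrak D_y\simeq\mathcal A(\mathcal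 A_y-,-)$ for every $y$: $J$ is right biadjoint if and only if for every object $y$ of $\mathcal C$ the weighted bicolimit $\mathcal W\ast_{bi}\mathcal A_y$ exists in $\mathcal A$; and in this case, for any choice of objects $Gy=\mathcal W\ast_{bi}\mathcal A_y$, the assignment $y\mapsto Gy$ extends to a pseudofunctor $G:\mathcal C\to\mathcal A$ to which $J$ is right biadjoint. -/

import Mathlib

open CategoryTheory Bicategory Opposite
open scoped CategoryTheory.Pseudofunctor.StrongTrans

universe w₁ w₂ w₃ w₄ v₁ v₂ v₃ v₄ u₁ u₂ u₃ u₄ v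

namespace BiLift

/-! Conventions: composition of 1-cells is written in diagrammatic order. `B ⥤ᵖ C` is the type of
pseudofunctors; with the instances of `Pseudofunctor.StrongTrans` it is the bicategory
`[B, C]_PS` of pseudofunctors, pseudonatural transformations and modifications. A pseudonatural
equivalence `F ≃ G` is an equivalence (`Bicategory.Equivalence`) in that bicategory. -/

section
variable {B : Type u₁} [Bicategory.{w₁, v₁} B] {C : Type u₂}
    [Bicategory.{w₂, v₂} C] (F : B ⥤ᵖ C)

theorem map₂_associator_inv {a b c d : B} (f : a ⟶ b) (g : b ⟶ c) (h : c ⟶ d) :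
    F.map₂ (α_ f g h).inv = (F.mapComp f (g ≫ h)).hom ≫ F.map f ◁ (F.mapComp g h).hom ≫
      (α_ (F.map f) (F.map g) (F.map h)).inv ≫ (F.mapComp f g).inv ▷ F.map h ≫
      (F.mapComp (f ≫ g) h).inv := by
  rw [← cancel_epi (F.map₂ (α_ f g h).hom), ← F.map₂_comp]
  simp

theorem map_whiskerLeft_map₂ {a b c : B} (f : a ⟶ b) {g h : b ⟶ c} (η : g ⟶ h) :
    F.map f ◁ F.map₂ η = (F.mapComp f g).inv ≫ F.map₂ (f ◁ η) ≫ (F.mapComp f h).hom := by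
  simp

theorem map₂_whiskerRight_map {a b c : B} {f g : a ⟶ b} (η : f ⟶ g) (h : b ⟶ c) :
    F.map₂ η ▷ F.map h = (F.mapComp f h).inv ≫ F.map₂ (η ▷ h) ≫ (F.mapComp g h).hom := by
  simp

theorem map_whiskerLeft_mapComp_hom {a b c d : B} (f : a ⟶ b) (g : b ⟶ c) (h : c ⟶ d) :
    F.map f ◁ (F.mapComp g h).hom = (F.mapComp f (g ≫ h)).inv ≫ F.map₂ (α_ f g h).inv ≫
      (F.mapComp (f ≫ g) h).hom ≫ (F.mapComp f g).hom ▷ F.map h ≫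
      (α_ (F.map f) (F.map g) (F.map h)).hom := by
  simp [map₂_associator_inv]

theorem map_whiskerLeft_mapComp_inv {a b c d : B} (f : a ⟶ b) (g : b ⟶ c) (h : c ⟶ d) :
    F.map f ◁ (F.mapComp g h).inv = (α_ (F.map f) (F.map g) (F.map h)).inv ≫
      (F.mapComp f g).inv ▷ F.map h ≫ (F.mapComp (f ≫ g) h).inv ≫ F.map₂ (α_ f g h).hom ≫
      (F.mapComp f (g ≫ h)).hom := by
  simp
end

section Gen
variable {X : Type u₁} [Bicategory.{w₁, v₁} X] {K : Type u₂} [Bicategory.{w₂, v₂} K] (P : X ⥤ᵖ K)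

/-- The image of a square under a pseudofunctor. -/
def mapSquare {x y x' y' : X} {g : x ⟶ y} {g' : x' ⟶ y'} {t : x ⟶ x'} {t' : y ⟶ y'}
    (σ : g ≫ t' ≅ t ≫ g') : P.map g ≫ P.map t' ≅ P.map t ≫ P.map g' :=
  (P.mapComp g t').symm ≪≫ P.map₂Iso σ ≪≫ P.mapComp t g'

theorem mapSquare_naturality {x y x' y' : X} {g h : x ⟶ y} {g' h' : x' ⟶ y'} {t : x ⟶ x'}
    {t' : y ⟶ y'} (σ : g ≫ t' ≅ t ≫ g') (τ : h ≫ t' ≅ t ≫ h') (η : g ⟶ h) (η' : g' ⟶ h')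
    (H : η ▷ t' ≫ τ.hom = σ.hom ≫ t ◁ η') :
    P.map₂ η ▷ P.map t' ≫ (mapSquare P τ).hom = (mapSquare P σ).hom ≫ P.map t ◁ P.map₂ η' := by
  simp only [mapSquare, Iso.trans_hom, Iso.symm_hom, P.map₂Iso_hom, map₂_whiskerRight_map,
    map_whiskerLeft_map₂, Category.assoc, Iso.hom_inv_id_assoc]
  rw [← P.map₂_comp_assoc, ← P.map₂_comp_assoc, H]

theorem mapSquare_id {x x' : X} (t : x ⟶ x') {i : x ⟶ x} {i' : x' ⟶ x'} (c : i ⟶ 𝟙 x)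
    (c' : i' ⟶ 𝟙 x') (σ : i ≫ t ≅ t ≫ i')
    (H : σ.hom ≫ t ◁ c' = c ▷ t ≫ (λ_ t).hom ≫ (ρ_ t).inv) :
    (mapSquare P σ).hom ≫ P.map t ◁ (P.map₂ c' ≫ (P.mapId x').hom) =
      (P.map₂ c ≫ (P.mapId x).hom) ▷ P.map t ≫ (λ_ (P.map t)).hom ≫ (ρ_ (P.map t)).inv := by
  have h1 : P.map t ◁ (P.mapId x').hom =
      (P.mapComp t (𝟙 x')).inv ≫ P.map₂ (ρ_ t).hom ≫ (ρ_ (P.map t)).inv := by simp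
  have h2 : (P.mapId x).hom ▷ P.map t =
      (P.mapComp (𝟙 x) t).inv ≫ P.map₂ (λ_ t).hom ≫ (λ_ (P.map t)).inv := by simp
  simp only [mapSquare, Iso.trans_hom, Iso.symm_hom, P.map₂Iso_hom, h1, h2, Category.assoc,
    whiskerLeft_comp, comp_whiskerRight, map₂_whiskerRight_map, map_whiskerLeft_map₂,
    Iso.hom_inv_id_assoc, Iso.inv_hom_id_assoc]
  rw [← P.map₂_comp_assoc, H, ← P.map₂_comp_assoc, ← P.map₂_comp_assoc]
  simp only [Category.assoc, Iso.inv_hom_id, Category.comp_id]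

theorem mapSquare_comp {x y z x' y' z' : X} {g : x ⟶ y} {h : y ⟶ z} {k : x ⟶ z}
    {g' : x' ⟶ y'} {h' : y' ⟶ z'} {k' : x' ⟶ z'} {t : x ⟶ x'} {t' : y ⟶ y'} {t'' : z ⟶ z'}
    (c : k ⟶ g ≫ h) (c' : k' ⟶ g' ≫ h') (σ : g ≫ t' ≅ t ≫ g') (τ : h ≫ t'' ≅ t' ≫ h')
    (υ : k ≫ t'' ≅ t ≫ k')
    (H : υ.hom ≫ t ◁ c' = c ▷ t'' ≫ (α_ _ _ _).hom ≫ g ◁ τ.hom ≫ (α_ _ _ _).inv ≫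
      σ.hom ▷ h' ≫ (α_ _ _ _).hom) :
    (mapSquare P υ).hom ≫ P.map t ◁ (P.map₂ c' ≫ (P.mapComp g' h').hom) =
      (P.map₂ c ≫ (P.mapComp g h).hom) ▷ P.map t'' ≫ (α_ _ _ _).hom ≫
      P.map g ◁ (mapSquare P τ).hom ≫ (α_ _ _ _).inv ≫
      (mapSquare P σ).hom ▷ P.map h' ≫ (α_ _ _ _).hom := by
  have H' := congrArg P.map₂ H
  simp only [P.map₂_comp] at H'
  simp only [mapSquare, Iso.trans_hom, Iso.symm_hom, P.map₂Iso_hom, map₂_whiskerRight_map,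
    map_whiskerLeft_map₂, Category.assoc, Iso.hom_inv_id_assoc, whiskerLeft_comp,
    comp_whiskerRight, map_whiskerLeft_mapComp_hom, map_whiskerLeft_mapComp_inv,
    hom_inv_whiskerRight_assoc]
  rw [reassoc_of% H', ← P.map₂_comp_assoc (α_ t g' h').hom, Iso.hom_inv_id, P.map₂_id,
    Category.id_comp]

theorem mapSquare_modification {x y x' y' : X} {g : x ⟶ y} {g' : x' ⟶ y'} {t r : x ⟶ x'}
    {t' r' : y ⟶ y'} (σ : g ≫ t' ≅ t ≫ g') (τ : g ≫ r' ≅ r ≫ g') (β : t ⟶ r) (β' : t' ⟶ r')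
    (H : g ◁ β' ≫ τ.hom = σ.hom ≫ β ▷ g') :
    P.map g ◁ P.map₂ β' ≫ (mapSquare P τ).hom = (mapSquare P σ).hom ≫ P.map₂ β ▷ P.map g' := by
  simp only [mapSquare, Iso.trans_hom, Iso.symm_hom, P.map₂Iso_hom, map₂_whiskerRight_map,
    map_whiskerLeft_map₂, Category.assoc, Iso.hom_inv_id_assoc]
  rw [← P.map₂_comp_assoc, ← P.map₂_comp_assoc, H]

theorem mapSquare_mapId {x y : X} (g : x ⟶ y) (σ : g ≫ 𝟙 y ≅ 𝟙 x ≫ g)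
    (H : σ.hom = (ρ_ g).hom ≫ (λ_ g).inv) :
    P.map g ◁ (P.mapId y).hom ≫ (ρ_ (P.map g)).hom ≫ (λ_ (P.map g)).inv =
      (mapSquare P σ).hom ≫ (P.mapId x).hom ▷ P.map g := by
  have h1 : P.map g ◁ (P.mapId y).hom =
      (P.mapComp g (𝟙 y)).inv ≫ P.map₂ (ρ_ g).hom ≫ (ρ_ (P.map g)).inv := by simp
  have h2 : (P.mapId x).hom ▷ P.map g =
      (P.mapComp (𝟙 x) g).inv ≫ P.map₂ (λ_ g).hom ≫ (λ_ (P.map g)).inv := by simp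
  simp only [mapSquare, Iso.trans_hom, Iso.symm_hom, P.map₂Iso_hom, H, h1, h2, Category.assoc,
    Iso.hom_inv_id_assoc, Iso.inv_hom_id_assoc]
  rw [← P.map₂_comp_assoc, Category.assoc, Iso.inv_hom_id, Category.comp_id]

theorem mapSquare_mapComp {x y x' y' x'' y'' : X} {g : x ⟶ y} {g' : x' ⟶ y'} {g'' : x'' ⟶ y''}
    {t : x ⟶ x'} {r : x' ⟶ x''} {t' : y ⟶ y'} {r' : y' ⟶ y''} {k : x ⟶ x''} {k' : y ⟶ y''}
    (σ : g ≫ t' ≅ t ≫ g') (τ : g' ≫ r' ≅ r ≫ g'') (υ : g ≫ k' ≅ k ≫ g'')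
    (c : k ⟶ t ≫ r) (c' : k' ⟶ t' ≫ r')
    (H : g ◁ c' ≫ (α_ _ _ _).inv ≫ σ.hom ▷ r' ≫ (α_ _ _ _).hom ≫ t ◁ τ.hom ≫ (α_ _ _ _).inv =
      υ.hom ≫ c ▷ g'') :
    P.map g ◁ (P.map₂ c' ≫ (P.mapComp t' r').hom) ≫ (α_ _ _ _).inv ≫ (mapSquare P σ).hom ▷ P.map r' ≫
      (α_ _ _ _).hom ≫ P.map t ◁ (mapSquare P τ).hom ≫ (α_ _ _ _).inv =
      (mapSquare P υ).hom ≫ (P.map₂ c ≫ (P.mapComp t r).hom) ▷ P.map g'' := by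
  have H' := congrArg P.map₂ H
  simp only [P.map₂_comp] at H'
  simp only [mapSquare, Iso.trans_hom, Iso.symm_hom, P.map₂Iso_hom, map₂_whiskerRight_map,
    map_whiskerLeft_map₂, Category.assoc, Iso.hom_inv_id_assoc, whiskerLeft_comp,
    comp_whiskerRight, map_whiskerLeft_mapComp_hom, map_whiskerLeft_mapComp_inv,
    hom_inv_whiskerRight_assoc]
  rw [← reassoc_of% H']
  simp
end Gen

section Curry
open CategoryTheory.Prod
variable {S : Type u₁} [Bicategory.{w₁, v₁} S] {A : Type u₂} [Bicategory.{w₂, v₂} A]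
  {K : Type u₃} [Bicategory.{w₃, v₃} K] (P : S × A ⥤ᵖ K)

/-- The pseudofunctor `P(-, a)`. -/
def slice (a : A) : S ⥤ᵖ K := (Bicategory.Prod.sectL S a).toPseudofunctor.comp P

/-- The pseudofunctor `P(s, -)`. -/
def sliceRight (s : S) : A ⥤ᵖ K := (Bicategory.Prod.sectR s A).toPseudofunctor.comp P

/-- The canonical isomorphism `(g, 1) ≫ (1, f) ≅ (1, f) ≫ (g, 1)`; both sides are `(g, f)` up to
unitors. -/
def interchange {s t : S} {a b : A} (g : s ⟶ t) (f : a ⟶ b) :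
    (g ×ₘ 𝟙 a) ≫ (𝟙 t ×ₘ f) ≅ (𝟙 s ×ₘ f) ≫ (g ×ₘ 𝟙 b) :=
  Iso.prod (ρ_ g ≪≫ (λ_ g).symm) (λ_ f ≪≫ (ρ_ f).symm)

theorem sliceRight_mapId_hom (s : S) (a : A) :
    ((sliceRight P s).mapId a).hom = (P.mapId (s, a)).hom := by
  change P.map₂ (𝟙 _) ≫ _ = _
  rw [P.map₂_id]; exact Category.id_comp _

/-- The pseudonatural transformation `P(-, f) : P(-, a) ⟶ P(-, b)`. -/
def sliceTrans {a b : A} (f : a ⟶ b) : slice P a ⟶ slice P b where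
  app s := P.map (𝟙 s ×ₘ f)
  naturality g := mapSquare P (interchange g f)
  naturality_naturality {s t g h} η := by
    have h1 : η ▷ 𝟙 t ≫ (ρ_ h).hom ≫ (λ_ h).inv = ((ρ_ g).hom ≫ (λ_ g).inv) ≫ 𝟙 s ◁ η := by
      simp
    have h2 : 𝟙 (𝟙 a) ▷ f ≫ (λ_ f).hom ≫ (ρ_ f).inv =
        ((λ_ f).hom ≫ (ρ_ f).inv) ≫ f ◁ 𝟙 (𝟙 b) := by simp
    exact mapSquare_naturality P (interchange g f) (interchange h f) (η ×ₘ 𝟙 (𝟙 a))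
      (η ×ₘ 𝟙 (𝟙 b)) (Prod.ext h1 h2)
  naturality_id s := by
    have h1 : ((ρ_ (𝟙 s)).hom ≫ (λ_ (𝟙 s)).inv) ≫ 𝟙 s ◁ 𝟙 (𝟙 s) =
        𝟙 (𝟙 s) ▷ 𝟙 s ≫ (λ_ (𝟙 s)).hom ≫ (ρ_ (𝟙 s)).inv := by simp [unitors_equal]
    have h2 : ((λ_ f).hom ≫ (ρ_ f).inv) ≫ f ◁ 𝟙 (𝟙 b) =
        𝟙 (𝟙 a) ▷ f ≫ (λ_ f).hom ≫ (ρ_ f).inv := by simp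
    exact mapSquare_id P (𝟙 s ×ₘ f) (𝟙 (𝟙 (s, a))) (𝟙 (𝟙 (s, b))) (interchange (𝟙 s) f)
      (Prod.ext h1 h2)
  naturality_comp {s t r} g h := by
    have h1 : ((ρ_ (g ≫ h)).hom ≫ (λ_ (g ≫ h)).inv) ≫ 𝟙 s ◁ 𝟙 (g ≫ h) =
      𝟙 (g ≫ h) ▷ 𝟙 r ≫ (α_ _ _ _).hom ≫ g ◁ ((ρ_ h).hom ≫ (λ_ h).inv) ≫ (α_ _ _ _).inv ≫
        ((ρ_ g).hom ≫ (λ_ g).inv) ▷ h ≫ (α_ _ _ _).hom := by simp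
    have h2 : ((λ_ f).hom ≫ (ρ_ f).inv) ≫ f ◁ (λ_ (𝟙 b)).inv =
      (λ_ (𝟙 a)).inv ▷ f ≫ (α_ _ _ _).hom ≫ 𝟙 a ◁ ((λ_ f).hom ≫ (ρ_ f).inv) ≫ (α_ _ _ _).inv ≫
        ((λ_ f).hom ≫ (ρ_ f).inv) ▷ 𝟙 b ≫ (α_ _ _ _).hom := by bicategory
    exact mapSquare_comp P
      ((𝟙 (g ≫ h), (λ_ (𝟙 a)).inv) : ((g ≫ h) ×ₘ 𝟙 a) ⟶ (g ×ₘ 𝟙 a) ≫ (h ×ₘ 𝟙 a))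
      ((𝟙 (g ≫ h), (λ_ (𝟙 b)).inv) : ((g ≫ h) ×ₘ 𝟙 b) ⟶ (g ×ₘ 𝟙 b) ≫ (h ×ₘ 𝟙 b))
      (interchange g f) (interchange h f) (interchange (g ≫ h) f) (Prod.ext h1 h2)

/-- The modification `P(-, η) : P(-, f) ⟶ P(-, g)`. -/
def sliceModification {a b : A} {f g : a ⟶ b} (η : f ⟶ g) : sliceTrans P f ⟶ sliceTrans P g where
  as :=
    { app := fun s => P.map₂ (𝟙 (𝟙 s) ×ₘ η)
      naturality := fun {s t} k => by
        have h1 : k ◁ 𝟙 (𝟙 t) ≫ (ρ_ k).hom ≫ (λ_ k).inv =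
          ((ρ_ k).hom ≫ (λ_ k).inv) ≫ 𝟙 (𝟙 s) ▷ k := by simp
        have h2 : 𝟙 a ◁ η ≫ (λ_ g).hom ≫ (ρ_ g).inv = ((λ_ f).hom ≫ (ρ_ f).inv) ≫ η ▷ 𝟙 b := by
          simp
        exact mapSquare_modification P (interchange k f) (interchange k g) (𝟙 (𝟙 s) ×ₘ η)
          (𝟙 (𝟙 t) ×ₘ η) (Prod.ext h1 h2) }

/-- The pseudofunctor `a ↦ P(-, a)` into `[S, K]_PS`. -/
def curry : A ⥤ᵖ (S ⥤ᵖ K) where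
  obj a := slice P a
  map f := sliceTrans P f
  map₂ η := sliceModification P η
  map₂_id f := Pseudofunctor.StrongTrans.homCategory.ext fun s => (sliceRight P s).map₂_id f
  map₂_comp η θ := Pseudofunctor.StrongTrans.homCategory.ext fun s =>
    (sliceRight P s).map₂_comp η θ
  mapId a := Pseudofunctor.StrongTrans.isoMk (fun s => (sliceRight P s).mapId a) (by
    intro s t g
    rw [sliceRight_mapId_hom, sliceRight_mapId_hom]
    exact mapSquare_mapId P (g ×ₘ 𝟙 a) (interchange g (𝟙 a)) (Prod.ext rfl (by
        change (λ_ (𝟙 a)).hom ≫ (ρ_ (𝟙 a)).inv = (ρ_ (𝟙 a)).hom ≫ (λ_ (𝟙 a)).inv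
        simp [unitors_equal])))
  mapComp {a b c} f g := Pseudofunctor.StrongTrans.isoMk
    (fun s => (sliceRight P s).mapComp f g) (by
    intro s t k
    have h1 : k ◁ (ρ_ (𝟙 t)).inv ≫ (α_ _ _ _).inv ≫ ((ρ_ k).hom ≫ (λ_ k).inv) ▷ 𝟙 t ≫
        (α_ _ _ _).hom ≫ 𝟙 s ◁ ((ρ_ k).hom ≫ (λ_ k).inv) ≫ (α_ _ _ _).inv =
      ((ρ_ k).hom ≫ (λ_ k).inv) ≫ (ρ_ (𝟙 s)).inv ▷ k := by bicategory
    have h2 : 𝟙 a ◁ 𝟙 (f ≫ g) ≫ (α_ _ _ _).inv ≫ ((λ_ f).hom ≫ (ρ_ f).inv) ▷ g ≫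
        (α_ _ _ _).hom ≫ f ◁ ((λ_ g).hom ≫ (ρ_ g).inv) ≫ (α_ _ _ _).inv =
      ((λ_ (f ≫ g)).hom ≫ (ρ_ (f ≫ g)).inv) ≫ 𝟙 (f ≫ g) ▷ 𝟙 c := by bicategory
    exact mapSquare_mapComp P (interchange k f) (interchange k g) (interchange k (f ≫ g))
      (((ρ_ (𝟙 s)).inv, 𝟙 (f ≫ g)) : (𝟙 s ×ₘ (f ≫ g)) ⟶ (𝟙 s ×ₘ f) ≫ (𝟙 s ×ₘ g))
      (((ρ_ (𝟙 t)).inv, 𝟙 (f ≫ g)) : (𝟙 t ×ₘ (f ≫ g)) ⟶ (𝟙 t ×ₘ f) ≫ (𝟙 t ×ₘ g)) (Prod.ext h1 h2))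
  map₂_whisker_left f _ _ η := Pseudofunctor.StrongTrans.homCategory.ext fun s =>
    (sliceRight P s).map₂_whisker_left f η
  map₂_whisker_right η h := Pseudofunctor.StrongTrans.homCategory.ext fun s =>
    (sliceRight P s).map₂_whisker_right η h
  map₂_associator f g h := Pseudofunctor.StrongTrans.homCategory.ext fun s =>
    (sliceRight P s).map₂_associator f g h
  map₂_left_unitor f := Pseudofunctor.StrongTrans.homCategory.ext fun s =>
    (sliceRight P s).map₂_left_unitor f
  map₂_right_unitor f := Pseudofunctor.StrongTrans.homCategory.ext fun s =>
    (sliceRight P s).map₂_right_unitor f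

end Curry

section Prod
variable {B : Type u₁} [Bicategory.{w₁, v₁} B] {B' : Type u₂} [Bicategory.{w₂, v₂} B']
  {C : Type u₃} [Bicategory.{w₃, v₃} C] {C' : Type u₄} [Bicategory.{w₄, v₄} C']

/-- The product `F × G : B × C → B' × C'` of two pseudofunctors. -/
def prodMap (F : B ⥤ᵖ B') (G : C ⥤ᵖ C') : B × C ⥤ᵖ B' × C' where
  obj x := (F.obj x.1, G.obj x.2)
  map f := (F.map f.1, G.map f.2)
  map₂ η := (F.map₂ η.1, G.map₂ η.2)
  map₂_id f := Prod.ext (F.map₂_id f.1) (G.map₂_id f.2)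
  map₂_comp η θ := Prod.ext (F.map₂_comp η.1 θ.1) (G.map₂_comp η.2 θ.2)
  mapId x := Iso.prod (F.mapId x.1) (G.mapId x.2)
  mapComp f g := Iso.prod (F.mapComp f.1 g.1) (G.mapComp f.2 g.2)
  map₂_whisker_left f _ _ η :=
    Prod.ext (F.map₂_whisker_left f.1 η.1) (G.map₂_whisker_left f.2 η.2)
  map₂_whisker_right η h :=
    Prod.ext (F.map₂_whisker_right η.1 h.1) (G.map₂_whisker_right η.2 h.2)
  map₂_associator f g h :=
    Prod.ext (F.map₂_associator f.1 g.1 h.1) (G.map₂_associator f.2 g.2 h.2)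
  map₂_left_unitor f := Prod.ext (F.map₂_left_unitor f.1) (G.map₂_left_unitor f.2)
  map₂_right_unitor f := Prod.ext (F.map₂_right_unitor f.1) (G.map₂_right_unitor f.2)

/-- The strict rearrangement `(s, (x, a)) ↦ (x, (s, a))`. -/
def prodExchange (S : Type u₁) [Bicategory.{w₁, v₁} S] (X : Type u₂) [Bicategory.{w₂, v₂} X]
    (A : Type u₃) [Bicategory.{w₃, v₃} A] : S × (X × A) ⥤ᵖ X × (S × A) where
  obj p := (p.2.1, (p.1, p.2.2))
  map f := (f.2.1, (f.1, f.2.2))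
  map₂ η := (η.2.1, (η.1, η.2.2))
  map₂_id _ := rfl
  map₂_comp _ _ := rfl
  mapId _ := Iso.refl _
  mapComp _ _ := Iso.refl _

end Prod

section Op
variable {S : Type u₁} [Bicategory.{w₁, v₁} S] {A : Type u₂} [Bicategory.{w₂, v₂} A]
open Bicategory.Opposite

/-- A pseudofunctor `Sᵒᵖ → A` regarded as a pseudofunctor `S → Aᵒᵖ` (1-cell duals). -/
def rightOp (F : Sᵒᵖ ⥤ᵖ A) : S ⥤ᵖ Aᵒᵖ where
  obj s := op (F.obj (op s))
  map f := (F.map f.op).op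
  map₂ η := op2 (F.map₂ (op2 η))
  map₂_id f := congrArg op2 (F.map₂_id f.op)
  map₂_comp η θ := congrArg op2 (F.map₂_comp (op2 η) (op2 θ))
  mapId s := (F.mapId (op s)).op2
  mapComp f g := (F.mapComp g.op f.op).op2
  map₂_whisker_left f _ _ η := congrArg op2 (F.map₂_whisker_right (op2 η) f.op)
  map₂_whisker_right η h := congrArg op2 (F.map₂_whisker_left h.op (op2 η))
  map₂_associator f g h := congrArg op2 (map₂_associator_inv F h.op g.op f.op)
  map₂_left_unitor f := congrArg op2 (F.map₂_right_unitor f.op)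
  map₂_right_unitor f := congrArg op2 (F.map₂_left_unitor f.op)
end Op

section Discrete
/-- The inclusion into `S` of the discrete 2-category on the objects of `S`. -/
def discreteInclusion (S : Type u₁) [Bicategory.{w₁, v₁} S] :
    LocallyDiscrete (Discrete S) ⥤ᵖ S :=
  pseudofunctorOfIsLocallyDiscrete (fun s => s.as.as)
    (fun f => eqToHom (Discrete.eq_of_hom f.as))
    (fun s => Iso.refl _)
    (fun f g => eqToHomTransIso _ _)
    (by
      rintro ⟨⟨a⟩⟩ ⟨⟨b⟩⟩ ⟨⟨c⟩⟩ ⟨⟨d⟩⟩ ⟨⟨⟨h⟩⟩⟩ ⟨⟨⟨h'⟩⟩⟩ ⟨⟨⟨h''⟩⟩⟩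
      dsimp at h h' h''
      subst h h' h''
      change (λ_ (𝟙 a)).inv ≫ (λ_ (𝟙 a)).inv ▷ 𝟙 a ≫ (α_ (𝟙 a) (𝟙 a) (𝟙 a)).hom ≫
        𝟙 a ◁ (λ_ (𝟙 a)).hom ≫ (λ_ (𝟙 a)).hom = 𝟙 (𝟙 a)
      simp)
    (by
      rintro ⟨⟨a⟩⟩ ⟨⟨b⟩⟩ ⟨⟨⟨h⟩⟩⟩
      dsimp at h
      subst h
      change (λ_ (𝟙 a)).inv ≫ 𝟙 (𝟙 a) ▷ 𝟙 a ≫ (λ_ (𝟙 a)).hom = 𝟙 (𝟙 a)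
      simp)
    (by
      rintro ⟨⟨a⟩⟩ ⟨⟨b⟩⟩ ⟨⟨⟨h⟩⟩⟩
      dsimp at h
      subst h
      change (λ_ (𝟙 a)).inv ≫ 𝟙 a ◁ 𝟙 (𝟙 a) ≫ (ρ_ (𝟙 a)).hom = 𝟙 (𝟙 a)
      simp)
end Discrete

section Hom
variable {B : Type u₁} [Bicategory.{w₁, v₁} B]

theorem cat_hom₂_ext {C D : Cat.{v₁, u₁}} {F G : C ⟶ D} {η θ : F ⟶ G}
    (h : ∀ X, η.toNatTrans.app X = θ.toNatTrans.app X) : η = θ :=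
  Cat.Hom₂.ext (NatTrans.ext (funext h))

/-- The covariant hom pseudofunctor `B(x, -) : B → Cat`. -/
def corep (x : B) : B ⥤ᵖ Cat.{w₁, v₁} where
  obj y := Cat.of (x ⟶ y)
  map g := (postcomp x g).toCatHom
  map₂ η := NatTrans.toCatHom₂ ((postcomposing x _ _).map η)
  map₂_id g := cat_hom₂_ext fun (h : x ⟶ _) => whiskerLeft_id h g
  map₂_comp η θ := cat_hom₂_ext fun (h : x ⟶ _) => whiskerLeft_comp h η θ
  mapId y := rightUnitorNatIsoCat x y
  mapComp g h := (associatorNatIsoLeftCat x g h).symm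
  map₂_whisker_left f g h η := cat_hom₂_ext fun (k : x ⟶ _) => by
    change k ◁ f ◁ η = (α_ k f g).inv ≫ (k ≫ f) ◁ η ≫ (α_ k f h).hom
    simp
  map₂_whisker_right {_ _ _ f g} η h := cat_hom₂_ext fun (k : x ⟶ _) => by
    change k ◁ η ▷ h = (α_ k f h).inv ≫ (k ◁ η) ▷ h ≫ (α_ k g h).hom
    simp
  map₂_associator f g h := cat_hom₂_ext fun (k : x ⟶ _) => by
    change k ◁ (α_ f g h).hom = (α_ k (f ≫ g) h).inv ≫ (α_ k f g).inv ▷ h ≫ 𝟙 _ ≫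
      (α_ (k ≫ f) g h).hom ≫ (α_ k f (g ≫ h)).hom
    simp
  map₂_left_unitor f := cat_hom₂_ext fun (k : x ⟶ _) => by
    change k ◁ (λ_ f).hom = (α_ k (𝟙 _) f).inv ≫ (ρ_ k).hom ▷ f ≫ 𝟙 _
    simp
  map₂_right_unitor f := cat_hom₂_ext fun (k : x ⟶ _) => by
    change k ◁ (ρ_ f).hom = (α_ k f (𝟙 _)).inv ≫ (ρ_ (k ≫ f)).hom ≫ 𝟙 _
    simp

variable (B) in
/-- The hom pseudofunctor `B(-, -) : Bᵒᵖ × B → Cat`, acting on 1-cells by `h ↦ f ≫ h ≫ g`. -/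
def homPseudofunctor : Bᵒᵖ × B ⥤ᵖ Cat.{w₁, v₁} where
  obj p := Cat.of (p.1.unop ⟶ p.2)
  map {p q} f := Functor.toCatHom
    { obj := fun h => f.1.unop ≫ h ≫ f.2
      map := fun η => f.1.unop ◁ η ▷ f.2 }
  map₂ {p q f g} η := NatTrans.toCatHom₂
    { app := fun h => η.1.unop2 ▷ (h ≫ f.2) ≫ g.1.unop ◁ h ◁ η.2
      naturality := fun h k θ => by
        dsimp only
        rw [whisker_exchange_assoc, Category.assoc, ← whiskerLeft_comp, ← whiskerLeft_comp,
          whisker_exchange] }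
  map₂_id {p q} f := cat_hom₂_ext fun (h : p.1.unop ⟶ p.2) => by
    change 𝟙 f.1.unop ▷ (h ≫ f.2) ≫ f.1.unop ◁ h ◁ 𝟙 f.2 = 𝟙 (f.1.unop ≫ h ≫ f.2)
    simp
  map₂_comp {p q f g k} η θ := cat_hom₂_ext fun (h : p.1.unop ⟶ p.2) => by
    change (η.1.unop2 ≫ θ.1.unop2) ▷ (h ≫ f.2) ≫ k.1.unop ◁ h ◁ (η.2 ≫ θ.2) =
      (η.1.unop2 ▷ (h ≫ f.2) ≫ g.1.unop ◁ h ◁ η.2) ≫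
        (θ.1.unop2 ▷ (h ≫ g.2) ≫ k.1.unop ◁ h ◁ θ.2)
    simp only [comp_whiskerRight, whiskerLeft_comp, Category.assoc]
    rw [whisker_exchange_assoc]
  mapId p := Cat.Hom.isoMk (NatIso.ofComponents
    (fun h => λ_ (h ≫ 𝟙 p.2) ≪≫ ρ_ h) (by
      intro (h : p.1.unop ⟶ p.2) (k : p.1.unop ⟶ p.2) θ
      change (𝟙 _ ◁ θ ▷ 𝟙 _) ≫ (λ_ (k ≫ 𝟙 p.2)).hom ≫ (ρ_ k).hom =
        ((λ_ (h ≫ 𝟙 p.2)).hom ≫ (ρ_ h).hom) ≫ θ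
      bicategory))
  mapComp {p q r} f g := Cat.Hom.isoMk (NatIso.ofComponents
    (fun h => α_ g.1.unop f.1.unop (h ≫ f.2 ≫ g.2) ≪≫
      whiskerLeftIso g.1.unop ((whiskerLeftIso f.1.unop (α_ h f.2 g.2).symm) ≪≫
        (α_ f.1.unop (h ≫ f.2) g.2).symm)) (by
      intro (h : p.1.unop ⟶ p.2) (k : p.1.unop ⟶ p.2) θ
      change (g.1.unop ≫ f.1.unop) ◁ θ ▷ (f.2 ≫ g.2) ≫
          (α_ g.1.unop f.1.unop (k ≫ f.2 ≫ g.2)).hom ≫ g.1.unop ◁ (f.1.unop ◁ (α_ k f.2 g.2).inv ≫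
            (α_ f.1.unop (k ≫ f.2) g.2).inv) =
        ((α_ g.1.unop f.1.unop (h ≫ f.2 ≫ g.2)).hom ≫
          g.1.unop ◁ (f.1.unop ◁ (α_ h f.2 g.2).inv ≫
            (α_ f.1.unop (h ≫ f.2) g.2).inv)) ≫ g.1.unop ◁ (f.1.unop ◁ θ ▷ f.2) ▷ g.2
      simp))
  map₂_whisker_left {p q r} f g h η := cat_hom₂_ext fun (k : p.1.unop ⟶ p.2) => by
    change (η.1.unop2 ▷ f.1.unop) ▷ (k ≫ f.2 ≫ g.2) ≫ (h.1.unop ≫ f.1.unop) ◁ k ◁ f.2 ◁ η.2 =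
      ((α_ g.1.unop f.1.unop (k ≫ f.2 ≫ g.2)).hom ≫ g.1.unop ◁ (f.1.unop ◁ (α_ k f.2 g.2).inv ≫
            (α_ f.1.unop (k ≫ f.2) g.2).inv)) ≫
      (η.1.unop2 ▷ ((f.1.unop ≫ k ≫ f.2) ≫ g.2) ≫ h.1.unop ◁ (f.1.unop ≫ k ≫ f.2) ◁ η.2) ≫
      (h.1.unop ◁ ((α_ f.1.unop (k ≫ f.2) h.2).hom ≫ f.1.unop ◁ (α_ k f.2 h.2).hom) ≫
        (α_ h.1.unop f.1.unop (k ≫ f.2 ≫ h.2)).inv)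
    bicategory
  map₂_whisker_right {p q r f g} η h := cat_hom₂_ext fun (k : p.1.unop ⟶ p.2) => by
    change (h.1.unop ◁ η.1.unop2) ▷ (k ≫ f.2 ≫ h.2) ≫ (h.1.unop ≫ g.1.unop) ◁ k ◁ η.2 ▷ h.2 =
      ((α_ h.1.unop f.1.unop (k ≫ f.2 ≫ h.2)).hom ≫ h.1.unop ◁ (f.1.unop ◁ (α_ k f.2 h.2).inv ≫
            (α_ f.1.unop (k ≫ f.2) h.2).inv)) ≫
      (h.1.unop ◁ (η.1.unop2 ▷ (k ≫ f.2) ≫ g.1.unop ◁ k ◁ η.2) ▷ h.2) ≫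
      (h.1.unop ◁ ((α_ g.1.unop (k ≫ g.2) h.2).hom ≫ g.1.unop ◁ (α_ k g.2 h.2).hom) ≫
        (α_ h.1.unop g.1.unop (k ≫ g.2 ≫ h.2)).inv)
    bicategory
  map₂_associator {p q r s} f g h := cat_hom₂_ext fun (k : p.1.unop ⟶ p.2) => by
    obtain ⟨f₁, f₂⟩ := f
    obtain ⟨g₁, g₂⟩ := g
    obtain ⟨h₁, h₂⟩ := h
    change (α_ h₁.unop g₁.unop f₁.unop).inv ▷ (k ≫ (f₂ ≫ g₂) ≫ h₂) ≫
        ((h₁.unop ≫ g₁.unop) ≫ f₁.unop) ◁ k ◁ (α_ f₂ g₂ h₂).hom =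
      ((α_ h₁.unop (g₁.unop ≫ f₁.unop) (k ≫ (f₂ ≫ g₂) ≫ h₂)).hom ≫
        h₁.unop ◁ ((g₁.unop ≫ f₁.unop) ◁ (α_ k (f₂ ≫ g₂) h₂).inv ≫
          (α_ (g₁.unop ≫ f₁.unop) (k ≫ f₂ ≫ g₂) h₂).inv)) ≫
      (h₁.unop ◁ ((α_ g₁.unop f₁.unop (k ≫ f₂ ≫ g₂)).hom ≫
        g₁.unop ◁ (f₁.unop ◁ (α_ k f₂ g₂).inv ≫ (α_ f₁.unop (k ≫ f₂) g₂).inv)) ▷ h₂) ≫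
      𝟙 _ ≫
      (h₁.unop ◁ ((α_ g₁.unop ((f₁.unop ≫ k ≫ f₂) ≫ g₂) h₂).hom ≫
        g₁.unop ◁ (α_ (f₁.unop ≫ k ≫ f₂) g₂ h₂).hom) ≫
        (α_ h₁.unop g₁.unop ((f₁.unop ≫ k ≫ f₂) ≫ g₂ ≫ h₂)).inv) ≫
      ((h₁.unop ≫ g₁.unop) ◁ ((α_ f₁.unop (k ≫ f₂) (g₂ ≫ h₂)).hom ≫
        f₁.unop ◁ (α_ k f₂ (g₂ ≫ h₂)).hom) ≫
        (α_ (h₁.unop ≫ g₁.unop) f₁.unop (k ≫ f₂ ≫ g₂ ≫ h₂)).inv)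
    bicategory
  map₂_left_unitor {p q} f := cat_hom₂_ext fun (k : p.1.unop ⟶ p.2) => by
    obtain ⟨f₁, f₂⟩ := f
    change (ρ_ f₁.unop).hom ▷ (k ≫ 𝟙 _ ≫ f₂) ≫ f₁.unop ◁ k ◁ (λ_ f₂).hom =
      ((α_ f₁.unop (𝟙 _) (k ≫ 𝟙 _ ≫ f₂)).hom ≫
        f₁.unop ◁ ((𝟙 _) ◁ (α_ k (𝟙 _) f₂).inv ≫ (α_ (𝟙 _) (k ≫ 𝟙 _) f₂).inv)) ≫
      f₁.unop ◁ ((λ_ (k ≫ 𝟙 _)).hom ≫ (ρ_ k).hom) ▷ f₂ ≫ 𝟙 _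
    bicategory
  map₂_right_unitor {p q} f := cat_hom₂_ext fun (k : p.1.unop ⟶ p.2) => by
    obtain ⟨f₁, f₂⟩ := f
    change (λ_ f₁.unop).hom ▷ (k ≫ f₂ ≫ 𝟙 _) ≫ f₁.unop ◁ k ◁ (ρ_ f₂).hom =
      ((α_ (𝟙 _) f₁.unop (k ≫ f₂ ≫ 𝟙 _)).hom ≫
        (𝟙 _) ◁ (f₁.unop ◁ (α_ k f₂ (𝟙 _)).inv ≫ (α_ f₁.unop (k ≫ f₂) (𝟙 _)).inv)) ≫
      ((λ_ ((f₁.unop ≫ k ≫ f₂) ≫ 𝟙 _)).hom ≫ (ρ_ (f₁.unop ≫ k ≫ f₂)).hom) ≫ 𝟙 _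
    bicategory

end Hom


section Whisker
variable {X : Type u₁} [Bicategory.{w₁, v₁} X] {Y : Type u₂} [Bicategory.{w₂, v₂} Y]
  {Z : Type u₃} [Bicategory.{w₃, v₃} Z]

/-- The whiskering `η F` of a pseudonatural transformation `η : G ⟶ H` with `F`. -/
def preWhisker (F : X ⥤ᵖ Y) {G H : Y ⥤ᵖ Z} (η : G ⟶ H) : F.comp G ⟶ F.comp H where
  app x := η.app (F.obj x)
  naturality f := η.naturality (F.map f)
  naturality_naturality θ := η.naturality_naturality (F.map₂ θ)
  naturality_id x := by
    change (η.naturality (F.map (𝟙 x))).hom ≫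
        η.app (F.obj x) ◁ (H.map₂ (F.mapId x).hom ≫ (H.mapId (F.obj x)).hom) =
      (G.map₂ (F.mapId x).hom ≫ (G.mapId (F.obj x)).hom) ▷ η.app (F.obj x) ≫
        (λ_ (η.app (F.obj x))).hom ≫ (ρ_ (η.app (F.obj x))).inv
    rw [whiskerLeft_comp, ← η.naturality_naturality_assoc, η.naturality_id, comp_whiskerRight,
      Category.assoc]
  naturality_comp {x y z} f g := by
    change (η.naturality (F.map (f ≫ g))).hom ≫ η.app (F.obj x) ◁ (H.map₂ (F.mapComp f g).hom ≫
        (H.mapComp (F.map f) (F.map g)).hom) =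
      (G.map₂ (F.mapComp f g).hom ≫ (G.mapComp (F.map f) (F.map g)).hom) ▷ η.app (F.obj z) ≫
        (α_ _ _ _).hom ≫ G.map (F.map f) ◁ (η.naturality (F.map g)).hom ≫ (α_ _ _ _).inv ≫
        (η.naturality (F.map f)).hom ▷ H.map (F.map g) ≫ (α_ _ _ _).hom
    rw [whiskerLeft_comp, ← η.naturality_naturality_assoc, η.naturality_comp, comp_whiskerRight,
      Category.assoc]
end Whisker

section Biadjunction
variable {A : Type u₁} [Bicategory.{w₁, v₁} A] {B : Type u₂} [Bicategory.{w₂, v₂} B]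
  {E : B ⥤ᵖ A} {R : A ⥤ᵖ B}

/-- For `η : 1 ⟶ R E`, the whiskering `E η : E ⟶ E R E`. -/
def unitPost (η : Pseudofunctor.id B ⟶ E.comp R) : E ⟶ E.comp (R.comp E) where
  app x := E.map (η.app x)
  naturality f := mapSquare E (η.naturality f)
  naturality_naturality {x y f g} θ :=
    mapSquare_naturality E (η.naturality f) (η.naturality g) θ (R.map₂ (E.map₂ θ))
      (η.naturality_naturality θ)
  naturality_id x := by
    have h1 : (E.mapId x).hom = E.map₂ (𝟙 (𝟙 x)) ≫ (E.mapId x).hom := by simp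
    have h2 : ((E.comp (R.comp E)).mapId x).hom =
        E.map₂ ((E.comp R).mapId x).hom ≫ (E.mapId (R.obj (E.obj x))).hom :=
      (E.map₂_comp_assoc (R.map₂ (E.mapId x).hom) (R.mapId (E.obj x)).hom _).symm
    rw [h1, h2]
    exact mapSquare_id E (η.app x) (𝟙 (𝟙 x)) ((E.comp R).mapId x).hom (η.naturality (𝟙 x))
      (η.naturality_id x)
  naturality_comp {x y z} f g := by
    have h1 : (E.mapComp f g).hom = E.map₂ (𝟙 (f ≫ g)) ≫ (E.mapComp f g).hom := by simp
    have h2 : ((E.comp (R.comp E)).mapComp f g).hom =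
        E.map₂ ((E.comp R).mapComp f g).hom ≫
          (E.mapComp (R.map (E.map f)) (R.map (E.map g))).hom :=
      (E.map₂_comp_assoc (R.map₂ (E.mapComp f g).hom) (R.mapComp (E.map f) (E.map g)).hom _).symm
    rw [h1, h2]
    exact mapSquare_comp E (𝟙 (f ≫ g)) ((E.comp R).mapComp f g).hom (η.naturality f)
      (η.naturality g) (η.naturality (f ≫ g)) (η.naturality_comp f g)

/-- For `κ : E R ⟶ 1`, the whiskering `κ E : E R E ⟶ E`. -/
def counitPre (κ : R.comp E ⟶ Pseudofunctor.id A) : E.comp (R.comp E) ⟶ E where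
  app x := κ.app (E.obj x)
  naturality f := κ.naturality (E.map f)
  naturality_naturality θ := κ.naturality_naturality (E.map₂ θ)
  naturality_id x := by
    have h1 : (E.mapId x).hom = ((E.comp (Pseudofunctor.id A)).mapId x).hom :=
      (Category.comp_id _).symm
    rw [h1]
    exact (preWhisker E κ).naturality_id x
  naturality_comp f g := by
    have h1 : (E.mapComp f g).hom = ((E.comp (Pseudofunctor.id A)).mapComp f g).hom :=
      (Category.comp_id _).symm
    rw [h1]
    exact (preWhisker E κ).naturality_comp f g

/-- For `η : 1 ⟶ R E`, the whiskering `η R : R ⟶ R E R`. -/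
def unitPre (η : Pseudofunctor.id B ⟶ E.comp R) : R ⟶ R.comp (E.comp R) where
  app a := η.app (R.obj a)
  naturality f := η.naturality (R.map f)
  naturality_naturality θ := η.naturality_naturality (R.map₂ θ)
  naturality_id a := by
    have h1 : (R.mapId a).hom = ((R.comp (Pseudofunctor.id B)).mapId a).hom :=
      (Category.comp_id _).symm
    rw [h1]
    exact (preWhisker R η).naturality_id a
  naturality_comp f g := by
    have h1 : (R.mapComp f g).hom = ((R.comp (Pseudofunctor.id B)).mapComp f g).hom :=
      (Category.comp_id _).symm
    rw [h1]
    exact (preWhisker R η).naturality_comp f g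

/-- For `κ : E R ⟶ 1`, the whiskering `R κ : R E R ⟶ R`. -/
def counitPost (κ : R.comp E ⟶ Pseudofunctor.id A) : R.comp (E.comp R) ⟶ R where
  app a := R.map (κ.app a)
  naturality f := mapSquare R (κ.naturality f)
  naturality_naturality {a b f g} θ :=
    mapSquare_naturality R (κ.naturality f) (κ.naturality g) (E.map₂ (R.map₂ θ)) θ
      (κ.naturality_naturality θ)
  naturality_id a := by
    have h1 : (R.mapId a).hom = R.map₂ (𝟙 (𝟙 a)) ≫ (R.mapId a).hom := by simp
    have h2 : ((R.comp (E.comp R)).mapId a).hom =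
        R.map₂ ((R.comp E).mapId a).hom ≫ (R.mapId (E.obj (R.obj a))).hom :=
      (R.map₂_comp_assoc (E.map₂ (R.mapId a).hom) (E.mapId (R.obj a)).hom _).symm
    rw [h1, h2]
    exact mapSquare_id R (κ.app a) ((R.comp E).mapId a).hom (𝟙 (𝟙 a)) (κ.naturality (𝟙 a))
      (κ.naturality_id a)
  naturality_comp f g := by
    have h1 : (R.mapComp f g).hom = R.map₂ (𝟙 (f ≫ g)) ≫ (R.mapComp f g).hom := by simp
    have h2 : ((R.comp (E.comp R)).mapComp f g).hom =
        R.map₂ ((R.comp E).mapComp f g).hom ≫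
          (R.mapComp (E.map (R.map f)) (E.map (R.map g))).hom :=
      (R.map₂_comp_assoc (E.map₂ (R.mapComp f g).hom) (E.mapComp (R.map f) (R.map g)).hom _).symm
    rw [h1, h2]
    exact mapSquare_comp R ((R.comp E).mapComp f g).hom (𝟙 (f ≫ g)) (κ.naturality f)
      (κ.naturality g) (κ.naturality (f ≫ g)) (κ.naturality_comp f g)

variable (E R) in
/-- `E` is left biadjoint to `R`: a unit `η : 1 ⟶ R E`, a counit `κ : E R ⟶ 1`, invertible
modifications `v : 1_E ≅ (κ E)(E η)` and `w : (R κ)(η R) ≅ 1_R`, and the two coherence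
(swallowtail) axioms: for each `x` the pasting
`η_x ≅ R(1) η_x ≅ R(κ_{Ex} E η_x) η_x ≅ R κ_{Ex} RE η_x η_x ≅ R κ_{Ex} η_{REx} η_x ≅ η_x`
of `v_x`, `η_{η_x}⁻¹` and `w_{Ex}` is the identity, and for each `a` the pasting
`κ_a ≅ κ_a κ_{ERa} E η_{Ra} ≅ κ_a ER κ_a E η_{Ra} ≅ κ_a E(R κ_a η_{Ra}) ≅ κ_a E(1) ≅ κ_a`
of `v_{Ra}`, `κ_{κ_a}⁻¹` and `w_a` is the identity. -/
structure Biadjunction where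
  /-- the unit `η` -/
  unit : Pseudofunctor.id B ⟶ E.comp R
  /-- the counit `κ` -/
  counit : R.comp E ⟶ Pseudofunctor.id A
  /-- the invertible modification `v` -/
  leftMod : 𝟙 E ≅ unitPost unit ≫ counitPre counit
  /-- the invertible modification `w` -/
  rightMod : unitPre unit ≫ counitPost counit ≅ 𝟙 R
  swallowtail_unit (x : B) :
    (ρ_ (unit.app x)).inv ≫ unit.app x ◁ ((R.mapId (E.obj x)).inv ≫
        R.map₂ (show 𝟙 (E.obj x) ⟶ E.map (unit.app x) ≫ counit.app (E.obj x) from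
          leftMod.hom.as.app x) ≫
        (R.mapComp (E.map (unit.app x)) (counit.app (E.obj x))).hom) ≫
      (α_ (unit.app x) (R.map (E.map (unit.app x))) (R.map (counit.app (E.obj x)))).inv ≫
      (show unit.app x ≫ R.map (E.map (unit.app x)) ⟶
          unit.app x ≫ unit.app (R.obj (E.obj x)) from (unit.naturality (unit.app x)).inv) ▷
        R.map (counit.app (E.obj x)) ≫
      (α_ (unit.app x) (unit.app (R.obj (E.obj x))) (R.map (counit.app (E.obj x)))).hom ≫
      unit.app x ◁ (show unit.app (R.obj (E.obj x)) ≫ R.map (counit.app (E.obj x)) ⟶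
          𝟙 (R.obj (E.obj x)) from rightMod.hom.as.app (E.obj x)) ≫
      (ρ_ (unit.app x)).hom = 𝟙 (unit.app x)
  swallowtail_counit (a : A) :
    (λ_ (counit.app a)).inv ≫
      (show 𝟙 (E.obj (R.obj a)) ⟶ E.map (unit.app (R.obj a)) ≫ counit.app (E.obj (R.obj a)) from
          leftMod.hom.as.app (R.obj a)) ▷ counit.app a ≫
      (α_ (E.map (unit.app (R.obj a))) (counit.app (E.obj (R.obj a))) (counit.app a)).hom ≫
      E.map (unit.app (R.obj a)) ◁ (show counit.app (E.obj (R.obj a)) ≫ counit.app a ⟶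
          E.map (R.map (counit.app a)) ≫ counit.app a from
          (counit.naturality (counit.app a)).inv) ≫
      (α_ (E.map (unit.app (R.obj a))) (E.map (R.map (counit.app a))) (counit.app a)).inv ≫
      ((E.mapComp (unit.app (R.obj a)) (R.map (counit.app a))).inv ≫
        E.map₂ (show unit.app (R.obj a) ≫ R.map (counit.app a) ⟶ 𝟙 (R.obj a) from
          rightMod.hom.as.app a) ≫
        (E.mapId (R.obj a)).hom) ▷ counit.app a ≫
      (λ_ (counit.app a)).hom = 𝟙 (counit.app a)

/-- `R` is right biadjoint: it has a left biadjoint. -/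
def IsRightBiadjoint (R : A ⥤ᵖ B) : Prop :=
  ∃ E : B ⥤ᵖ A, Nonempty (Biadjunction E R)
end Biadjunction

section Weighted
/-- For `F : X → K`, the pseudofunctor `K(-, F -) : Kᵒᵖ × X → Cat`. -/
def homTo {K : Type u₁} [Bicategory.{w₁, v₁} K] {X : Type u₂} [Bicategory.{w₂, v₂} X]
    (F : X ⥤ᵖ K) : Kᵒᵖ × X ⥤ᵖ Cat.{w₁, v₁} :=
  (prodMap (Pseudofunctor.id Kᵒᵖ) F).comp (homPseudofunctor K)

/-- For `D : Sᵒᵖ → A`, the pseudofunctor `A(D -, -) : S × A → Cat`. -/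
def homFrom {S : Type u₁} [Bicategory.{w₁, v₁} S] {A : Type u₂} [Bicategory.{w₂, v₂} A]
    (D : Sᵒᵖ ⥤ᵖ A) : S × A ⥤ᵖ Cat.{w₂, v₂} :=
  (prodMap (rightOp D) (Pseudofunctor.id A)).comp (homPseudofunctor A)

/-- The restriction `|D| : S₀ × A → K` of `D : S × A → K`, where `S₀` is the discrete 2-category on
the objects of `S`. -/
def restrictDiscrete {S : Type u₁} [Bicategory.{w₁, v₁} S] {A : Type u₂} [Bicategory.{w₂, v₂} A]
    {K : Type u₃} [Bicategory.{w₃, v₃} K] (D : S × A ⥤ᵖ K) :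
    LocallyDiscrete (Discrete S) × A ⥤ᵖ K :=
  (prodMap (discreteInclusion S) (Pseudofunctor.id A)).comp D

/-- `|D|` can be factorized through `B(-, R -)`: there are a pseudofunctor `D' : S₀ → Bᵒᵖ` and a
pseudonatural equivalence `|D| ≃ B(-, R -) ∘ (D' × 1)`. -/
def FactorsThrough {S : Type u₁} [Bicategory.{w₁, v₁} S] {A : Type u₂} [Bicategory.{w₂, v₂} A]
    {B : Type u₃} [Bicategory.{w₃, v₃} B] (D : S × A ⥤ᵖ Cat.{w₃, v₃}) (R : A ⥤ᵖ B) : Prop :=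
  ∃ D' : LocallyDiscrete (Discrete S) ⥤ᵖ Bᵒᵖ, Nonempty (Bicategory.Equivalence
    (restrictDiscrete D) ((prodMap D' (Pseudofunctor.id A)).comp (homTo R)))

/-- The pseudofunctor `a ↦ [S, Cat]_PS (W, P(-, a))`. -/
def weightedHom {S : Type v} [Bicategory.{v, v} S] {A : Type u₁} [Bicategory.{w₁, v₁} A]
    (W : S ⥤ᵖ Cat.{v, v}) (P : S × A ⥤ᵖ Cat.{v, v}) : A ⥤ᵖ Cat.{v, v} :=
  (curry P).comp (corep W)

/-- `L a` is the weighted bilimit `{W, T(-, a)}_bi` in `K`, pseudonaturally in `a`: there is an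
equivalence `K(X, L a) ≃ [S, Cat]_PS (W, K(X, T(-, a)))`, pseudonatural in `X` and in `a`. -/
def IsWeightedBilimitFamily {S : Type v} [Bicategory.{v, v} S] {A : Type u₁}
    [Bicategory.{w₁, v₁} A] {K : Type u₂} [Bicategory.{v, v} K]
    (W : S ⥤ᵖ Cat.{v, v}) (T : S × A ⥤ᵖ K) (L : A ⥤ᵖ K) : Prop :=
  Nonempty (Bicategory.Equivalence (homTo L)
    (weightedHom W ((prodExchange S Kᵒᵖ A).comp (homTo T))))

/-- `G` is the weighted bicolimit of `D : Sᵒᵖ → A` with weight `W : S → Cat`: there is an equivalence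
`A(G, X) ≃ [S, Cat]_PS (W, A(D -, X))`, pseudonatural in `X`. -/
def IsWeightedBicolimit {S : Type v} [Bicategory.{v, v} S] {A : Type u₁} [Bicategory.{v, v} A]
    (W : S ⥤ᵖ Cat.{v, v}) (D : Sᵒᵖ ⥤ᵖ A) (G : A) : Prop :=
  Nonempty (Bicategory.Equivalence (corep G) (weightedHom W (homFrom D)))
end Weighted

end BiLift

open CategoryTheory Bicategory Opposite
open scoped CategoryTheory.Pseudofunctor.StrongTrans

namespace BiLift

/-! ### Interchange of whiskered 2-cells, with the associators spelled out. -/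

section Exchange
variable {C : Type u₃} [Bicategory.{w₃, v₃} C]

/-! The theorem reduces to representability, handled through universal elements: for `F : A → Cat`,
an element `u` of `F a` is universal when every functor `f ↦ (F f) u` from `A(a, b)` to `F b` is an
equivalence. By the Yoneda lemma such a `u` exists at `a` exactly when `A(a, -) ≃ F`
(`exists_isUniversalElement_iff`).

Existence of the `𝒜_y`. If `E` is left biadjoint to `R`, then `D_y(s, -) ≃ B(D'_y s, R -) ≃ A(E
(D'_y s), -)`, so each `D_y(s, -)` is representable (`FactorsThrough.exists_isUniversalElement`).
The factorization through `R` is only given on the discrete 2-category of objects of `S`; dependence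
on the 1-cells and 2-cells of `S` is recovered because the Yoneda pseudofunctor from `Aᵒᵖ` to `[A,
Cat]_PS` is locally an equivalence (`isEquivalence_coyoneda_mapFunctor`,
`exists_equivalence_homFrom`).

The criterion. `J` is right biadjoint exactly when each `C(y, J -)` has a universal element
(`Biadjunction.isUniversalElement`, `exists_biadjunction`). Taking `X` to be the point in hypothesis
(b) gives `C(y, J a) ≃ [S, Cat]_PS (W, D_y(-, a)) ≃ [S, Cat]_PS (W, A(𝒜_y -, a))`, naturally in `a`.
So `G` carries a universal element of `C(y, J -)` if and only if `G` is the bicolimit of `𝒜_y`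
weighted by `W` (`exists_isUniversalElement_iff_isWeightedBicolimit`).

Two devices keep the coherence under control. First, universal arrows `K x ⟶ J (G x)` are viewed as
objects of an iso-comma bicategory. A 1-cell out of such an object is determined up to isomorphism,
and a 2-cell exactly, by its component in `X` (`IsoComma.hom₂_ext_left`), so every axiom for the
induced pseudofunctor, unit, counit and modifications follows from an easy identity on left
components. This is used twice: with `K` the identity, to build the left biadjoint of `J`, and with
the Yoneda pseudofunctor as target, to build `𝒜_y`. Second, universal elements transfer along
families of equivalences that are natural up to isomorphism with no condition on identities and
composites (`PreTrans`), so most comparisons need no coherence check at all. -/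

theorem exchange_left {x y z z' t : C} {f g : x ⟶ y} (θ : f ⟶ g) {a : y ⟶ z} {b : z ⟶ t}
    {c : y ⟶ z'} {d : z' ⟶ t} (σ : a ≫ b ⟶ c ≫ d) :
    θ ▷ a ▷ b ≫ (α_ g a b).hom ≫ g ◁ σ =
      (α_ f a b).hom ≫ f ◁ σ ≫ (α_ f c d).inv ≫ θ ▷ c ▷ d ≫ (α_ g c d).hom := by
  have h := whisker_exchange θ σ
  simp only [whiskerRight_comp] at h
  rw [← cancel_mono (α_ g c d).inv]
  simp only [Category.assoc, Iso.hom_inv_id, Category.comp_id] at h ⊢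
  simpa using ((α_ f a b).hom ≫= h.symm) =≫ (α_ g c d).inv

theorem exchange_right {x y y' z t : C} {a : x ⟶ y} {b : y ⟶ z} {c : x ⟶ y'} {d : y' ⟶ z}
    (σ : a ≫ b ⟶ c ≫ d) {f g : z ⟶ t} (θ : f ⟶ g) :
    a ◁ b ◁ θ ≫ (α_ a b g).inv ≫ σ ▷ g =
      (α_ a b f).inv ≫ σ ▷ f ≫ (α_ c d f).hom ≫ c ◁ d ◁ θ ≫ (α_ c d g).inv := by
  have h := whisker_exchange σ θ
  simp only [comp_whiskerLeft, Category.assoc] at h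
  rw [← h, Iso.inv_hom_id_assoc]

end Exchange

/-! ### The iso-comma bicategory of two pseudofunctors. -/

section IsoComma
variable {X : Type u₁} [Bicategory.{w₁, v₁} X] {Z : Type u₂} [Bicategory.{w₂, v₂} Z]
  {C : Type u₃} [Bicategory.{w₃, v₃} C]

/-- Objects of the iso-comma bicategory of `K : X → C` and `J : Z → C`. -/
structure IsoComma (K : X ⥤ᵖ C) (J : Z ⥤ᵖ C) where
  /-- the object of `X` -/
  left : X
  /-- the object of `Z` -/
  right : Z
  /-- the connecting 1-cell -/
  arr : K.obj left ⟶ J.obj right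

namespace IsoComma
variable {K : X ⥤ᵖ C} {J : Z ⥤ᵖ C}

/-- 1-cells of the iso-comma bicategory: squares filled with an invertible 2-cell. -/
structure Hom (p q : IsoComma K J) where
  /-- the 1-cell of `X` -/
  left : p.left ⟶ q.left
  /-- the 1-cell of `Z` -/
  right : p.right ⟶ q.right
  /-- the invertible 2-cell -/
  sq : K.map left ≫ q.arr ≅ p.arr ≫ J.map right

/-- 2-cells of the iso-comma bicategory. -/
structure Hom₂ {p q : IsoComma K J} (f g : Hom p q) where
  /-- the 2-cell of `X` -/
  left : f.left ⟶ g.left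
  /-- the 2-cell of `Z` -/
  right : f.right ⟶ g.right
  w : K.map₂ left ▷ q.arr ≫ g.sq.hom = f.sq.hom ≫ p.arr ◁ J.map₂ right

theorem Hom₂.ext' {p q : IsoComma K J} {f g : Hom p q} {x y : Hom₂ f g} (h : x.left = y.left)
    (h' : x.right = y.right) : x = y := by
  cases x; cases y; cases h; cases h'; rfl

instance : CategoryStruct (IsoComma K J) where
  Hom := Hom
  id p :=
    { left := 𝟙 _
      right := 𝟙 _
      sq := whiskerRightIso (K.mapId p.left) p.arr ≪≫ λ_ _ ≪≫ (ρ_ _).symm ≪≫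
        whiskerLeftIso p.arr (J.mapId p.right).symm }
  comp {p _ r} f g :=
    { left := f.left ≫ g.left
      right := f.right ≫ g.right
      sq := whiskerRightIso (K.mapComp f.left g.left) r.arr ≪≫ α_ _ _ _ ≪≫
        whiskerLeftIso (K.map f.left) g.sq ≪≫ (α_ _ _ _).symm ≪≫
        whiskerRightIso f.sq (J.map g.right) ≪≫ α_ _ _ _ ≪≫
        whiskerLeftIso p.arr (J.mapComp f.right g.right).symm }

instance homCategory (p q : IsoComma K J) : Category (p ⟶ q) where
  Hom f g := Hom₂ f g
  id f := ⟨𝟙 _, 𝟙 _, by simp⟩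
  comp {f g h} x y := ⟨x.left ≫ y.left, x.right ≫ y.right, by
    rw [K.map₂_comp, J.map₂_comp, comp_whiskerRight, whiskerLeft_comp, Category.assoc, y.w,
      ← Category.assoc, x.w, Category.assoc]⟩

@[simp] theorem id_left (p : IsoComma K J) : Hom.left (𝟙 p) = 𝟙 p.left := rfl
@[simp] theorem id_right (p : IsoComma K J) : Hom.right (𝟙 p) = 𝟙 p.right := rfl
@[simp] theorem comp_left {p q r : IsoComma K J} (f : p ⟶ q) (g : q ⟶ r) :
    Hom.left (f ≫ g) = f.left ≫ g.left := rfl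
@[simp] theorem comp_right {p q r : IsoComma K J} (f : p ⟶ q) (g : q ⟶ r) :
    Hom.right (f ≫ g) = f.right ≫ g.right := rfl

theorem id_sq_hom (p : IsoComma K J) : (Hom.sq (𝟙 p)).hom =
    (K.mapId p.left).hom ▷ p.arr ≫ (λ_ p.arr).hom ≫ (ρ_ p.arr).inv ≫
      p.arr ◁ (J.mapId p.right).inv := rfl

theorem comp_sq_hom {p q r : IsoComma K J} (f : p ⟶ q) (g : q ⟶ r) : (Hom.sq (f ≫ g)).hom =
    (K.mapComp f.left g.left).hom ▷ r.arr ≫ (α_ _ _ _).hom ≫ K.map f.left ◁ g.sq.hom ≫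
      (α_ _ _ _).inv ≫ f.sq.hom ▷ J.map g.right ≫ (α_ _ _ _).hom ≫
      p.arr ◁ (J.mapComp f.right g.right).inv := rfl

theorem hom₂_ext {p q : IsoComma K J} {f g : p ⟶ q} {x y : f ⟶ g} (h : x.left = y.left)
    (h' : x.right = y.right) : x = y := Hom₂.ext' h h'

theorem hom₂_w {p q : IsoComma K J} {f g : p ⟶ q} (x : f ⟶ g) :
    K.map₂ x.left ▷ q.arr ≫ g.sq.hom = f.sq.hom ≫ p.arr ◁ J.map₂ x.right := x.w

/-- Construct an invertible 2-cell from invertible components. -/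
def isoMk {p q : IsoComma K J} {f g : p ⟶ q} (l : f.left ≅ g.left) (r : f.right ≅ g.right)
    (w : K.map₂ l.hom ▷ q.arr ≫ g.sq.hom = f.sq.hom ≫ p.arr ◁ J.map₂ r.hom) : f ≅ g where
  hom := ⟨l.hom, r.hom, w⟩
  inv := ⟨l.inv, r.inv, by
    rw [← cancel_epi (K.map₂ l.hom ▷ q.arr), ← Category.assoc, ← comp_whiskerRight,
      ← K.map₂_comp, l.hom_inv_id, K.map₂_id, id_whiskerRight, Category.id_comp,
      ← Category.assoc, w, Category.assoc, ← whiskerLeft_comp, ← J.map₂_comp, r.hom_inv_id,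
      J.map₂_id, whiskerLeft_id, Category.comp_id]⟩
  hom_inv_id := hom₂_ext l.hom_inv_id r.hom_inv_id
  inv_hom_id := hom₂_ext l.inv_hom_id r.inv_hom_id

/-- Apart from the condition satisfied by `x`, the only input is the interchange of `J.map₂ x.right`
with the square of `f`. -/
theorem whiskerLeft_w {p q r : IsoComma K J} (f : p ⟶ q) {g h : q ⟶ r} (x : g ⟶ h) :
    K.map₂ (f.left ◁ x.left) ▷ r.arr ≫ (Hom.sq (f ≫ h)).hom =
      (Hom.sq (f ≫ g)).hom ≫ p.arr ◁ J.map₂ (f.right ◁ x.right) := by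
  have hx := congrArg (K.map f.left ◁ ·) (hom₂_w x)
  simp only [whiskerLeft_comp] at hx
  simp only [comp_sq_hom, K.map₂_whisker_left, J.map₂_whisker_left, comp_whiskerRight,
    whiskerLeft_comp, Category.assoc, inv_hom_whiskerRight_assoc, whiskerLeft_inv_hom_assoc,
    whisker_assoc, Iso.inv_hom_id_assoc, reassoc_of% hx,
    reassoc_of% (exchange_right f.sq.hom (J.map₂ x.right))]

theorem whiskerRight_w {p q r : IsoComma K J} {f g : p ⟶ q} (x : f ⟶ g) (h : q ⟶ r) :
    K.map₂ (x.left ▷ h.left) ▷ r.arr ≫ (Hom.sq (g ≫ h)).hom =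
      (Hom.sq (f ≫ h)).hom ≫ p.arr ◁ J.map₂ (x.right ▷ h.right) := by
  have hx := congrArg (· ▷ J.map h.right) (hom₂_w x)
  have ex := whisker_exchange (K.map₂ x.left) h.sq.hom
  simp only [comp_whiskerRight, whisker_assoc] at hx
  simp only [comp_sq_hom, K.map₂_whisker_right, J.map₂_whisker_right, comp_whiskerRight,
    whiskerLeft_comp, Category.assoc, inv_hom_whiskerRight_assoc, whiskerLeft_inv_hom_assoc,
    associator_naturality_left_assoc]
  rw [← reassoc_of% ex]
  simp only [whiskerRight_comp, Category.assoc, Iso.hom_inv_id_assoc]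
  rw [reassoc_of% hx]
  simp

/-- The two bracketings of three pasted squares differ by sliding `K.mapComp f.left g.left` past the
square of `h` and `J.mapComp g.right h.right` past the square of `f`. Each slide is one interchange.
-/
theorem associator_w {p q r s : IsoComma K J} (f : p ⟶ q) (g : q ⟶ r) (h : r ⟶ s) :
    K.map₂ (α_ f.left g.left h.left).hom ▷ s.arr ≫ (Hom.sq (f ≫ g ≫ h)).hom =
      (Hom.sq ((f ≫ g) ≫ h)).hom ≫ p.arr ◁ J.map₂ (α_ f.right g.right h.right).hom := by
  have ex := exchange_left (K.mapComp f.left g.left).hom h.sq.hom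
  simp only [comp_whiskerLeft] at ex
  rw [← cancel_mono (α_ _ _ _).inv] at ex
  simp only [Category.assoc, Iso.hom_inv_id, Category.comp_id] at ex
  simp [comp_sq_hom, reassoc_of% (exchange_right f.sq.hom (J.mapComp g.right h.right).inv),
    ← reassoc_of% ex]

theorem leftUnitor_w {p q : IsoComma K J} (f : p ⟶ q) :
    K.map₂ (λ_ f.left).hom ▷ q.arr ≫ f.sq.hom =
      (Hom.sq (𝟙 p ≫ f)).hom ≫ p.arr ◁ J.map₂ (λ_ f.right).hom := by
  simp [comp_sq_hom, id_sq_hom, ← reassoc_of% (exchange_left (K.mapId p.left).hom f.sq.hom)]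

theorem rightUnitor_w {p q : IsoComma K J} (f : p ⟶ q) :
    K.map₂ (ρ_ f.left).hom ▷ q.arr ≫ f.sq.hom =
      (Hom.sq (f ≫ 𝟙 q)).hom ≫ p.arr ◁ J.map₂ (ρ_ f.right).hom := by
  simp [comp_sq_hom, id_sq_hom, reassoc_of% (exchange_right f.sq.hom (J.mapId q.right).inv)]

/-- A 2-cell is determined by its two components, so every axiom splits into the same axiom in `X`
and in `Z`. -/
instance bicategory : Bicategory (IsoComma K J) where
  homCategory := homCategory
  whiskerLeft f _ _ x := ⟨f.left ◁ x.left, f.right ◁ x.right, whiskerLeft_w f x⟩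
  whiskerRight x h := ⟨x.left ▷ h.left, x.right ▷ h.right, whiskerRight_w x h⟩
  associator f g h := isoMk (α_ f.left g.left h.left) (α_ f.right g.right h.right)
    (associator_w f g h)
  leftUnitor f := isoMk (λ_ f.left) (λ_ f.right) (leftUnitor_w f)
  rightUnitor f := isoMk (ρ_ f.left) (ρ_ f.right) (rightUnitor_w f)
  whiskerLeft_id _ _ := hom₂_ext (whiskerLeft_id _ _) (whiskerLeft_id _ _)
  whiskerLeft_comp _ _ _ _ _ _ := hom₂_ext (whiskerLeft_comp _ _ _) (whiskerLeft_comp _ _ _)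
  id_whiskerLeft _ := hom₂_ext (id_whiskerLeft _) (id_whiskerLeft _)
  comp_whiskerLeft _ _ _ _ _ := hom₂_ext (comp_whiskerLeft _ _ _) (comp_whiskerLeft _ _ _)
  id_whiskerRight _ _ := hom₂_ext (id_whiskerRight _ _) (id_whiskerRight _ _)
  comp_whiskerRight _ _ _ := hom₂_ext (comp_whiskerRight _ _ _) (comp_whiskerRight _ _ _)
  whiskerRight_id _ := hom₂_ext (whiskerRight_id _) (whiskerRight_id _)
  whiskerRight_comp _ _ _ := hom₂_ext (whiskerRight_comp _ _ _) (whiskerRight_comp _ _ _)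
  whisker_assoc _ _ _ _ _ := hom₂_ext (whisker_assoc _ _ _) (whisker_assoc _ _ _)
  whisker_exchange _ _ := hom₂_ext (whisker_exchange _ _) (whisker_exchange _ _)
  pentagon _ _ _ _ := hom₂_ext (pentagon _ _ _ _) (pentagon _ _ _ _)
  triangle _ _ := hom₂_ext (triangle _ _) (triangle _ _)

end IsoComma
end IsoComma

/-! ### Universal objects, and the pseudofunctor they induce. -/

section Section
variable {X : Type u₁} [Bicategory.{w₁, v₁} X] {Z : Type u₂} [Bicategory.{w₂, v₂} Z]
  {C : Type u₃} [Bicategory.{w₃, v₃} C] {K : X ⥤ᵖ C} {J : Z ⥤ᵖ C}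

namespace IsoComma

/-- The functor `f ↦ p.arr ≫ J f`. -/
def homFunctor (p : IsoComma K J) (z : Z) : (p.right ⟶ z) ⥤ (K.obj p.left ⟶ J.obj z) where
  obj f := p.arr ≫ J.map f
  map γ := p.arr ◁ J.map₂ γ

/-- `p` is universal if the functors `f ↦ p.arr ≫ J f` are equivalences. -/
def IsUniversal (p : IsoComma K J) : Prop := ∀ z, (p.homFunctor z).IsEquivalence

variable {p q : IsoComma K J}

/-- Essential surjectivity at `K.map φ ≫ q.arr` provides the right component together with the
invertible square. -/
theorem exists_hom_left_eq (hp : p.IsUniversal) (φ : p.left ⟶ q.left) :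
    ∃ f : p ⟶ q, f.left = φ := by
  have := hp q.right
  exact ⟨⟨φ, (p.homFunctor q.right).objPreimage (K.map φ ≫ q.arr),
    ((p.homFunctor q.right).objObjPreimageIso (K.map φ ≫ q.arr)).symm⟩, rfl⟩

/-- Since the square of `f` is invertible, compatibility expresses `p.arr ◁ J.map₂ x.right` through
`x.left`, and faithfulness recovers `x.right`. Coherence in the iso-comma bicategory thereby becomes
coherence in `X`, where it is nearly trivial. -/
theorem hom₂_ext_left (hp : p.IsUniversal) {f g : p ⟶ q} {x y : f ⟶ g} (h : x.left = y.left) :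
    x = y := by
  have := hp q.right
  refine hom₂_ext h ((p.homFunctor q.right).map_injective ?_)
  change p.arr ◁ J.map₂ x.right = p.arr ◁ J.map₂ y.right
  rw [← cancel_epi f.sq.hom, ← hom₂_w, ← hom₂_w, h]

/-- Compatibility prescribes the image of the right component under the functor `f ↦ p.arr ≫ J f`;
fullness supplies a preimage. -/
theorem exists_hom₂_left_eq (hp : p.IsUniversal) {f g : p ⟶ q} (β : f.left ⟶ g.left) :
    ∃ x : f ⟶ g, x.left = β := by
  have := hp q.right
  refine ⟨⟨β, (p.homFunctor q.right).preimage
    (f.sq.inv ≫ K.map₂ β ▷ q.arr ≫ g.sq.hom : p.arr ≫ J.map f.right ⟶ p.arr ≫ J.map g.right),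
    ?_⟩, rfl⟩
  have h := (p.homFunctor q.right).map_preimage (X := f.right) (Y := g.right)
    (f.sq.inv ≫ K.map₂ β ▷ q.arr ≫ g.sq.hom : p.arr ≫ J.map f.right ⟶ p.arr ≫ J.map g.right)
  change p.arr ◁ J.map₂ _ = _ at h
  rw [h, Iso.hom_inv_id_assoc]

/-- A 1-cell out of a universal object, with prescribed left component. -/
noncomputable def lift (hp : p.IsUniversal) (φ : p.left ⟶ q.left) : p ⟶ q :=
  -- The chosen 1-cell has left component equal to `φ` only propositionally. Rebuilding it with `φ`
  -- in place, at the cost of an `eqToIso` in the square, makes the left component reduce to `φ`, as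
  -- the later `rfl` and `change` steps require.
  ⟨φ, (exists_hom_left_eq hp φ).choose.right,
    whiskerRightIso (K.map₂Iso (eqToIso (exists_hom_left_eq hp φ).choose_spec.symm)) q.arr ≪≫
      (exists_hom_left_eq hp φ).choose.sq⟩

/-- A 2-cell out of a universal object, with prescribed left component. -/
noncomputable def lift₂ (hp : p.IsUniversal) {f g : p ⟶ q} (β : f.left ⟶ g.left) : f ⟶ g :=
  ⟨β, (exists_hom₂_left_eq hp β).choose.right, by
    have h := hom₂_w (exists_hom₂_left_eq hp β).choose
    rwa [(exists_hom₂_left_eq hp β).choose_spec] at h⟩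

/-- An invertible 2-cell out of a universal object, with prescribed left component. -/
noncomputable def liftIso (hp : p.IsUniversal) {f g : p ⟶ q} (β : f.left ≅ g.left) : f ≅ g where
  hom := lift₂ hp β.hom
  inv := lift₂ hp β.inv
  hom_inv_id := hom₂_ext_left hp β.hom_inv_id
  inv_hom_id := hom₂_ext_left hp β.inv_hom_id

/-- Expanding the square of an identity 1-cell turns the compatibility condition on the 2-cell with
right component `e` into the unit axiom of a pseudonatural transformation. `naturality_comp_of_w`
does the same for composites. -/
theorem naturality_id_of_w {x : X} {z : Z} {a : K.obj x ⟶ J.obj z} {r : z ⟶ z}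
    (s : K.map (𝟙 x) ≫ a ≅ a ≫ J.map r) (e : r ⟶ 𝟙 z)
    (h : K.map₂ (𝟙 (𝟙 x)) ▷ a ≫ (Hom.sq (𝟙 (IsoComma.mk x z a : IsoComma K J))).hom =
      s.hom ≫ a ◁ J.map₂ e) :
    s.hom ≫ a ◁ (J.map₂ e ≫ (J.mapId z).hom) =
      (K.mapId x).hom ▷ a ≫ (λ_ a).hom ≫ (ρ_ a).inv := by
  rw [whiskerLeft_comp, ← Category.assoc, ← h, id_sq_hom]
  simp

theorem naturality_comp_of_w {p q r : IsoComma K J} (f : p ⟶ q) (g : q ⟶ r)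
    {k : p.right ⟶ r.right} (s : K.map (f.left ≫ g.left) ≫ r.arr ≅ p.arr ≫ J.map k)
    (e : k ⟶ f.right ≫ g.right)
    (h : K.map₂ (𝟙 (f.left ≫ g.left)) ▷ r.arr ≫ (Hom.sq (f ≫ g)).hom =
      s.hom ≫ p.arr ◁ J.map₂ e) :
    s.hom ≫ p.arr ◁ (J.map₂ e ≫ (J.mapComp f.right g.right).hom) =
      (K.mapComp f.left g.left).hom ▷ r.arr ≫ (α_ _ _ _).hom ≫ K.map f.left ◁ g.sq.hom ≫
        (α_ _ _ _).inv ≫ f.sq.hom ▷ J.map g.right ≫ (α_ _ _ _).hom := by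
  rw [whiskerLeft_comp, ← Category.assoc, ← h, comp_sq_hom]
  simp

end IsoComma

variable (G : X → Z) (η : ∀ x, K.obj x ⟶ J.obj (G x))
  (hη : ∀ x, (IsoComma.mk x (G x) (η x) : IsoComma K J).IsUniversal)

open IsoComma

/-- The section of the projection to `X` given by a family of universal objects. -/
noncomputable def universalSection : X ⥤ᵖ IsoComma K J where
  obj x := ⟨x, G x, η x⟩
  map φ := lift (hη _) φ
  map₂ β := lift₂ (hη _) β
  -- On left components the section is the identity pseudofunctor of `X`, with identity constraints.
  -- Each axiom is therefore an identity in `X` up to whiskered identities.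
  map₂_id _ := hom₂_ext_left (hη _) rfl
  map₂_comp _ _ := hom₂_ext_left (hη _) rfl
  mapId x := liftIso (hη _) (Iso.refl (𝟙 x))
  mapComp φ ψ := liftIso (hη _) (Iso.refl (φ ≫ ψ))
  map₂_whisker_left φ _ _ β := hom₂_ext_left (hη _) (by
    change φ ◁ β = 𝟙 _ ≫ φ ◁ β ≫ 𝟙 _
    simp)
  map₂_whisker_right β φ := hom₂_ext_left (hη _) (by
    change β ▷ φ = 𝟙 _ ≫ β ▷ φ ≫ 𝟙 _
    simp)
  map₂_associator φ ψ χ := hom₂_ext_left (hη _) (by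
    change (α_ φ ψ χ).hom = 𝟙 _ ≫ 𝟙 (φ ≫ ψ) ▷ χ ≫ (α_ φ ψ χ).hom ≫ φ ◁ 𝟙 (ψ ≫ χ) ≫ 𝟙 _
    simp)
  map₂_left_unitor {x _} φ := hom₂_ext_left (hη _) (by
    change (λ_ φ).hom = 𝟙 _ ≫ 𝟙 (𝟙 x) ▷ φ ≫ (λ_ φ).hom
    simp)
  map₂_right_unitor {_ y} φ := hom₂_ext_left (hη _) (by
    change (ρ_ φ).hom = 𝟙 _ ≫ φ ◁ 𝟙 (𝟙 y) ≫ (ρ_ φ).hom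
    simp)

/-- The right component of a 2-isomorphism. -/
def IsoComma.rightIso {p q : IsoComma K J} {f g : p ⟶ q} (x : f ≅ g) :
    f.right ≅ g.right where
  hom := x.hom.right
  inv := x.inv.right
  hom_inv_id := congrArg Hom₂.right x.hom_inv_id
  inv_hom_id := congrArg Hom₂.right x.inv_hom_id

/-- The pseudofunctor `x ↦ G x` determined by universal arrows `K x ⟶ J (G x)`. -/
noncomputable def universalFunctor : X ⥤ᵖ Z where
  obj := G
  map φ := ((universalSection G η hη).map φ).right
  map₂ β := ((universalSection G η hη).map₂ β).right
  map₂_id φ := congrArg Hom₂.right ((universalSection G η hη).map₂_id φ)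
  map₂_comp β γ := congrArg Hom₂.right ((universalSection G η hη).map₂_comp β γ)
  mapId x := rightIso ((universalSection G η hη).mapId x)
  mapComp φ ψ := rightIso ((universalSection G η hη).mapComp φ ψ)
  map₂_whisker_left φ _ _ β :=
    congrArg Hom₂.right ((universalSection G η hη).map₂_whisker_left φ β)
  map₂_whisker_right β φ :=
    congrArg Hom₂.right ((universalSection G η hη).map₂_whisker_right β φ)
  map₂_associator φ ψ χ :=
    congrArg Hom₂.right ((universalSection G η hη).map₂_associator φ ψ χ)
  map₂_left_unitor φ := congrArg Hom₂.right ((universalSection G η hη).map₂_left_unitor φ)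
  map₂_right_unitor φ := congrArg Hom₂.right ((universalSection G η hη).map₂_right_unitor φ)

/-- The universal arrows form a pseudonatural transformation. -/
noncomputable def universalUnit : K ⟶ (universalFunctor G η hη).comp J where
  app := η
  naturality φ := ((universalSection G η hη).map φ).sq
  naturality_naturality β := hom₂_w ((universalSection G η hη).map₂ β)
  naturality_id x := naturality_id_of_w _ ((universalFunctor G η hη).mapId x).hom
    (hom₂_w ((universalSection G η hη).mapId x).hom)
  naturality_comp φ ψ := naturality_comp_of_w ((universalSection G η hη).map φ)
    ((universalSection G η hη).map ψ) _ ((universalFunctor G η hη).mapComp φ ψ).hom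
    (hom₂_w ((universalSection G η hη).mapComp φ ψ).hom)

end Section

/-! ### Universal arrows assemble into a biadjunction. -/

section UniversalBiadjunction
variable {A : Type u₁} [Bicategory.{w₁, v₁} A] {B : Type u₂} [Bicategory.{w₂, v₂} B]
  {J : A ⥤ᵖ B}

section Aux

theorem idComma_map₂_w {a b : A} {f g : a ⟶ b} (γ : f ⟶ g) :
    J.map₂ γ ▷ 𝟙 (J.obj b) ≫ (ρ_ (J.map g)).hom ≫ (λ_ (J.map g)).inv =
      ((ρ_ (J.map f)).hom ≫ (λ_ (J.map f)).inv) ≫ 𝟙 (J.obj a) ◁ J.map₂ γ := by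
  simp

theorem idComma_mapId_w (a : A) :
    (J.mapId a).hom ▷ 𝟙 (J.obj a) ≫ 𝟙 (𝟙 (J.obj a)) ▷ 𝟙 (J.obj a) ≫ (λ_ (𝟙 (J.obj a))).hom ≫
        (ρ_ (𝟙 (J.obj a))).inv ≫ 𝟙 (J.obj a) ◁ (J.mapId a).inv =
      ((ρ_ (J.map (𝟙 a))).hom ≫ (λ_ (J.map (𝟙 a))).inv) ≫ 𝟙 (J.obj a) ◁ J.map₂ (𝟙 (𝟙 a)) := by
  simp [unitors_equal]

theorem idComma_mapComp_w {a b c : A} (f : a ⟶ b) (g : b ⟶ c) :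
    (J.mapComp f g).hom ▷ 𝟙 (J.obj c) ≫ 𝟙 (J.map f ≫ J.map g) ▷ 𝟙 (J.obj c) ≫ (α_ _ _ _).hom ≫
        J.map f ◁ ((ρ_ (J.map g)).hom ≫ (λ_ (J.map g)).inv) ≫ (α_ _ _ _).inv ≫
        ((ρ_ (J.map f)).hom ≫ (λ_ (J.map f)).inv) ▷ J.map g ≫ (α_ _ _ _).hom ≫
        𝟙 (J.obj a) ◁ (J.mapComp f g).inv =
      ((ρ_ (J.map (f ≫ g))).hom ≫ (λ_ (J.map (f ≫ g))).inv) ≫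
        𝟙 (J.obj a) ◁ J.map₂ (𝟙 (f ≫ g)) := by
  simp

/-- This is the compatibility condition that makes the naturality cell of the unit, on the left, and
unitors, on the right, into the 2-cell `unitCommaNaturality`. Its content is the interchange of `n`
with `J.mapId`. -/
theorem unitComma_naturality_w {x y : B} {c d : A} {φ : x ⟶ y} {h : x ⟶ J.obj c}
    {k : y ⟶ J.obj d} {l : c ⟶ d} (n : φ ≫ k ≅ h ≫ J.map l) :
    n.hom ▷ 𝟙 (J.obj d) ≫ 𝟙 (h ≫ J.map l) ▷ 𝟙 (J.obj d) ≫ (α_ _ _ _).hom ≫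
        h ◁ ((ρ_ (J.map l)).hom ≫ (λ_ (J.map l)).inv) ≫ (α_ _ _ _).inv ≫
        ((ρ_ h).hom ≫ (ρ_ h).inv ≫ h ◁ (J.mapId c).inv) ▷ J.map l ≫ (α_ _ _ _).hom ≫
        h ◁ (J.mapComp (𝟙 c) l).inv =
      (𝟙 (φ ≫ k) ▷ 𝟙 (J.obj d) ≫ (α_ _ _ _).hom ≫
        φ ◁ ((ρ_ k).hom ≫ (ρ_ k).inv ≫ k ◁ (J.mapId d).inv) ≫
        (α_ _ _ _).inv ≫ n.hom ▷ J.map (𝟙 d) ≫ (α_ _ _ _).hom ≫ h ◁ (J.mapComp l (𝟙 d)).inv) ≫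
      h ◁ J.map₂ ((ρ_ l).hom ≫ (λ_ l).inv) := by
  simp
  rw [← cancel_epi (α_ _ _ _).inv]
  simp only [Iso.inv_hom_id_assoc]
  rw [reassoc_of% (exchange_right n.hom (J.mapId d).inv)]
  simp
  simp only [← whiskerLeft_comp]
  simp [J.mapComp_id_left_inv]

/-- `H` is the compatibility condition of the naturality 2-cell of `counitComma`. Moving the
invertible squares `s` and `s'` to the other side turns it into the modification axiom for the
second triangle isomorphism. -/
theorem counit_modification_w {a b c d : A} {f : a ⟶ b} {h : J.obj a ⟶ J.obj c}
    {k : J.obj b ⟶ J.obj d} {l : c ⟶ d} {κ : c ⟶ a} {κ' : d ⟶ b}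
    (s : 𝟙 (J.obj a) ≫ 𝟙 (J.obj a) ≅ h ≫ J.map κ) (s' : 𝟙 (J.obj b) ≫ 𝟙 (J.obj b) ≅ k ≫ J.map κ')
    (n : J.map f ≫ k ≅ h ≫ J.map l) (m : l ≫ κ' ≅ κ ≫ f)
    (H : ((ρ_ (J.map f)).hom ≫ (λ_ (J.map f)).inv) ▷ 𝟙 (J.obj b) ≫
        𝟙 (𝟙 (J.obj a) ≫ J.map f) ▷ 𝟙 (J.obj b) ≫ (α_ _ _ _).hom ≫
        𝟙 (J.obj a) ◁ ((ρ_ (J.map f)).hom ≫ (λ_ (J.map f)).inv) ≫ (α_ _ _ _).inv ≫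
        s.hom ▷ J.map f ≫ (α_ _ _ _).hom ≫ h ◁ (J.mapComp κ f).inv =
      (𝟙 (J.map f ≫ 𝟙 (J.obj b)) ▷ 𝟙 (J.obj b) ≫ (α_ _ _ _).hom ≫ J.map f ◁ s'.hom ≫
        (α_ _ _ _).inv ≫ n.hom ▷ J.map κ' ≫ (α_ _ _ _).hom ≫ h ◁ (J.mapComp l κ').inv) ≫
        h ◁ J.map₂ m.hom) :
    J.map f ◁ (s'.inv ≫ (λ_ (𝟙 (J.obj b))).hom) ≫ (ρ_ (J.map f)).hom ≫ (λ_ (J.map f)).inv =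
      ((α_ _ _ _).inv ≫ n.hom ▷ J.map κ' ≫ (α_ _ _ _).hom ≫ h ◁ (mapSquare J m).hom ≫
        (α_ _ _ _).inv) ≫ (s.inv ≫ (λ_ (𝟙 (J.obj a))).hom) ▷ J.map f := by
  have H' := (J.map f ◁ s'.inv ≫ (α_ _ _ _).inv) ≫= H
  simp at H'
  simp [mapSquare]
  rw [← reassoc_of% H']
  simp

/-- `H` is the compatibility condition of the triangle 2-cell `triangleComma`; cancelling the
invertible cells `s` and `n` turns it into the first swallowtail axiom. -/
theorem swallowtail_unit_of_w {x : B} {c d : A} {h : x ⟶ J.obj c} {k : J.obj c ⟶ J.obj d}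
    {κ : d ⟶ c} {l : c ⟶ d} (s : 𝟙 (J.obj c) ≫ 𝟙 (J.obj c) ≅ k ≫ J.map κ)
    (n : h ≫ k ≅ h ≫ J.map l) (m : 𝟙 c ⟶ l ≫ κ)
    (H : (ρ_ h).inv ▷ 𝟙 (J.obj c) ≫ 𝟙 (h ≫ 𝟙 (J.obj c)) ▷ 𝟙 (J.obj c) ≫ (α_ _ _ _).hom ≫
        h ◁ s.hom ≫ (α_ _ _ _).inv ≫ n.hom ▷ J.map κ ≫ (α_ _ _ _).hom ≫
        h ◁ (J.mapComp l κ).inv =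
      ((ρ_ h).hom ≫ (ρ_ h).inv ≫ h ◁ (J.mapId c).inv) ≫ h ◁ J.map₂ m) :
    (ρ_ h).inv ≫ h ◁ ((J.mapId c).inv ≫ J.map₂ m ≫ (J.mapComp l κ).hom) ≫ (α_ _ _ _).inv ≫
      n.inv ▷ J.map κ ≫ (α_ _ _ _).hom ≫ h ◁ (s.inv ≫ (λ_ (𝟙 (J.obj c))).hom) ≫
      (ρ_ h).hom = 𝟙 h := by
  simp at H
  simp
  rw [← reassoc_of% H]
  simp

theorem counitComma_unitComma_w {a c : A} {h : J.obj a ⟶ J.obj c} {κ : c ⟶ a}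
    (s : 𝟙 (J.obj a) ≫ 𝟙 (J.obj a) ≅ h ≫ J.map κ) :
    ((λ_ (𝟙 (J.obj a))).inv ≫ s.hom) ▷ 𝟙 (J.obj a) ≫ 𝟙 (h ≫ J.map κ) ▷ 𝟙 (J.obj a) ≫
        (α_ _ _ _).hom ≫ h ◁ ((ρ_ (J.map κ)).hom ≫ (λ_ (J.map κ)).inv) ≫ (α_ _ _ _).inv ≫
        ((ρ_ h).hom ≫ (ρ_ h).inv ≫ h ◁ (J.mapId c).inv) ▷ J.map κ ≫ (α_ _ _ _).hom ≫
        h ◁ (J.mapComp (𝟙 c) κ).inv =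
      s.hom ≫ h ◁ J.map₂ (λ_ κ).inv := by
  simp [J.mapComp_id_left_inv]

/-- This is the left component of an equation of iso-comma 2-cells whose right component is the
second swallowtail axiom. `triangle_modification_left` plays the same role for the modification
axiom of the first triangle isomorphism. -/
theorem swallowtail_counit_left {a b : B} {h : a ⟶ b} {k : b ⟶ a} (s : 𝟙 a ≫ 𝟙 a ≅ h ≫ k) :
    ((λ_ (𝟙 a)).inv ≫ s.hom) ≫ (ρ_ h).inv ▷ k ≫ (α_ _ _ _).hom ≫
      h ◁ ((λ_ k).hom ≫ (ρ_ k).inv) ≫ (α_ _ _ _).inv ≫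
      (𝟙 (h ≫ k) ≫ (s.inv ≫ (λ_ (𝟙 a)).hom) ≫ 𝟙 (𝟙 a)) ▷ 𝟙 a ≫ (λ_ (𝟙 a)).hom = 𝟙 (𝟙 a) := by
  simp

theorem triangle_modification_left {x y c d : B} {φ : x ⟶ y} {h : x ⟶ c} {k : y ⟶ d} {l : c ⟶ d}
    (n : φ ≫ k ≅ h ≫ l) :
    φ ◁ (ρ_ k).inv ≫ (α_ _ _ _).inv ≫ (𝟙 (φ ≫ k) ≫ n.hom ≫ 𝟙 (h ≫ l)) ▷ 𝟙 d ≫ (α_ _ _ _).hom ≫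
      h ◁ ((ρ_ l).hom ≫ (λ_ l).inv) ≫ (α_ _ _ _).inv = n.hom ≫ (ρ_ h).inv ▷ l := by
  simp

end Aux

open IsoComma

/-- The pseudofunctor `a ↦ (J a, a, 𝟙)` into the iso-comma bicategory. -/
def idComma (J : A ⥤ᵖ B) : A ⥤ᵖ IsoComma (Pseudofunctor.id B) J where
  obj a := ⟨J.obj a, a, 𝟙 (J.obj a)⟩
  map f := ⟨J.map f, f, ρ_ (J.map f) ≪≫ (λ_ (J.map f)).symm⟩
  map₂ γ := ⟨J.map₂ γ, γ, idComma_map₂_w γ⟩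
  map₂_id f := hom₂_ext (J.map₂_id f) rfl
  map₂_comp γ δ := hom₂_ext (J.map₂_comp γ δ) rfl
  mapId a := IsoComma.isoMk (J.mapId a) (Iso.refl (𝟙 a)) (idComma_mapId_w a)
  mapComp f g := IsoComma.isoMk (J.mapComp f g) (Iso.refl (f ≫ g)) (idComma_mapComp_w f g)
  map₂_whisker_left f _ _ γ := hom₂_ext (J.map₂_whisker_left f γ)
    (by change f ◁ γ = 𝟙 _ ≫ f ◁ γ ≫ 𝟙 _; simp)
  map₂_whisker_right γ f := hom₂_ext (J.map₂_whisker_right γ f)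
    (by change γ ▷ f = 𝟙 _ ≫ γ ▷ f ≫ 𝟙 _; simp)
  map₂_associator f g h := hom₂_ext (J.map₂_associator f g h) (by
    change (α_ f g h).hom = 𝟙 _ ≫ 𝟙 (f ≫ g) ▷ h ≫ (α_ f g h).hom ≫ f ◁ 𝟙 (g ≫ h) ≫ 𝟙 _
    simp)
  map₂_left_unitor {x _} f := hom₂_ext (J.map₂_left_unitor f) (by
    change (λ_ f).hom = 𝟙 _ ≫ 𝟙 (𝟙 x) ▷ f ≫ (λ_ f).hom
    simp)
  map₂_right_unitor {_ y} f := hom₂_ext (J.map₂_right_unitor f) (by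
    change (ρ_ f).hom = 𝟙 _ ≫ f ◁ 𝟙 (𝟙 y) ≫ (ρ_ f).hom
    simp)

variable (G : B → A) (η : ∀ y, (Pseudofunctor.id B).obj y ⟶ J.obj (G y))
  (hη : ∀ y, (IsoComma.mk y (G y) (η y) : IsoComma (Pseudofunctor.id B) J).IsUniversal)

/-- The counit in the iso-comma bicategory. -/
noncomputable def counitComma : J.comp (universalSection G η hη) ⟶ idComma J where
  app a := lift (hη (J.obj a)) (𝟙 (J.obj a))
  naturality {a b} f := liftIso (hη (J.obj a)) (ρ_ (J.map f) ≪≫ (λ_ (J.map f)).symm)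
  naturality_naturality {a b f g} γ := hom₂_ext_left (hη (J.obj a)) (idComma_map₂_w γ)
  naturality_id a := hom₂_ext_left (hη (J.obj a)) (by
    change ((ρ_ (J.map (𝟙 a))).hom ≫ (λ_ (J.map (𝟙 a))).inv) ≫ 𝟙 (J.obj a) ◁ (J.mapId a).hom =
      ((J.mapId a).hom ≫ 𝟙 _) ▷ 𝟙 (J.obj a) ≫ (λ_ (𝟙 (J.obj a))).hom ≫ (ρ_ (𝟙 (J.obj a))).inv
    simp [unitors_equal])
  naturality_comp {a b c} f g := hom₂_ext_left (hη (J.obj a)) (by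
    change ((ρ_ (J.map (f ≫ g))).hom ≫ (λ_ (J.map (f ≫ g))).inv) ≫ 𝟙 (J.obj a) ◁
        (J.mapComp f g).hom = ((J.mapComp f g).hom ≫ 𝟙 _) ▷ 𝟙 (J.obj c) ≫ (α_ _ _ _).hom ≫
        J.map f ◁ ((ρ_ (J.map g)).hom ≫ (λ_ (J.map g)).inv) ≫ (α_ _ _ _).inv ≫
        ((ρ_ (J.map f)).hom ≫ (λ_ (J.map f)).inv) ▷ J.map g ≫ (α_ _ _ _).hom
    simp)

/-- The counit. -/
noncomputable def universalCounit : J.comp (universalFunctor G η hη) ⟶ Pseudofunctor.id A where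
  app a := ((counitComma G η hη).app a).right
  naturality f := rightIso ((counitComma G η hη).naturality f)
  naturality_naturality γ :=
    congrArg Hom₂.right ((counitComma G η hη).naturality_naturality γ)
  naturality_id a := congrArg Hom₂.right ((counitComma G η hη).naturality_id a)
  naturality_comp f g := congrArg Hom₂.right ((counitComma G η hη).naturality_comp f g)

/-- The 1-cell `(η y, 𝟙)` of the iso-comma bicategory. -/
def unitComma (y : B) :
    (IsoComma.mk y (G y) (η y) : IsoComma (Pseudofunctor.id B) J) ⟶ (idComma J).obj (G y) :=
  ⟨η y, 𝟙 (G y), ρ_ (η y) ≪≫ (ρ_ (η y)).symm ≪≫ whiskerLeftIso (η y) (J.mapId (G y)).symm⟩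

/-- The pseudonaturality of `unitComma`. -/
noncomputable def unitCommaNaturality {x y : B} (φ : x ⟶ y) :
    (universalSection G η hη).map φ ≫ unitComma G η y ≅
      unitComma G η x ≫ (idComma J).map ((universalFunctor G η hη).map φ) :=
  IsoComma.isoMk ((universalUnit G η hη).naturality φ)
    (ρ_ ((universalFunctor G η hη).map φ) ≪≫ (λ_ ((universalFunctor G η hη).map φ)).symm)
    (unitComma_naturality_w (J := J) (l := (universalFunctor G η hη).map φ)
      ((universalUnit G η hη).naturality φ))

/-- The triangle isomorphism at `y`, in the iso-comma bicategory. -/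
noncomputable def triangleComma (y : B) :
    unitComma G η y ≅
      (universalSection G η hη).map (show y ⟶ J.obj (G y) from η y) ≫
        (counitComma G η hη).app (G y) :=
  liftIso (hη y) (ρ_ (η y)).symm

/-- The first triangle isomorphism. -/
noncomputable def universalLeftMod : 𝟙 (universalFunctor G η hη) ≅
    unitPost (universalUnit G η hη) ≫ counitPre (universalCounit G η hη) :=
  Pseudofunctor.StrongTrans.isoMk (fun y => rightIso (triangleComma G η hη y)) (by
    intro x y φ
    have h : (universalSection G η hη).map φ ◁ (triangleComma G η hη y).hom ≫
        (α_ _ _ _).inv ≫ (mapSquare (universalSection G η hη)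
          (show φ ≫ (show y ⟶ J.obj (G y) from η y) ≅
            (show x ⟶ J.obj (G x) from η x) ≫ J.map ((universalFunctor G η hη).map φ) from
            (universalUnit G η hη).naturality φ)).hom ▷ (counitComma G η hη).app (G y) ≫
        (α_ _ _ _).hom ≫ (universalSection G η hη).map (show x ⟶ J.obj (G x) from η x) ◁
          ((counitComma G η hη).naturality ((universalFunctor G η hη).map φ)).hom ≫
        (α_ _ _ _).inv = (unitCommaNaturality G η hη φ).hom ≫ (triangleComma G η hη x).hom ▷
          (idComma J).map ((universalFunctor G η hη).map φ) :=
      hom₂_ext_left (hη x)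
        (triangle_modification_left (B := B) ((universalUnit G η hη).naturality φ))
    -- The equation `h` is proved on left components, where only unitors and the naturality of the
    -- unit occur; its right component is the modification axiom wanted.
    exact congrArg Hom₂.right h)

/-- The second triangle isomorphism at `a`. -/
noncomputable def counitTriangle (a : A) :
    (universalUnit G η hη).app (J.obj a) ≫ J.map ((universalCounit G η hη).app a) ≅
      𝟙 (J.obj a) :=
  ((counitComma G η hη).app a).sq.symm ≪≫ λ_ (𝟙 (J.obj a))

/-- The second triangle isomorphism. -/
noncomputable def universalRightMod : unitPre (universalUnit G η hη) ≫
    counitPost (universalCounit G η hη) ≅ 𝟙 J :=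
  Pseudofunctor.StrongTrans.isoMk (counitTriangle G η hη) (by
    intro a b f
    exact counit_modification_w (J := J) ((counitComma G η hη).app a).sq
      ((counitComma G η hη).app b).sq ((universalUnit G η hη).naturality (J.map f))
      ((universalCounit G η hη).naturality f) (hom₂_w ((counitComma G η hη).naturality f).hom))

/-- The comparison of the counit with the unit and its image. -/
noncomputable def counitUnitComma (a : A) : (counitComma G η hη).app a ⟶
    unitComma G η (J.obj a) ≫ (idComma J).map ((universalCounit G η hη).app a) :=
  ⟨(λ_ (𝟙 (J.obj a))).inv ≫ ((counitComma G η hη).app a).sq.hom,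
    (λ_ ((universalCounit G η hη).app a)).inv,
    counitComma_unitComma_w (J := J) ((counitComma G η hη).app a).sq⟩

/-- Universal arrows `y ⟶ J (G y)` make `G` a left biadjoint of `J`. -/
noncomputable def universalBiadjunction : Biadjunction (universalFunctor G η hη) J where
  unit := universalUnit G η hη
  counit := universalCounit G η hη
  leftMod := universalLeftMod G η hη
  rightMod := universalRightMod G η hη
  swallowtail_unit x := swallowtail_unit_of_w (J := J) ((counitComma G η hη).app (G x)).sq
    ((universalUnit G η hη).naturality (show x ⟶ J.obj (G x) from η x)) _
    (hom₂_w (triangleComma G η hη x).hom)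
  swallowtail_counit a := by
    let sec := universalSection G η hη
    -- The second swallowtail is lifted to the iso-comma bicategory by replacing `L` with the
    -- section and the counit with `counitComma`. On the left the square of `counitComma` at `a`
    -- meets its inverse, contained in `counitTriangle`, and cancels.
    have h : counitUnitComma G η hη a ≫ (triangleComma G η hη (J.obj a)).hom ▷
        (idComma J).map ((universalCounit G η hη).app a) ≫ (α_ _ _ _).hom ≫
        sec.map ((universalUnit G η hη).app (J.obj a)) ◁
          ((counitComma G η hη).naturality ((universalCounit G η hη).app a)).inv ≫
        (α_ _ _ _).inv ≫
        ((sec.mapComp _ _).inv ≫ sec.map₂ (counitTriangle G η hη a).hom ≫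
          (sec.mapId (J.obj a)).hom) ▷ (counitComma G η hη).app a ≫ (λ_ _).hom = 𝟙 _ :=
      hom₂_ext_left (hη _) (swallowtail_counit_left (B := B) ((counitComma G η hη).app a).sq)
    exact congrArg Hom₂.right h

end UniversalBiadjunction

/-! ### Equivalences in a bicategory; pointwise equivalences of pseudofunctors. -/

section Equivalences
variable {C : Type u₃} [Bicategory.{w₃, v₃} C]

/-- A 1-cell is an equivalence. -/
def IsEquiv {a b : C} (l : a ⟶ b) : Prop := ∃ e : a ≌ b, e.hom = l

/-- Any pair of quasi-inverse 1-cells can be corrected to an adjoint equivalence by changing the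
counit, so no triangle identity has to be supplied. -/
theorem IsEquiv.of_iso {a b : C} {l : a ⟶ b} {r : b ⟶ a} (η : 𝟙 a ≅ l ≫ r) (κ : r ≫ l ≅ 𝟙 b) :
    IsEquiv l := ⟨Bicategory.Equivalence.mkOfAdjointifyCounit η κ, rfl⟩

theorem isEquiv_hom {a b : C} (e : a ≌ b) : IsEquiv e.hom := ⟨e, rfl⟩

theorem isEquiv_inv {a b : C} (e : a ≌ b) : IsEquiv e.inv := .of_iso e.counit.symm e.unit.symm

theorem IsEquiv.comp {a b c : C} {f : a ⟶ b} {g : b ⟶ c} (hf : IsEquiv f) (hg : IsEquiv g) :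
    IsEquiv (f ≫ g) := by
  obtain ⟨e, rfl⟩ := hf
  obtain ⟨e', rfl⟩ := hg
  refine .of_iso (r := e'.inv ≫ e.inv) ?_ ?_
  · exact e.unit ≪≫ whiskerLeftIso e.hom ((λ_ _).symm ≪≫ whiskerRightIso e'.unit e.inv ≪≫
      α_ _ _ _) ≪≫ (α_ _ _ _).symm
  · exact α_ _ _ _ ≪≫ whiskerLeftIso e'.inv ((α_ _ _ _).symm ≪≫ whiskerRightIso e.counit e'.hom ≪≫
      λ_ _) ≪≫ e'.counit

theorem IsEquiv.map {D : Type u₂} [Bicategory.{w₂, v₂} D] (F : C ⥤ᵖ D) {a b : C} {f : a ⟶ b}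
    (hf : IsEquiv f) : IsEquiv (F.map f) := by
  obtain ⟨e, rfl⟩ := hf
  exact .of_iso ((F.mapId a).symm ≪≫ F.map₂Iso e.unit ≪≫ F.mapComp e.hom e.inv)
    ((F.mapComp e.inv e.hom).symm ≪≫ F.map₂Iso e.counit ≪≫ F.mapId b)

theorem IsEquiv.postcomp_isEquivalence {a b : C} {l : a ⟶ b} (hl : IsEquiv l) (x : C) :
    (postcomp x l).IsEquivalence := by
  obtain ⟨e, rfl⟩ := hl
  exact (CategoryTheory.Equivalence.mk (postcomp x e.hom) (postcomp x e.inv)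
    (NatIso.ofComponents (fun f => (ρ_ f).symm ≪≫ whiskerLeftIso f e.unit ≪≫ (α_ _ _ _).symm)
      (by
        intro f g β
        change β ≫ (ρ_ g).inv ≫ g ◁ e.unit.hom ≫ (α_ _ _ _).inv =
          ((ρ_ f).inv ≫ f ◁ e.unit.hom ≫ (α_ _ _ _).inv) ≫ β ▷ e.hom ▷ e.inv
        have := whisker_exchange β e.unit.hom
        simp only [Category.assoc, ← associator_inv_naturality_left,
          rightUnitor_inv_naturality_assoc]
        rw [reassoc_of% this]))
    (NatIso.ofComponents (fun f => α_ _ _ _ ≪≫ whiskerLeftIso f e.counit ≪≫ ρ_ f) (by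
        intro f g β
        change β ▷ e.inv ▷ e.hom ≫ (α_ _ _ _).hom ≫ g ◁ e.counit.hom ≫ (ρ_ g).hom =
          ((α_ _ _ _).hom ≫ f ◁ e.counit.hom ≫ (ρ_ f).hom) ≫ β
        have := whisker_exchange β e.counit.hom
        simp only [Category.assoc, associator_naturality_left_assoc, ← rightUnitor_naturality]
        rw [reassoc_of% this]))).isEquivalence_functor

theorem IsEquiv.precomp_isEquivalence {a b : C} {l : a ⟶ b} (hl : IsEquiv l) (x : C) :
    (precomp x l).IsEquivalence := by
  obtain ⟨e, rfl⟩ := hl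
  exact (CategoryTheory.Equivalence.mk (precomp x e.hom) (precomp x e.inv)
    (NatIso.ofComponents (fun f => (λ_ f).symm ≪≫ whiskerRightIso e.counit.symm f ≪≫ α_ _ _ _)
      (by
        intro f g β
        change β ≫ (λ_ g).inv ≫ e.counit.inv ▷ g ≫ (α_ _ _ _).hom =
          ((λ_ f).inv ≫ e.counit.inv ▷ f ≫ (α_ _ _ _).hom) ≫ e.inv ◁ e.hom ◁ β
        have := whisker_exchange e.counit.inv β
        simp only [Category.assoc, ← associator_naturality_right, leftUnitor_inv_naturality_assoc]
        rw [reassoc_of% this]))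
    (NatIso.ofComponents (fun f => (α_ _ _ _).symm ≪≫ whiskerRightIso e.unit.symm f ≪≫ λ_ f) (by
        intro f g β
        change e.hom ◁ e.inv ◁ β ≫ (α_ _ _ _).inv ≫ e.unit.inv ▷ g ≫ (λ_ g).hom =
          ((α_ _ _ _).inv ≫ e.unit.inv ▷ f ≫ (λ_ f).hom) ≫ β
        have := whisker_exchange e.unit.inv β
        simp only [Category.assoc, associator_inv_naturality_right_assoc, ← leftUnitor_naturality]
        rw [reassoc_of% this]))).isEquivalence_functor

theorem IsEquiv.whiskerRight_injective {a b : C} {l : a ⟶ b} (hl : IsEquiv l) {x : C}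
    {f g : x ⟶ a} {β γ : f ⟶ g} (h : β ▷ l = γ ▷ l) : β = γ := by
  have := hl.postcomp_isEquivalence x
  exact (postcomp x l).map_injective h

theorem IsEquiv.exists_whiskerRight {a b : C} {l : a ⟶ b} (hl : IsEquiv l) {x : C}
    {f g : x ⟶ a} (β : f ≫ l ≅ g ≫ l) : ∃ γ : f ≅ g, γ.hom ▷ l = β.hom := by
  have := hl.postcomp_isEquivalence x
  exact ⟨(postcomp x l).preimageIso β, (postcomp x l).map_preimage β.hom⟩

section Pointwise
variable {X : Type u₁} [Bicategory.{w₁, v₁} X] {F G : X ⥤ᵖ C} (θ : F ⟶ G)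
  (r : ∀ x, G.obj x ⟶ F.obj x) (κ : ∀ x, r x ≫ θ.app x ≅ 𝟙 (G.obj x))
  (hθ : ∀ x, IsEquiv (θ.app x))

/-- The displayed equation says that `κ` is a modification. It prescribes the naturality cell of `r`
after whiskering with `θ.app y`, and whiskering with an equivalence is fully faithful. -/
theorem exists_inverseNaturality {x y : X} (hθ : IsEquiv (θ.app y)) (f : x ⟶ y) :
    ∃ n : G.map f ≫ r y ≅ r x ≫ F.map f,
      n.hom ▷ θ.app y ≫ (α_ _ _ _).hom ≫ r x ◁ (θ.naturality f).hom ≫ (α_ _ _ _).inv ≫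
        (κ x).hom ▷ G.map f = (α_ _ _ _).hom ≫ G.map f ◁ (κ y).hom ≫ (ρ_ _).hom ≫ (λ_ _).inv := by
  obtain ⟨n, hn⟩ := hθ.exists_whiskerRight (α_ _ _ _ ≪≫ whiskerLeftIso (G.map f) (κ y) ≪≫ ρ_ _ ≪≫
    (λ_ _).symm ≪≫ whiskerRightIso (κ x).symm (G.map f) ≪≫ α_ _ _ _ ≪≫
    whiskerLeftIso (r x) (θ.naturality f).symm ≪≫ (α_ _ _ _).symm)
  exact ⟨n, by simp [hn]⟩

section
variable {θ r κ}

/-- Axioms for the inverse are tested after whiskering with a component of `θ`, which loses nothing.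
There the defining equation of `n` reduces this one, and likewise the unit and composition axioms,
to the corresponding axiom of `θ` by interchange. -/
theorem inverse_naturality_naturality {x y : X} {f g : x ⟶ y} (β : f ⟶ g)
    {n : G.map f ≫ r y ≅ r x ≫ F.map f} {n' : G.map g ≫ r y ≅ r x ≫ F.map g}
    (hf : n.hom ▷ θ.app y ≫ (α_ _ _ _).hom ≫ r x ◁ (θ.naturality f).hom ≫ (α_ _ _ _).inv ≫
      (κ x).hom ▷ G.map f = (α_ _ _ _).hom ≫ G.map f ◁ (κ y).hom ≫ (ρ_ _).hom ≫ (λ_ _).inv)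
    (hg : n'.hom ▷ θ.app y ≫ (α_ _ _ _).hom ≫ r x ◁ (θ.naturality g).hom ≫ (α_ _ _ _).inv ≫
      (κ x).hom ▷ G.map g = (α_ _ _ _).hom ≫ G.map g ◁ (κ y).hom ≫ (ρ_ _).hom ≫ (λ_ _).inv) :
    (G.map₂ β ▷ r y ≫ n'.hom) ▷ θ.app y = (n.hom ≫ r x ◁ F.map₂ β) ▷ θ.app y := by
  rw [← cancel_mono ((α_ _ _ _).hom ≫ r x ◁ (θ.naturality g).hom ≫ (α_ _ _ _).inv ≫
    (κ x).hom ▷ G.map g)]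
  simp only [comp_whiskerRight, Category.assoc, hg, whisker_assoc, Iso.inv_hom_id_assoc]
  rw [← whiskerLeft_comp_assoc, θ.naturality_naturality, whiskerLeft_comp_assoc,
    associator_inv_naturality_right_assoc, whisker_exchange, reassoc_of% hf,
    associator_naturality_left_assoc, ← whisker_exchange_assoc]
  simp

theorem inverse_naturality_id {x : X} {n : G.map (𝟙 x) ≫ r x ≅ r x ≫ F.map (𝟙 x)}
    (h : n.hom ▷ θ.app x ≫ (α_ _ _ _).hom ≫ r x ◁ (θ.naturality (𝟙 x)).hom ≫ (α_ _ _ _).inv ≫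
      (κ x).hom ▷ G.map (𝟙 x) =
      (α_ _ _ _).hom ≫ G.map (𝟙 x) ◁ (κ x).hom ≫ (ρ_ _).hom ≫ (λ_ _).inv) :
    (n.hom ≫ r x ◁ (F.mapId x).hom) ▷ θ.app x =
      ((G.mapId x).hom ▷ r x ≫ (λ_ (r x)).hom ≫ (ρ_ (r x)).inv) ▷ θ.app x := by
  rw [← cancel_mono ((α_ _ _ _).hom ≫ r x ◁ ((λ_ _).hom ≫ (ρ_ _).inv) ≫ (α_ _ _ _).inv ≫
    (κ x).hom ▷ 𝟙 _)]
  have e : (r x ◁ (F.mapId x).hom) ▷ θ.app x ≫ (α_ _ _ _).hom ≫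
      r x ◁ ((λ_ _).hom ≫ (ρ_ _).inv) = (α_ _ _ _).hom ≫ r x ◁ (θ.naturality (𝟙 x)).hom ≫
        r x ◁ θ.app x ◁ (G.mapId x).hom := by
    rw [← whiskerLeft_comp, θ.naturality_id]
    simp
  rw [comp_whiskerRight, Category.assoc, reassoc_of% e, associator_inv_naturality_right_assoc,
    whisker_exchange, reassoc_of% h]
  symm
  calc
    _ = 𝟙 _ ⊗≫ ((G.mapId x).hom ▷ (r x ≫ θ.app x) ≫ 𝟙 (G.obj x) ◁ (κ x).hom) ⊗≫ 𝟙 _ := by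
      bicategory
    _ = _ := by
      rw [← whisker_exchange]; bicategory

theorem inverse_naturality_comp {x y z : X} (f : x ⟶ y) (g : y ⟶ z)
    {n : G.map f ≫ r y ≅ r x ≫ F.map f} {n' : G.map g ≫ r z ≅ r y ≫ F.map g}
    {n'' : G.map (f ≫ g) ≫ r z ≅ r x ≫ F.map (f ≫ g)}
    (hf : n.hom ▷ θ.app y ≫ (α_ _ _ _).hom ≫ r x ◁ (θ.naturality f).hom ≫ (α_ _ _ _).inv ≫
      (κ x).hom ▷ G.map f = (α_ _ _ _).hom ≫ G.map f ◁ (κ y).hom ≫ (ρ_ _).hom ≫ (λ_ _).inv)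
    (hg : n'.hom ▷ θ.app z ≫ (α_ _ _ _).hom ≫ r y ◁ (θ.naturality g).hom ≫ (α_ _ _ _).inv ≫
      (κ y).hom ▷ G.map g = (α_ _ _ _).hom ≫ G.map g ◁ (κ z).hom ≫ (ρ_ _).hom ≫ (λ_ _).inv)
    (hfg : n''.hom ▷ θ.app z ≫ (α_ _ _ _).hom ≫ r x ◁ (θ.naturality (f ≫ g)).hom ≫
      (α_ _ _ _).inv ≫ (κ x).hom ▷ G.map (f ≫ g) =
        (α_ _ _ _).hom ≫ G.map (f ≫ g) ◁ (κ z).hom ≫ (ρ_ _).hom ≫ (λ_ _).inv) :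
    (n''.hom ≫ r x ◁ (F.mapComp f g).hom) ▷ θ.app z =
      ((G.mapComp f g).hom ▷ r z ≫ (α_ _ _ _).hom ≫ G.map f ◁ n'.hom ≫ (α_ _ _ _).inv ≫
        n.hom ▷ F.map g ≫ (α_ _ _ _).hom) ▷ θ.app z := by
  rw [← cancel_mono ((α_ _ _ _).hom ≫ r x ◁ ((α_ _ _ _).hom ≫ F.map f ◁ (θ.naturality g).hom ≫
    (α_ _ _ _).inv ≫ (θ.naturality f).hom ▷ G.map g ≫ (α_ _ _ _).hom) ≫ (α_ _ _ _).inv ≫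
      (κ x).hom ▷ (G.map f ≫ G.map g))]
  have e : (r x ◁ (F.mapComp f g).hom) ▷ θ.app z ≫ (α_ _ _ _).hom ≫
      r x ◁ ((α_ _ _ _).hom ≫ F.map f ◁ (θ.naturality g).hom ≫
    (α_ _ _ _).inv ≫ (θ.naturality f).hom ▷ G.map g ≫ (α_ _ _ _).hom) =
        (α_ _ _ _).hom ≫ r x ◁ (θ.naturality (f ≫ g)).hom ≫
        r x ◁ θ.app x ◁ (G.mapComp f g).hom := by
    rw [← whiskerLeft_comp, θ.naturality_comp]
    simp
  rw [comp_whiskerRight, Category.assoc, reassoc_of% e, associator_inv_naturality_right_assoc,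
    whisker_exchange, reassoc_of% hfg]
  symm
  calc
    _ = 𝟙 _ ⊗≫ (G.mapComp f g).hom ▷ (r z ≫ θ.app z) ⊗≫ G.map f ◁ n'.hom ▷ θ.app z ⊗≫
        (n.hom ▷ (F.map g ≫ θ.app z) ≫ (r x ≫ F.map f) ◁ (θ.naturality g).hom) ⊗≫
        r x ◁ (θ.naturality f).hom ▷ G.map g ⊗≫ (κ x).hom ▷ (G.map f ≫ G.map g) ⊗≫ 𝟙 _ := by
      bicategory
    _ = 𝟙 _ ⊗≫ (G.mapComp f g).hom ▷ (r z ≫ θ.app z) ⊗≫ G.map f ◁ n'.hom ▷ θ.app z ⊗≫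
        G.map f ◁ r y ◁ (θ.naturality g).hom ⊗≫
        (n.hom ▷ θ.app y ≫ (α_ _ _ _).hom ≫ r x ◁ (θ.naturality f).hom ≫ (α_ _ _ _).inv ≫
      (κ x).hom ▷ G.map f) ▷ G.map g ⊗≫ 𝟙 _ := by
      rw [← whisker_exchange]; bicategory
    _ = 𝟙 _ ⊗≫ (G.mapComp f g).hom ▷ (r z ≫ θ.app z) ⊗≫
        G.map f ◁ (n'.hom ▷ θ.app z ≫ (α_ _ _ _).hom ≫ r y ◁ (θ.naturality g).hom ≫
          (α_ _ _ _).inv ≫ (κ y).hom ▷ G.map g) ⊗≫ 𝟙 _ := by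
      rw [hf]; bicategory
    _ = 𝟙 _ ⊗≫ ((G.mapComp f g).hom ▷ (r z ≫ θ.app z) ≫
        (G.map f ≫ G.map g) ◁ (κ z).hom) ⊗≫ 𝟙 _ := by
      rw [hg]; bicategory
    _ = _ := by
      rw [← whisker_exchange]; bicategory

end

/-- The inverse of a pointwise equivalence. -/
noncomputable def pointwiseInverse : G ⟶ F where
  app := r
  naturality {_ y} f := (exists_inverseNaturality θ r κ (hθ y) f).choose
  naturality_naturality {_ y f g} β := (hθ y).whiskerRight_injective
    (inverse_naturality_naturality β (exists_inverseNaturality θ r κ (hθ y) f).choose_spec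
      (exists_inverseNaturality θ r κ (hθ y) g).choose_spec)
  naturality_id x := (hθ x).whiskerRight_injective
    (inverse_naturality_id (exists_inverseNaturality θ r κ (hθ x) (𝟙 x)).choose_spec)
  naturality_comp {_ y z} f g := (hθ z).whiskerRight_injective
    (inverse_naturality_comp f g (exists_inverseNaturality θ r κ (hθ y) f).choose_spec
      (exists_inverseNaturality θ r κ (hθ z) g).choose_spec
      (exists_inverseNaturality θ r κ (hθ z) (f ≫ g)).choose_spec)

/-- The pointwise inverse is a one-sided inverse. -/
noncomputable def pointwiseInverseCompIso : pointwiseInverse θ r κ hθ ≫ θ ≅ 𝟙 G :=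
  Pseudofunctor.StrongTrans.isoMk κ (by
    intro x y f
    have h := (exists_inverseNaturality θ r κ (hθ y) f).choose_spec
    change G.map f ◁ (κ y).hom ≫ (ρ_ _).hom ≫ (λ_ _).inv = ((α_ _ _ _).inv ≫
      (exists_inverseNaturality θ r κ (hθ y) f).choose.hom ▷ θ.app y ≫ (α_ _ _ _).hom ≫
      r x ◁ (θ.naturality f).hom ≫ (α_ _ _ _).inv) ≫ (κ x).hom ▷ G.map f
    simp only [Category.assoc, h, Iso.inv_hom_id_assoc])

end Pointwise

theorem exists_pointwiseInverse {X : Type u₁} [Bicategory.{w₁, v₁} X] {F G : X ⥤ᵖ C} (θ : F ⟶ G)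
    (hθ : ∀ x, IsEquiv (θ.app x)) :
    ∃ θ' : G ⟶ F, (∀ x, IsEquiv (θ'.app x)) ∧ Nonempty (θ' ≫ θ ≅ 𝟙 G) := by
  choose e he using hθ
  refine ⟨pointwiseInverse θ (fun x => (e x).inv)
    (fun x => eqToIso (by rw [he]) ≪≫ (e x).counit) (fun x => ⟨e x, he x⟩),
    fun x => isEquiv_inv (e x), ⟨pointwiseInverseCompIso _ _ _ _⟩⟩

/-- A pseudonatural transformation whose components are equivalences is an equivalence. -/
theorem isEquiv_of_pointwise {X : Type u₁} [Bicategory.{w₁, v₁} X] {F G : X ⥤ᵖ C} (θ : F ⟶ G)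
    (hθ : ∀ x, IsEquiv (θ.app x)) : IsEquiv θ := by
  obtain ⟨φ, hφ, ⟨i⟩⟩ := exists_pointwiseInverse θ hθ
  obtain ⟨κ, -, ⟨j⟩⟩ := exists_pointwiseInverse φ hφ
  refine .of_iso (r := φ) ?_ i
  -- The left inverse `κ` of `φ` agrees with `θ`, since `κ ≅ κ ≫ φ ≫ θ ≅ θ`; hence `θ ≫ φ ≅ κ ≫ φ ≅
  -- 𝟙`.
  exact j.symm ≪≫ whiskerRightIso ((ρ_ κ).symm ≪≫ whiskerLeftIso κ i.symm ≪≫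
    (α_ _ _ _).symm ≪≫ whiskerRightIso j θ ≪≫ λ_ θ) φ

/-- The components of an equivalence of pseudofunctors are equivalences. -/
theorem IsEquiv.app {X : Type u₁} [Bicategory.{w₁, v₁} X] {F G : X ⥤ᵖ C} {θ : F ⟶ G}
    (hθ : IsEquiv θ) (x : X) : IsEquiv (θ.app x) := by
  obtain ⟨e, rfl⟩ := hθ
  exact .of_iso (r := e.inv.app x)
    ⟨e.unit.hom.as.app x, e.unit.inv.as.app x,
      congrArg (fun m => m.as.app x) e.unit.hom_inv_id,
      congrArg (fun m => m.as.app x) e.unit.inv_hom_id⟩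
    ⟨e.counit.hom.as.app x, e.counit.inv.as.app x,
      congrArg (fun m => m.as.app x) e.counit.hom_inv_id,
      congrArg (fun m => m.as.app x) e.counit.inv_hom_id⟩

end Equivalences

/-! ### Universal elements of `Cat`-valued pseudofunctors. -/

section UniversalElement

theorem isEquiv_of_isEquivalence {C D : Cat.{w₁, v₁}} (l : C ⟶ D) (h : l.toFunctor.IsEquivalence) :
    IsEquiv l :=
  .of_iso (r := l.toFunctor.inv.toCatHom)
    (Cat.Hom.isoMk l.toFunctor.asEquivalence.unitIso)
    (Cat.Hom.isoMk l.toFunctor.asEquivalence.counitIso)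

theorem IsEquiv.isEquivalence {C D : Cat.{w₁, v₁}} {l : C ⟶ D} (h : IsEquiv l) :
    l.toFunctor.IsEquivalence := by
  obtain ⟨e, rfl⟩ := h
  exact (CategoryTheory.Equivalence.mk e.hom.toFunctor e.inv.toFunctor
    (Cat.Hom.toNatIso e.unit) (Cat.Hom.toNatIso e.counit)).isEquivalence_functor

variable {A : Type u₁} [Bicategory.{w₁, v₁} A] {F G : A ⥤ᵖ Cat.{w₂, v₂}}

/-- The functor `f ↦ (F f) u`. -/
def evalFunctor (F : A ⥤ᵖ Cat.{w₂, v₂}) {a : A} (u : F.obj a) (b : A) : (a ⟶ b) ⥤ F.obj b where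
  obj f := (F.map f).toFunctor.obj u
  map γ := (F.map₂ γ).toNatTrans.app u
  map_id f := by rw [F.map₂_id]; rfl
  map_comp γ δ := by rw [F.map₂_comp]; rfl

/-- `u` is a universal element if the functors `f ↦ (F f) u` are equivalences. -/
def IsUniversalElement (F : A ⥤ᵖ Cat.{w₂, v₂}) {a : A} (u : F.obj a) : Prop :=
  ∀ b, (evalFunctor F u b).IsEquivalence

/-- A family of 1-cells that is natural up to isomorphism; unlike for pseudonatural
transformations, the isomorphisms need not be compatible with identities and composition. -/
structure PreTrans {K : Type u₂} [Bicategory.{w₃, v₃} K] (F G : A ⥤ᵖ K) where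
  /-- the components -/
  app (a : A) : F.obj a ⟶ G.obj a
  /-- the naturality isomorphisms -/
  naturality {a b : A} (f : a ⟶ b) : F.map f ≫ app b ≅ app a ≫ G.map f
  naturality_naturality {a b : A} {f g : a ⟶ b} (γ : f ⟶ g) :
    F.map₂ γ ▷ app b ≫ (naturality g).hom = (naturality f).hom ≫ app a ◁ G.map₂ γ

/-- The family underlying a pseudonatural transformation. -/
def PreTrans.ofTrans {K : Type u₂} [Bicategory.{w₃, v₃} K] {F G : A ⥤ᵖ K} (θ : F ⟶ G) :
    PreTrans F G :=
  ⟨θ.app, θ.naturality, θ.naturality_naturality⟩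

/-- The image of a family under a pseudofunctor. -/
def PreTrans.post {K : Type u₂} [Bicategory.{w₃, v₃} K] {F G : A ⥤ᵖ K} (θ : PreTrans F G)
    {L : Type u₄} [Bicategory.{w₄, v₄} L] (H : K ⥤ᵖ L) : PreTrans (F.comp H) (G.comp H) where
  app a := H.map (θ.app a)
  naturality f := mapSquare H (θ.naturality f)
  naturality_naturality {_ _ f g} γ := mapSquare_naturality H (θ.naturality f) (θ.naturality g)
    (F.map₂ γ) (G.map₂ γ) (θ.naturality_naturality γ)

/-- Natural families commute with evaluation. -/
def evalFunctorCompIso (θ : PreTrans F G) {a : A} (u : F.obj a) (b : A) :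
    evalFunctor F u b ⋙ (θ.app b).toFunctor ≅ evalFunctor G ((θ.app a).toFunctor.obj u) b :=
  NatIso.ofComponents (fun f => (Cat.Hom.toNatIso (θ.naturality f)).app u) (by
    intro f g γ
    have h := congrArg (fun m => m.toNatTrans.app u) (θ.naturality_naturality γ)
    exact h)

theorem IsUniversalElement.congr {a : A} {u u' : F.obj a} (hu : IsUniversalElement F u)
    (i : u ≅ u') : IsUniversalElement F u' := by
  intro b
  have := hu b
  exact Functor.isEquivalence_of_iso (F := evalFunctor F u b)
    (NatIso.ofComponents (fun f => (F.map f).toFunctor.mapIso i)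
      (fun {f g} γ => ((F.map₂ γ).toNatTrans.naturality i.hom).symm))

theorem IsUniversalElement.map {a : A} {u : F.obj a} (hu : IsUniversalElement F u)
    (θ : PreTrans F G) (hθ : ∀ b, IsEquiv (θ.app b)) :
    IsUniversalElement G ((θ.app a).toFunctor.obj u) := by
  intro b
  have := hu b
  have := (hθ b).isEquivalence
  exact Functor.isEquivalence_of_iso (evalFunctorCompIso θ u b)

/-- Two out of three: up to isomorphism, evaluation at the image of `u` is evaluation at `u`
followed by the equivalence `θ.app b`. -/
theorem IsUniversalElement.of_map {a : A} {u : F.obj a} (θ : PreTrans F G)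
    (hθ : ∀ b, IsEquiv (θ.app b)) (hu : IsUniversalElement G ((θ.app a).toFunctor.obj u)) :
    IsUniversalElement F u := by
  intro b
  have := hu b
  have := (hθ b).isEquivalence
  have := Functor.isEquivalence_of_iso (evalFunctorCompIso θ u b).symm
  exact Functor.isEquivalence_of_comp_right (evalFunctor F u b) (θ.app b).toFunctor

/-- Existence of a universal element at `a` is invariant under natural pointwise equivalences. -/
theorem PreTrans.exists_isUniversalElement_iff (θ : PreTrans F G) (hθ : ∀ b, IsEquiv (θ.app b))
    (a : A) : (∃ u : F.obj a, IsUniversalElement F u) ↔ ∃ u : G.obj a, IsUniversalElement G u := by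
  constructor
  · rintro ⟨u, hu⟩
    exact ⟨_, hu.map θ hθ⟩
  · rintro ⟨u, hu⟩
    have := (hθ a).isEquivalence
    exact ⟨(θ.app a).toFunctor.objPreimage u, .of_map θ hθ
      (hu.congr ((θ.app a).toFunctor.objObjPreimageIso u).symm)⟩

theorem isUniversalElement_id (a : A) : IsUniversalElement (corep a) (𝟙 a : a ⟶ a) := by
  intro b
  exact Functor.isEquivalence_of_iso (F := 𝟭 (a ⟶ b))
    (NatIso.ofComponents (fun f => (λ_ f).symm) (by
    intro f g γ
    exact leftUnitor_inv_naturality γ))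

theorem evalFunctor_mapComp_naturality {a b c : A} (u : F.obj a) {f f' : a ⟶ b} (γ : f ⟶ f')
    (g : b ⟶ c) :
    (F.map₂ (γ ▷ g)).toNatTrans.app u ≫ (F.mapComp f' g).hom.toNatTrans.app u =
      (F.mapComp f g).hom.toNatTrans.app u ≫
        (F.map g).toFunctor.map ((F.map₂ γ).toNatTrans.app u) := by
  have h : F.map₂ (γ ▷ g) ≫ (F.mapComp f' g).hom = (F.mapComp f g).hom ≫ F.map₂ γ ▷ F.map g := by
    simp
  exact congrArg (fun m => m.toNatTrans.app u) h

variable {F : A ⥤ᵖ Cat.{w₁, v₁}}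

/-- The pseudonatural transformation determined by an element. -/
def yonedaTrans (F : A ⥤ᵖ Cat.{w₁, v₁}) {a : A} (u : F.obj a) : corep a ⟶ F where
  app b := (evalFunctor F u b).toCatHom
  naturality {b c} g := Cat.Hom.isoMk (NatIso.ofComponents
    (fun f => (Cat.Hom.toNatIso (F.mapComp f g)).app u)
    (fun {f f'} γ => evalFunctor_mapComp_naturality u γ g))
  naturality_naturality {b c g h} γ := cat_hom₂_ext fun (f : a ⟶ b) => by
    have h : F.map₂ (f ◁ γ) ≫ (F.mapComp f h).hom = (F.mapComp f g).hom ≫ F.map f ◁ F.map₂ γ := by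
      simp
    exact congrArg (fun m => m.toNatTrans.app u) h
  naturality_id b := cat_hom₂_ext fun (f : a ⟶ b) => by
    have h'' : (F.mapComp f (𝟙 b)).hom.toNatTrans.app u ≫
        (F.mapId b).hom.toNatTrans.app ((F.map f).toFunctor.obj u) =
          (F.map₂ (ρ_ f).hom).toNatTrans.app u ≫ 𝟙 _ ≫ 𝟙 _ := by simp
    exact h''
  naturality_comp {b c d} g h := cat_hom₂_ext fun (f : a ⟶ b) => by
    have e : (F.mapComp f (g ≫ h)).hom ≫ F.map f ◁ (F.mapComp g h).hom =
        F.map₂ (α_ f g h).inv ≫ (F.mapComp (f ≫ g) h).hom ≫ (F.mapComp f g).hom ▷ F.map h ≫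
          (α_ _ _ _).hom := by simp [map₂_associator_inv]
    have e' := congrArg (fun m => m.toNatTrans.app u) e
    have e'' : (F.mapComp f (g ≫ h)).hom.toNatTrans.app u ≫
        (F.mapComp g h).hom.toNatTrans.app ((F.map f).toFunctor.obj u) =
          (F.map₂ (α_ f g h).inv).toNatTrans.app u ≫ 𝟙 _ ≫
          (F.mapComp (f ≫ g) h).hom.toNatTrans.app u ≫ 𝟙 _ ≫
          (F.map h).toFunctor.map ((F.mapComp f g).hom.toNatTrans.app u) ≫ 𝟙 _ := by
      simpa using e'
    exact e''

theorem IsUniversalElement.isEquiv_yonedaTrans {a : A} {u : F.obj a} (hu : IsUniversalElement F u) :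
    IsEquiv (yonedaTrans F u) :=
  isEquiv_of_pointwise _ fun b => isEquiv_of_isEquivalence _ (hu b)

/-- A universal element makes the Yoneda transformation a pointwise equivalence, hence an
equivalence; conversely, a representation carries the universal element `𝟙 a` of `A(a, -)` to one of
`F`. -/
theorem exists_isUniversalElement_iff (F : A ⥤ᵖ Cat.{w₁, v₁}) (a : A) :
    (∃ u : F.obj a, IsUniversalElement F u) ↔ Nonempty (Bicategory.Equivalence (corep a) F) := by
  constructor
  · rintro ⟨u, hu⟩
    exact ⟨hu.isEquiv_yonedaTrans.choose⟩
  · rintro ⟨e⟩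
    exact ⟨_, (isUniversalElement_id a).map (.ofTrans e.hom) fun b => (isEquiv_hom e).app b⟩

end UniversalElement

/-! ### Biadjunctions and universal elements of `B(y, J -)`. -/

section OfBiadjunction
variable {A : Type u₁} [Bicategory.{w₁, v₁} A] {B : Type u₂} [Bicategory.{w₂, v₂} B]
  {L : B ⥤ᵖ A} {J : A ⥤ᵖ B}

/-- The functor `f ↦ u ≫ J f`. -/
def postcompMap (J : A ⥤ᵖ B) {y : B} {c : A} (u : y ⟶ J.obj c) (b : A) :
    (c ⟶ b) ⥤ (y ⟶ J.obj b) where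
  obj f := u ≫ J.map f
  map γ := u ◁ J.map₂ γ

/-- The functor `g ↦ L g ≫ k`. -/
def mapPrecomp (L : B ⥤ᵖ A) {x : B} {b : A} (k : L.obj x ⟶ b) (y : B) :
    (y ⟶ x) ⥤ (L.obj y ⟶ b) where
  obj g := L.map g ≫ k
  map γ := L.map₂ γ ▷ k

section
variable {y : B} (u : y ⟶ J.obj (L.obj y)) (κ : ∀ a, L.obj (J.obj a) ⟶ a)
  (m : ∀ {a b : A} (f : a ⟶ b), L.map (J.map f) ≫ κ b ≅ κ a ≫ f)
  (hm : ∀ {a b : A} {f g : a ⟶ b} (γ : f ⟶ g),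
    L.map₂ (J.map₂ γ) ▷ κ b ≫ (m g).hom = (m f).hom ≫ κ a ◁ γ)
  (t : 𝟙 (L.obj y) ≅ L.map u ≫ κ (L.obj y))

/-- One of the comparison isomorphisms of a biadjunction. -/
def homUnitIso (b : A) :
    𝟭 (L.obj y ⟶ b) ≅ postcompMap J u b ⋙ mapPrecomp L (κ b) y :=
  NatIso.ofComponents (fun f => (λ_ f).symm ≪≫ whiskerRightIso t f ≪≫ α_ _ _ _ ≪≫
    whiskerLeftIso (L.map u) (m f).symm ≪≫ (α_ _ _ _).symm ≪≫
    whiskerRightIso (L.mapComp u (J.map f)).symm (κ b)) (by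
    intro f g γ
    change γ ≫ (λ_ g).inv ≫ t.hom ▷ g ≫ (α_ _ _ _).hom ≫ L.map u ◁ (m g).inv ≫ (α_ _ _ _).inv ≫
      (L.mapComp u (J.map g)).inv ▷ κ b = ((λ_ f).inv ≫ t.hom ▷ f ≫ (α_ _ _ _).hom ≫
      L.map u ◁ (m f).inv ≫ (α_ _ _ _).inv ≫ (L.mapComp u (J.map f)).inv ▷ κ b) ≫
      L.map₂ (u ◁ J.map₂ γ) ▷ κ b
    have h : (m f).inv ≫ L.map₂ (J.map₂ γ) ▷ κ b = κ (L.obj y) ◁ γ ≫ (m g).inv := by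
      rw [Iso.inv_comp_eq, ← Category.assoc, ← hm, Category.assoc, Iso.hom_inv_id,
        Category.comp_id]
    have h' := congrArg (L.map u ◁ ·) h
    simp only [whiskerLeft_comp] at h'
    simp only [L.map₂_whisker_left, comp_whiskerRight, Category.assoc, inv_hom_whiskerRight_assoc,
      whisker_assoc, Iso.inv_hom_id_assoc, reassoc_of% h']
    rw [leftUnitor_inv_naturality_assoc, whisker_exchange_assoc]
    simp)

end

section
variable {y : B} (u : ∀ x, x ⟶ J.obj (L.obj x)) {b : A} (k : L.obj (J.obj b) ⟶ b)
  (n : ∀ {x : B} (f : y ⟶ x), f ≫ u x ≅ u y ≫ J.map (L.map f))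
  (hn : ∀ {x : B} {f g : y ⟶ x} (γ : f ⟶ g),
    γ ▷ u x ≫ (n g).hom = (n f).hom ≫ u y ◁ J.map₂ (L.map₂ γ))
  (t : u (J.obj b) ≫ J.map k ≅ 𝟙 (J.obj b))

/-- One of the comparison isomorphisms of a biadjunction. -/
def homCounitIso : mapPrecomp L k y ⋙ postcompMap J (u y) b ≅ 𝟭 (y ⟶ J.obj b) :=
  NatIso.ofComponents (fun f => whiskerLeftIso (u y) (J.mapComp (L.map f) k) ≪≫ (α_ _ _ _).symm ≪≫
    whiskerRightIso (n f).symm (J.map k) ≪≫ α_ _ _ _ ≪≫ whiskerLeftIso f t ≪≫ ρ_ f) (by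
    intro f g γ
    change u y ◁ J.map₂ (L.map₂ γ ▷ k) ≫ u y ◁ (J.mapComp (L.map g) k).hom ≫ (α_ _ _ _).inv ≫
      (n g).inv ▷ J.map k ≫ (α_ _ _ _).hom ≫ g ◁ t.hom ≫ (ρ_ g).hom =
      (u y ◁ (J.mapComp (L.map f) k).hom ≫ (α_ _ _ _).inv ≫
      (n f).inv ▷ J.map k ≫ (α_ _ _ _).hom ≫ f ◁ t.hom ≫ (ρ_ f).hom) ≫ γ
    have h : u y ◁ J.map₂ (L.map₂ γ) ≫ (n g).inv = (n f).inv ≫ γ ▷ u (J.obj b) := by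
      rw [Iso.eq_inv_comp, ← Category.assoc, ← hn, Category.assoc, Iso.hom_inv_id,
        Category.comp_id]
    have h' := congrArg (· ▷ J.map k) h
    simp only [comp_whiskerRight, whisker_assoc, Category.assoc] at h'
    simp only [J.map₂_whisker_right, whiskerLeft_comp, Category.assoc, whiskerLeft_inv_hom_assoc,
      ← rightUnitor_naturality]
    have e := whisker_exchange γ t.hom
    simp only [whiskerRight_comp, Category.assoc] at e
    rw [reassoc_of% e, Iso.hom_inv_id_assoc, ← reassoc_of% h', Iso.inv_hom_id_assoc])

end

/-- The inverse of `f ↦ η_y ≫ J f` is `g ↦ L g ≫ ε_b`; the two invertible modifications of the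
biadjunction give the natural isomorphisms. -/
theorem Biadjunction.isUniversalElement (h : Biadjunction L J) (y : B) :
    IsUniversalElement (J.comp (corep y)) (a := L.obj y) (h.unit.app y) := by
  intro b
  exact (CategoryTheory.Equivalence.mk (postcompMap J (h.unit.app y) b)
    (mapPrecomp L (h.counit.app b) y)
    (homUnitIso (h.unit.app y) h.counit.app (fun f => h.counit.naturality f)
      (fun γ => h.counit.naturality_naturality γ)
      ⟨h.leftMod.hom.as.app y, h.leftMod.inv.as.app y,
        congrArg (fun m => m.as.app y) h.leftMod.hom_inv_id,
        congrArg (fun m => m.as.app y) h.leftMod.inv_hom_id⟩ b)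
    (homCounitIso h.unit.app (h.counit.app b) (fun f => h.unit.naturality f)
      (fun γ => h.unit.naturality_naturality γ)
      ⟨h.rightMod.hom.as.app b, h.rightMod.inv.as.app b,
        congrArg (fun m => m.as.app b) h.rightMod.hom_inv_id,
        congrArg (fun m => m.as.app b) h.rightMod.inv_hom_id⟩)).isEquivalence_functor

/-- If each `B(y, J -)` has a universal element `y ⟶ J (G y)`, then `y ↦ G y` extends to a left
biadjoint of `J`. -/
theorem exists_biadjunction (G : B → A) (u : ∀ y, y ⟶ J.obj (G y))
    (hu : ∀ y, IsUniversalElement (J.comp (corep y)) (a := G y) (u y)) :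
    ∃ L : B ⥤ᵖ A, (∀ y, L.obj y = G y) ∧ Nonempty (Biadjunction L J) :=
  -- With the identity of `B` in place of `K`, the functor tested by `IsUniversal` is by definition
  -- the one tested by `IsUniversalElement`. The pseudofunctor built has object map `G` itself, so
  -- the equality on objects is `rfl`.
  ⟨universalFunctor (K := Pseudofunctor.id B) G u (fun y z => hu y z), fun _ => rfl,
    ⟨universalBiadjunction G u (fun y z => hu y z)⟩⟩

end OfBiadjunction

/-! ### Slices of pseudonatural transformations between pseudofunctors on a product. -/

section CurryTrans

/-- Pasting the naturality cells of `θ` along the two sides of a square gives its naturality cells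
at the two composites, and these are related by naturality at the 2-cell `σ`. For the interchange
square this is the modification axiom required in `curryTrans`. -/
theorem mapSquare_trans {X : Type u₁} [Bicategory.{w₁, v₁} X] {K : Type u₂} [Bicategory.{w₂, v₂} K]
    {P Q : X ⥤ᵖ K} (θ : P ⟶ Q) {x y x' y' : X} {g : x ⟶ y} {g' : x' ⟶ y'} {t : x ⟶ x'}
    {t' : y ⟶ y'} (σ : g ≫ t' ≅ t ≫ g') :
    P.map g ◁ (θ.naturality t').hom ≫ (α_ _ _ _).inv ≫ (θ.naturality g).hom ▷ Q.map t' ≫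
        (α_ _ _ _).hom ≫ θ.app x ◁ (mapSquare Q σ).hom ≫ (α_ _ _ _).inv =
      ((α_ _ _ _).inv ≫ (mapSquare P σ).hom ▷ θ.app y' ≫ (α_ _ _ _).hom ≫
        P.map t ◁ (θ.naturality g').hom ≫ (α_ _ _ _).inv) ≫ (θ.naturality t).hom ▷ Q.map g' := by
  have h1 := θ.naturality_comp g t'
  have h2 := θ.naturality_comp t g'
  have h3 := θ.naturality_naturality σ.hom
  have e1 : P.map g ◁ (θ.naturality t').hom ≫ (α_ _ _ _).inv ≫ (θ.naturality g).hom ▷ Q.map t' ≫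
        (α_ _ _ _).hom = (α_ _ _ _).inv ≫ (P.mapComp g t').inv ▷ θ.app y' ≫
        (θ.naturality (g ≫ t')).hom ≫ θ.app x ◁ (Q.mapComp g t').hom := by
    rw [h1]; simp
  have e2 : (P.mapComp t g').hom ▷ θ.app y' ≫ (α_ _ _ _).hom ≫ P.map t ◁ (θ.naturality g').hom ≫
      (α_ _ _ _).inv ≫ (θ.naturality t).hom ▷ Q.map g' =
      (θ.naturality (t ≫ g')).hom ≫ θ.app x ◁ (Q.mapComp t g').hom ≫ (α_ _ _ _).inv := by
    rw [reassoc_of% h2]; simp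
  simp only [mapSquare, Iso.trans_hom, Iso.symm_hom, P.map₂Iso_hom, Q.map₂Iso_hom, whiskerLeft_comp,
    comp_whiskerRight, Category.assoc]
  rw [reassoc_of% e1, e2, reassoc_of% h3, whiskerLeft_hom_inv_assoc]

variable {S : Type u₁} [Bicategory.{w₁, v₁} S] {A : Type u₂} [Bicategory.{w₂, v₂} A]
  {K : Type u₃} [Bicategory.{w₃, v₃} K] {P Q : S × A ⥤ᵖ K}

open CategoryTheory.Prod

/-- The components `P(-, a) ⟶ Q(-, a)` of a pseudonatural transformation `P ⟶ Q`. -/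
def curryTrans (θ : P ⟶ Q) : PreTrans (curry P) (curry Q) where
  app a := preWhisker (Bicategory.Prod.sectL S a).toPseudofunctor θ
  naturality f := Pseudofunctor.StrongTrans.isoMk (fun s => θ.naturality (𝟙 s ×ₘ f))
    (fun g => mapSquare_trans θ (interchange g f))
  naturality_naturality {_ _ f g} γ := Pseudofunctor.StrongTrans.homCategory.ext fun s =>
    θ.naturality_naturality (f := 𝟙 s ×ₘ f) (g := 𝟙 s ×ₘ g) (𝟙 (𝟙 s), γ)

end CurryTrans

/-! ### Evaluation of hypothesis (b) at the one-point category. -/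

section Evaluation
open CategoryTheory.Prod

/-- The one-object discrete category. -/
abbrev pt : Cat.{v, v} := Cat.of (Discrete PUnit.{v + 1})

/-- Evaluation at the point. -/
def evalPt (C : Cat.{v, v}) : Cat.of (pt.{v} ⟶ C) ⟶ C :=
  Functor.toCatHom
    { obj := fun h => h.toFunctor.obj ⟨⟨⟩⟩
      map := fun η => η.toNatTrans.app ⟨⟨⟩⟩ }

theorem isEquiv_evalPt (C : Cat.{v, v}) : IsEquiv (evalPt C) := by
  apply isEquiv_of_isEquivalence
  refine {
    faithful := ⟨fun {h k} η θ e => ?_⟩, full := ⟨fun {h k} η => ?_⟩,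
    essSurj := ⟨fun c => ?_⟩ }
  · exact cat_hom₂_ext fun ⟨⟨⟩⟩ => e
  · exact ⟨NatTrans.toCatHom₂ (Discrete.natTrans fun ⟨⟨⟩⟩ => η), rfl⟩
  · exact ⟨((Functor.const (Discrete PUnit)).obj c).toCatHom, ⟨Iso.refl _⟩⟩

variable {A : Type u₁} [Bicategory.{w₁, v₁} A]

theorem evalPt_naturality {C D : Cat.{v, v}} (F : C ⟶ D) {h k : pt ⟶ C} (η : h ⟶ k) :
    F.toFunctor.map (η.toNatTrans.app ⟨⟨⟩⟩) ≫ 𝟙 (F.toFunctor.obj (k.toFunctor.obj ⟨⟨⟩⟩)) =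
      𝟙 (F.toFunctor.obj (h.toFunctor.obj ⟨⟨⟩⟩)) ≫ F.toFunctor.map (η.toNatTrans.app ⟨⟨⟩⟩) :=
  (Category.comp_id _).trans (Category.id_comp _).symm

/-- The component at the point of the whiskering of `h` and `γ` in the hom pseudofunctor. -/
def evalMap₂ {C D : Cat.{v, v}} (h : pt ⟶ C) {F G : C ⟶ D} (γ : F ⟶ G) :
    F.toFunctor.obj (h.toFunctor.obj ⟨⟨⟩⟩) ⟶ G.toFunctor.obj (h.toFunctor.obj ⟨⟨⟩⟩) :=
  F.toFunctor.map (h.toFunctor.map (𝟙 (Discrete.mk PUnit.unit))) ≫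
    γ.toNatTrans.app (h.toFunctor.obj ⟨⟨⟩⟩)

/-- The hom pseudofunctor acts on 2-cells by whiskering on both sides, which leaves a factor coming
from an identity of the point; functoriality removes it. -/
theorem evalMap₂_eq {C D : Cat.{v, v}} (h : pt ⟶ C) {F G : C ⟶ D} (γ : F ⟶ G) :
    evalMap₂ h γ = γ.toNatTrans.app (h.toFunctor.obj ⟨⟨⟩⟩) := by
  have e : F.toFunctor.map (h.toFunctor.map (𝟙 (Discrete.mk PUnit.unit))) = 𝟙 _ :=
    (congrArg F.toFunctor.map (h.toFunctor.map_id _)).trans (F.toFunctor.map_id _)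
  exact (congrArg (· ≫ γ.toNatTrans.app _) e).trans (Category.id_comp _)

theorem evalPt_map₂ {C D : Cat.{v, v}} (h : pt ⟶ C) {F G : C ⟶ D} (γ : F ⟶ G) :
    evalMap₂ h γ ≫ 𝟙 (G.toFunctor.obj (h.toFunctor.obj ⟨⟨⟩⟩)) =
    𝟙 (F.toFunctor.obj (h.toFunctor.obj ⟨⟨⟩⟩)) ≫ γ.toNatTrans.app (h.toFunctor.obj ⟨⟨⟩⟩) := by
  rw [evalMap₂_eq, Category.id_comp, Category.comp_id]

/-- Evaluation at the point. -/
def evalTrans (Q : A ⥤ᵖ Cat.{v, v}) : PreTrans (sliceRight (homTo Q) (op pt)) Q where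
  app a := evalPt (Q.obj a)
  naturality f := Cat.Hom.isoMk (NatIso.ofComponents (fun h => Iso.refl _)
    (fun η => evalPt_naturality (Q.map f) η))
  naturality_naturality {a b f g} γ := cat_hom₂_ext fun (h : pt ⟶ Q.obj a) => by
    exact evalPt_map₂ h (Q.map₂ γ)

variable {S : Type u₂} [Bicategory.{w₂, v₂} S]

/-- Evaluation at the point, for a fixed second variable. -/
def evalSlice (T : S × A ⥤ᵖ Cat.{v, v}) (a : A) :
    slice ((prodExchange S Cat.{v, v}ᵒᵖ A).comp (homTo T)) (op pt, a) ⟶ slice T a where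
  app s := evalPt (T.obj (s, a))
  naturality f := Cat.Hom.isoMk (NatIso.ofComponents (fun h => Iso.refl _)
    (fun η => evalPt_naturality (T.map (f ×ₘ 𝟙 a)) η))
  naturality_naturality {s t f g} γ := cat_hom₂_ext fun (h : pt ⟶ T.obj (s, a)) =>
    evalPt_map₂ h (T.map₂ ((γ, 𝟙 (𝟙 a)) : (f ×ₘ 𝟙 a) ⟶ (g ×ₘ 𝟙 a)))
  naturality_id s := cat_hom₂_ext fun (h : pt ⟶ T.obj (s, a)) => by
    -- This is the unit axiom evaluated at `h` and at the point. The identities are the components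
    -- of the associators and unitors of `Cat`; the extra cells at identities come from the
    -- constraints of composite pseudofunctors.
    have e : 𝟙 _ ≫ ((T.map₂ (𝟙 (𝟙 (s, a)))).toNatTrans.app (h.toFunctor.obj ⟨⟨⟩⟩) ≫
        (T.mapId (s, a)).hom.toNatTrans.app (h.toFunctor.obj ⟨⟨⟩⟩)) =
      (evalMap₂ h (T.map₂ (𝟙 (𝟙 (s, a)))) ≫ evalMap₂ h (T.map₂ (𝟙 (𝟙 (s, a)))) ≫
        evalMap₂ h (T.mapId (s, a)).hom ≫ 𝟙 _ ≫ 𝟙 _) ≫ 𝟙 _ ≫ 𝟙 _ := by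
      simp only [T.map₂_id]
      simp [evalMap₂_eq]
    exact e
  naturality_comp {s t r} f g := cat_hom₂_ext fun (h : pt ⟶ T.obj (s, a)) => by
    let i : (f ≫ g) ×ₘ 𝟙 a ⟶ (f ×ₘ 𝟙 a) ≫ (g ×ₘ 𝟙 a) := (𝟙 (f ≫ g), (λ_ (𝟙 a)).inv)
    have e : 𝟙 _ ≫ ((T.map₂ i).toNatTrans.app (h.toFunctor.obj ⟨⟨⟩⟩) ≫
        (T.mapComp (f ×ₘ 𝟙 a) (g ×ₘ 𝟙 a)).hom.toNatTrans.app (h.toFunctor.obj ⟨⟨⟩⟩)) =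
      (evalMap₂ h (T.map₂ i) ≫ evalMap₂ h (T.map₂ (𝟙 ((f ×ₘ 𝟙 a) ≫ (g ×ₘ 𝟙 a)))) ≫
        evalMap₂ h (T.mapComp (f ×ₘ 𝟙 a) (g ×ₘ 𝟙 a)).hom ≫ 𝟙 _ ≫ 𝟙 _ ≫ 𝟙 _) ≫ 𝟙 _ ≫ 𝟙 _ ≫
        𝟙 _ ≫ (T.map (g ×ₘ 𝟙 a)).toFunctor.map (𝟙 _) ≫ 𝟙 _ := by
      simp only [T.map₂_id]
      simp [evalMap₂_eq]
    exact e

/-- Evaluation at the point. -/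
def evalCurry (T : S × A ⥤ᵖ Cat.{v, v}) :
    PreTrans ((Bicategory.Prod.sectR (op pt) A).toPseudofunctor.comp
      (curry ((prodExchange S Cat.{v, v}ᵒᵖ A).comp (homTo T)))) (curry T) where
  app a := evalSlice T a
  naturality {a b} f := Pseudofunctor.StrongTrans.isoMk
    (fun s => Cat.Hom.isoMk (NatIso.ofComponents (fun h => Iso.refl _)
      (fun η => evalPt_naturality (T.map (𝟙 s ×ₘ f)) η)))
    (fun {s t} g => cat_hom₂_ext fun (h : pt ⟶ T.obj (s, a)) => by
      have e : 𝟙 _ ≫ 𝟙 _ ≫ (T.map (𝟙 t ×ₘ f)).toFunctor.map (𝟙 _) ≫ 𝟙 _ ≫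
          ((T.mapComp (g ×ₘ 𝟙 a) (𝟙 t ×ₘ f)).inv.toNatTrans.app (h.toFunctor.obj ⟨⟨⟩⟩) ≫
          (T.map₂ (interchange g f).hom).toNatTrans.app (h.toFunctor.obj ⟨⟨⟩⟩) ≫
          (T.mapComp (𝟙 s ×ₘ f) (g ×ₘ 𝟙 b)).hom.toNatTrans.app (h.toFunctor.obj ⟨⟨⟩⟩)) ≫ 𝟙 _ =
        (𝟙 _ ≫ ((((((𝟙 _ ≫ 𝟙 _) ≫ 𝟙 _) ≫ evalMap₂ h (T.mapComp (g ×ₘ 𝟙 a) (𝟙 t ×ₘ f)).inv) ≫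
          evalMap₂ h (T.map₂ (𝟙 ((g ×ₘ 𝟙 a) ≫ (𝟙 t ×ₘ f)))))) ≫
          evalMap₂ h (T.map₂ (interchange g f).hom) ≫
          (evalMap₂ h (T.map₂ (𝟙 ((𝟙 s ×ₘ f) ≫ (g ×ₘ 𝟙 b)))) ≫
            evalMap₂ h (T.mapComp (𝟙 s ×ₘ f) (g ×ₘ 𝟙 b)).hom ≫ 𝟙 _ ≫ 𝟙 _ ≫ 𝟙 _)) ≫
          𝟙 _ ≫ 𝟙 _ ≫ 𝟙 _) ≫ (T.map (g ×ₘ 𝟙 b)).toFunctor.map (𝟙 _) := by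
        simp only [T.map₂_id]
        simp [evalMap₂_eq]
      exact e)
  naturality_naturality {a b f g} γ := Pseudofunctor.StrongTrans.homCategory.ext fun s =>
    cat_hom₂_ext fun (h : pt ⟶ T.obj (s, a)) =>
    evalPt_map₂ h (T.map₂ ((𝟙 (𝟙 s), γ) : (𝟙 s ×ₘ f) ⟶ (𝟙 s ×ₘ g)))

end Evaluation

/-! ### Universal elements of `C(y, J -)` are weighted bicolimits. -/

section Bicolimit

/-- Composition of pseudofunctors is associative. -/
def PreTrans.assoc {X : Type u₁} [Bicategory.{w₁, v₁} X] {Y : Type u₂} [Bicategory.{w₂, v₂} Y]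
    {Z : Type u₃} [Bicategory.{w₃, v₃} Z] {K : Type u₄} [Bicategory.{w₄, v₄} K]
    (F : X ⥤ᵖ Y) (G : Y ⥤ᵖ Z) (H : Z ⥤ᵖ K) : PreTrans (F.comp (G.comp H)) ((F.comp G).comp H) where
  app x := 𝟙 (H.obj (G.obj (F.obj x)))
  naturality f := ρ_ (H.map (G.map (F.map f))) ≪≫ (λ_ (H.map (G.map (F.map f)))).symm
  naturality_naturality {x y f g} γ := by
    change H.map₂ (G.map₂ (F.map₂ γ)) ▷ 𝟙 _ ≫ (ρ_ (H.map (G.map (F.map g)))).hom ≫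
        (λ_ (H.map (G.map (F.map g)))).inv =
      ((ρ_ (H.map (G.map (F.map f)))).hom ≫ (λ_ (H.map (G.map (F.map f)))).inv) ≫
        𝟙 _ ◁ H.map₂ (G.map₂ (F.map₂ γ))
    simp

theorem isEquiv_id {K : Type u₁} [Bicategory.{w₁, v₁} K] (a : K) : IsEquiv (𝟙 a) :=
  isEquiv_hom (Bicategory.Equivalence.id a)

variable {S : Type v} [Bicategory.{v, v} S] {A : Type u₁} [Bicategory.{v, v} A]

theorem PreTrans.exists_isUniversalElement_comp_iff {X : Type u₂} [Bicategory.{w₂, v₂} X]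
    {K : Type u₃} [Bicategory.{w₃, v₃} K] {Φ : A ⥤ᵖ X} {P : X ⥤ᵖ K} {Q : A ⥤ᵖ K}
    (H : K ⥤ᵖ Cat.{w₁, v₁}) (θ : PreTrans (Φ.comp P) Q) (hθ : ∀ b, IsEquiv (θ.app b)) (a : A) :
    (∃ u : H.obj (P.obj (Φ.obj a)), IsUniversalElement (a := a) (Φ.comp (P.comp H)) u) ↔
      ∃ u : H.obj (Q.obj a), IsUniversalElement (a := a) (Q.comp H) u :=
  ((PreTrans.assoc Φ P H).exists_isUniversalElement_iff (fun _ => isEquiv_id _) a).trans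
    ((θ.post H).exists_isUniversalElement_iff (fun b => (hθ b).map H) a)

/-- The bilimit equivalence is restricted to `X` the point. Since `Cat(pt, -)` is equivalent to the
identity, both sides lose their dependence on `X`, and `Q a ≃ [S, Cat]_PS (W, T(-, a))` remains,
naturally in `a`. -/
theorem exists_isUniversalElement_iff_of_isWeightedBilimitFamily {W : S ⥤ᵖ Cat.{v, v}}
    {T : S × A ⥤ᵖ Cat.{v, v}} {Q : A ⥤ᵖ Cat.{v, v}} (hW : IsWeightedBilimitFamily W T Q) (a : A) :
    (∃ u : Q.obj a, IsUniversalElement Q u) ↔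
      ∃ u : (weightedHom W T).obj a, IsUniversalElement (weightedHom W T) u := by
  obtain ⟨e⟩ := hW
  have h₁ := (evalTrans Q).exists_isUniversalElement_iff (fun b => isEquiv_evalPt _) a
  have h₂ := PreTrans.exists_isUniversalElement_iff (.ofTrans (preWhisker
    (Bicategory.Prod.sectR (op pt) A).toPseudofunctor e.hom)) (fun b => (isEquiv_hom e).app _) a
  have h₃ := (evalCurry T).exists_isUniversalElement_comp_iff (corep W)
    (fun b => isEquiv_of_pointwise (evalSlice T b) fun s => isEquiv_evalPt (T.obj (s, b))) a
  exact h₁.symm.trans (h₂.trans h₃)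

/-- Replacing `T` by the equivalent `A(D -, -)` identifies `Q` with `a ↦ [S, Cat]_PS (W, A(D -,
a))`, and representing the latter is what defines the weighted bicolimit. -/
theorem exists_isUniversalElement_iff_isWeightedBicolimit {W : S ⥤ᵖ Cat.{v, v}}
    {T : S × A ⥤ᵖ Cat.{v, v}} {Q : A ⥤ᵖ Cat.{v, v}} (hW : IsWeightedBilimitFamily W T Q)
    {D : Sᵒᵖ ⥤ᵖ A} (e : Bicategory.Equivalence T (homFrom D)) (a : A) :
    (∃ u : Q.obj a, IsUniversalElement Q u) ↔ IsWeightedBicolimit W D a := by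
  rw [IsWeightedBicolimit, ← exists_isUniversalElement_iff,
    exists_isUniversalElement_iff_of_isWeightedBilimitFamily hW]
  exact ((curryTrans e.hom).post (corep W)).exists_isUniversalElement_iff
    (fun b => (isEquiv_of_pointwise ((curryTrans e.hom).app b)
      fun s => (isEquiv_hom e).app (s, b)).map (corep W)) a

end Bicolimit

/-! ### Pseudonatural transformations on a product, from data in each variable. -/

section ProdTrans
open CategoryTheory.Prod IsoComma
variable {S : Type u₁} [Bicategory.{w₁, v₁} S] {T : Type u₂} [Bicategory.{w₂, v₂} T]
  {A : Type u₃} [Bicategory.{w₃, v₃} A] {K : Type u₄} [Bicategory.{w₄, v₄} K]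

/-- The data of a pseudonatural transformation `P ⟶ H ∘ (G × 1)` given separately in each
variable. -/
structure ProdTrans (P : S × A ⥤ᵖ K) (H : T × A ⥤ᵖ K) (G : S ⥤ᵖ T) where
  /-- the components -/
  app (s : S) (a : A) : P.obj (s, a) ⟶ H.obj (G.obj s, a)
  /-- naturality in the first variable -/
  natL {s t : S} (g : s ⟶ t) (a : A) :
    P.map (g ×ₘ 𝟙 a) ≫ app t a ≅ app s a ≫ H.map (G.map g ×ₘ 𝟙 a)
  /-- naturality in the second variable -/
  natR (s : S) {a b : A} (f : a ⟶ b) :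
    P.map (𝟙 s ×ₘ f) ≫ app s b ≅ app s a ≫ H.map (𝟙 (G.obj s) ×ₘ f)
  natL_naturality {s t : S} {g h : s ⟶ t} (γ : g ⟶ h) (a : A) :
    P.map₂ ((γ, 𝟙 (𝟙 a)) : (g ×ₘ 𝟙 a) ⟶ (h ×ₘ 𝟙 a)) ▷ app t a ≫ (natL h a).hom =
      (natL g a).hom ≫
        app s a ◁ H.map₂ ((G.map₂ γ, 𝟙 (𝟙 a)) : (G.map g ×ₘ 𝟙 a) ⟶ (G.map h ×ₘ 𝟙 a))
  natR_naturality (s : S) {a b : A} {f g : a ⟶ b} (γ : f ⟶ g) :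
    P.map₂ ((𝟙 (𝟙 s), γ) : (𝟙 s ×ₘ f) ⟶ (𝟙 s ×ₘ g)) ▷ app s b ≫ (natR s g).hom =
      (natR s f).hom ≫
        app s a ◁ H.map₂ ((𝟙 (𝟙 (G.obj s)), γ) : (𝟙 (G.obj s) ×ₘ f) ⟶ (𝟙 (G.obj s) ×ₘ g))
  natL_id (s : S) (a : A) : (natL (𝟙 s) a).hom ≫ app s a ◁
      (H.map₂ (((G.mapId s).hom, 𝟙 (𝟙 a)) : (G.map (𝟙 s) ×ₘ 𝟙 a) ⟶ 𝟙 (G.obj s, a)) ≫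
        (H.mapId (G.obj s, a)).hom) =
    (P.mapId (s, a)).hom ▷ app s a ≫ (λ_ (app s a)).hom ≫ (ρ_ (app s a)).inv
  natR_id (s : S) (a : A) : (natR s (𝟙 a)).hom ≫ app s a ◁ (H.mapId (G.obj s, a)).hom =
    (P.mapId (s, a)).hom ▷ app s a ≫ (λ_ (app s a)).hom ≫ (ρ_ (app s a)).inv
  natL_comp {s t r : S} (g : s ⟶ t) (h : t ⟶ r) (a : A) :
    (natL (g ≫ h) a).hom ≫ app s a ◁
      (H.map₂ (((G.mapComp g h).hom, (λ_ (𝟙 a)).inv) : (G.map (g ≫ h) ×ₘ 𝟙 a) ⟶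
        (G.map g ×ₘ 𝟙 a) ≫ (G.map h ×ₘ 𝟙 a)) ≫
        (H.mapComp (G.map g ×ₘ 𝟙 a) (G.map h ×ₘ 𝟙 a)).hom) =
    (P.map₂ ((𝟙 (g ≫ h), (λ_ (𝟙 a)).inv) : ((g ≫ h) ×ₘ 𝟙 a) ⟶ (g ×ₘ 𝟙 a) ≫ (h ×ₘ 𝟙 a)) ≫
        (P.mapComp (g ×ₘ 𝟙 a) (h ×ₘ 𝟙 a)).hom) ▷ app r a ≫ (α_ _ _ _).hom ≫
      P.map (g ×ₘ 𝟙 a) ◁ (natL h a).hom ≫ (α_ _ _ _).inv ≫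
      (natL g a).hom ▷ H.map (G.map h ×ₘ 𝟙 a) ≫ (α_ _ _ _).hom
  natR_comp (s : S) {a b c : A} (f : a ⟶ b) (g : b ⟶ c) :
    (natR s (f ≫ g)).hom ≫ app s a ◁
      (H.map₂ (((ρ_ (𝟙 (G.obj s))).inv, 𝟙 (f ≫ g)) : (𝟙 (G.obj s) ×ₘ (f ≫ g)) ⟶
        (𝟙 (G.obj s) ×ₘ f) ≫ (𝟙 (G.obj s) ×ₘ g)) ≫
        (H.mapComp (𝟙 (G.obj s) ×ₘ f) (𝟙 (G.obj s) ×ₘ g)).hom) =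
    (P.map₂ (((ρ_ (𝟙 s)).inv, 𝟙 (f ≫ g)) : (𝟙 s ×ₘ (f ≫ g)) ⟶ (𝟙 s ×ₘ f) ≫ (𝟙 s ×ₘ g)) ≫
        (P.mapComp (𝟙 s ×ₘ f) (𝟙 s ×ₘ g)).hom) ▷ app s c ≫ (α_ _ _ _).hom ≫
      P.map (𝟙 s ×ₘ f) ◁ (natR s g).hom ≫ (α_ _ _ _).inv ≫
      (natR s f).hom ▷ H.map (𝟙 (G.obj s) ×ₘ g) ≫ (α_ _ _ _).hom
  exchange {s t : S} (g : s ⟶ t) {a b : A} (f : a ⟶ b) :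
    P.map (g ×ₘ 𝟙 a) ◁ (natR t f).hom ≫ (α_ _ _ _).inv ≫
      (natL g a).hom ▷ H.map (𝟙 (G.obj t) ×ₘ f) ≫ (α_ _ _ _).hom ≫
      app s a ◁ (mapSquare H (interchange (G.map g) f)).hom ≫ (α_ _ _ _).inv =
    ((α_ _ _ _).inv ≫ (mapSquare P (interchange g f)).hom ▷ app t b ≫ (α_ _ _ _).hom ≫
      P.map (𝟙 s ×ₘ f) ◁ (natL g b).hom ≫ (α_ _ _ _).inv) ≫
      (natR s f).hom ▷ H.map (G.map g ×ₘ 𝟙 b)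

theorem map₂_id_comp_mapId (P : S ⥤ᵖ K) (s : S) :
    P.map₂ (𝟙 (𝟙 s)) ≫ (P.mapId s).hom = (P.mapId s).hom := by
  rw [P.map₂_id, Category.id_comp]

/-- A required compatibility can be proved by pasting known iso-comma 2-cells and then identifying
the two components of the result. -/
theorem IsoComma.hom₂_w_of_eq {P : S ⥤ᵖ K} {H : T ⥤ᵖ K} {p q : IsoComma P H} {f g : p ⟶ q}
    (x : f ⟶ g) {l : f.left ⟶ g.left} {r : f.right ⟶ g.right} (hl : x.left = l)
    (hr : x.right = r) : P.map₂ l ▷ q.arr ≫ g.sq.hom = f.sq.hom ≫ p.arr ◁ H.map₂ r := by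
  subst hl hr; exact hom₂_w x

/-- `w_id`, `w_comp` and `w_exchange` read the axioms of separate naturality as compatibility
conditions, so that each axiom becomes an iso-comma 2-cell available for pasting. -/
theorem IsoComma.w_id {P : S ⥤ᵖ K} {H : T ⥤ᵖ K} {p : IsoComma P H} {f : p ⟶ p}
    (l : f.left ⟶ 𝟙 p.left) (r : f.right ⟶ 𝟙 p.right)
    (h : f.sq.hom ≫ p.arr ◁ (H.map₂ r ≫ (H.mapId p.right).hom) =
      (P.map₂ l ≫ (P.mapId p.left).hom) ▷ p.arr ≫ (λ_ p.arr).hom ≫ (ρ_ p.arr).inv) :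
    P.map₂ l ▷ p.arr ≫ (Hom.sq (𝟙 p)).hom = f.sq.hom ≫ p.arr ◁ H.map₂ r := by
  rw [id_sq_hom]
  rw [← cancel_mono (p.arr ◁ (H.mapId p.right).hom)]
  simp only [whiskerLeft_comp, comp_whiskerRight, Category.assoc] at h
  simp [h]

theorem IsoComma.w_comp {P : S ⥤ᵖ K} {H : T ⥤ᵖ K} {p q t : IsoComma P H} {f : p ⟶ q} {g : q ⟶ t}
    {k : p ⟶ t} (l : k.left ⟶ f.left ≫ g.left) (r : k.right ⟶ f.right ≫ g.right)
    (h : k.sq.hom ≫ p.arr ◁ (H.map₂ r ≫ (H.mapComp f.right g.right).hom) =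
      (P.map₂ l ≫ (P.mapComp f.left g.left).hom) ▷ t.arr ≫ (α_ _ _ _).hom ≫
      P.map f.left ◁ g.sq.hom ≫ (α_ _ _ _).inv ≫ f.sq.hom ▷ H.map g.right ≫ (α_ _ _ _).hom) :
    P.map₂ l ▷ t.arr ≫ (Hom.sq (f ≫ g)).hom = k.sq.hom ≫ p.arr ◁ H.map₂ r := by
  rw [comp_sq_hom]
  rw [← cancel_mono (p.arr ◁ (H.mapComp f.right g.right).hom)]
  simp only [whiskerLeft_comp, comp_whiskerRight, Category.assoc] at h
  simp [h]

theorem IsoComma.w_exchange {P : S ⥤ᵖ K} {H : T ⥤ᵖ K} {p q q' t : IsoComma P H} {f : p ⟶ q}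
    {g : q ⟶ t} {f' : p ⟶ q'} {g' : q' ⟶ t} (l : f.left ≫ g.left ≅ f'.left ≫ g'.left)
    (r : f.right ≫ g.right ≅ f'.right ≫ g'.right)
    (h : P.map f.left ◁ g.sq.hom ≫ (α_ _ _ _).inv ≫ f.sq.hom ▷ H.map g.right ≫ (α_ _ _ _).hom ≫
      p.arr ◁ (mapSquare H r).hom ≫ (α_ _ _ _).inv =
      ((α_ _ _ _).inv ≫ (mapSquare P l).hom ▷ t.arr ≫ (α_ _ _ _).hom ≫
        P.map f'.left ◁ g'.sq.hom ≫ (α_ _ _ _).inv) ≫ f'.sq.hom ▷ H.map g'.right) :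
    P.map₂ l.hom ▷ t.arr ≫ (Hom.sq (f' ≫ g')).hom =
      (Hom.sq (f ≫ g)).hom ≫ p.arr ◁ H.map₂ r.hom := by
  simp only [mapSquare, Iso.trans_hom, Iso.symm_hom, P.map₂Iso_hom, H.map₂Iso_hom, whiskerLeft_comp,
    comp_whiskerRight, Category.assoc] at h
  rw [comp_sq_hom, comp_sq_hom, ← cancel_mono (p.arr ◁ (H.mapComp f'.right g'.right).hom),
    ← cancel_mono (α_ _ _ _).inv, ← cancel_epi ((P.mapComp f.left g.left).inv ▷ t.arr),
    ← cancel_epi (α_ _ _ _).inv]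
  simp [h]

namespace ProdTrans
variable {P : S × A ⥤ᵖ K} {H : T × A ⥤ᵖ K} {G : S ⥤ᵖ T} (θ : ProdTrans P H G)

/-- The components, as objects of the iso-comma bicategory. -/
def obj (s : S) (a : A) : IsoComma P H := ⟨(s, a), (G.obj s, a), θ.app s a⟩

/-- The squares in the first variable. -/
def homL {s t : S} (g : s ⟶ t) (a : A) : θ.obj s a ⟶ θ.obj t a :=
  ⟨g ×ₘ 𝟙 a, G.map g ×ₘ 𝟙 a, θ.natL g a⟩

/-- The squares in the second variable. -/
def homR (s : S) {a b : A} (f : a ⟶ b) : θ.obj s a ⟶ θ.obj s b :=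
  ⟨𝟙 s ×ₘ f, 𝟙 (G.obj s) ×ₘ f, θ.natR s f⟩

/-- 2-cells in the first variable. -/
def homL₂ {s t : S} {g h : s ⟶ t} (γ : g ⟶ h) (a : A) : θ.homL g a ⟶ θ.homL h a :=
  ⟨(γ, 𝟙 (𝟙 a)), (G.map₂ γ, 𝟙 (𝟙 a)), θ.natL_naturality γ a⟩

/-- 2-cells in the second variable. -/
def homR₂ (s : S) {a b : A} {f g : a ⟶ b} (γ : f ⟶ g) : θ.homR s f ⟶ θ.homR s g :=
  ⟨(𝟙 (𝟙 s), γ), (𝟙 (𝟙 (G.obj s)), γ), θ.natR_naturality s γ⟩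

/-- Compatibility with identities in the first variable. -/
def homLId (s : S) (a : A) : θ.homL (𝟙 s) a ⟶ 𝟙 (θ.obj s a) :=
  ⟨𝟙 (𝟙 (s, a)), ((G.mapId s).hom, 𝟙 (𝟙 a)), w_id (f := θ.homL (𝟙 s) a) (𝟙 (𝟙 (s, a)))
    ((G.mapId s).hom, 𝟙 (𝟙 a)) ((θ.natL_id s a).trans
      (congrArg (· ▷ θ.app s a ≫ (λ_ _).hom ≫ (ρ_ _).inv) (map₂_id_comp_mapId P (s, a)).symm))⟩

/-- Compatibility with identities in the second variable. -/
def homRId (s : S) (a : A) : θ.homR s (𝟙 a) ⟶ 𝟙 (θ.obj s a) :=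
  ⟨𝟙 (𝟙 (s, a)), 𝟙 (𝟙 (G.obj s, a)), w_id (f := θ.homR s (𝟙 a)) (𝟙 (𝟙 (s, a)))
    (𝟙 (𝟙 (G.obj s, a))) ((congrArg (fun m => (θ.natR s (𝟙 a)).hom ≫ θ.app s a ◁ m)
      (map₂_id_comp_mapId H (G.obj s, a))).trans ((θ.natR_id s a).trans
      (congrArg (· ▷ θ.app s a ≫ (λ_ _).hom ≫ (ρ_ _).inv) (map₂_id_comp_mapId P (s, a)).symm)))⟩

/-- Compatibility with composition in the first variable. -/
def homLComp {s t r : S} (g : s ⟶ t) (h : t ⟶ r) (a : A) :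
    θ.homL (g ≫ h) a ⟶ θ.homL g a ≫ θ.homL h a :=
  ⟨(𝟙 (g ≫ h), (λ_ (𝟙 a)).inv), ((G.mapComp g h).hom, (λ_ (𝟙 a)).inv),
    w_comp (f := θ.homL g a) (g := θ.homL h a) (k := θ.homL (g ≫ h) a) _ _ (θ.natL_comp g h a)⟩

/-- Compatibility with composition in the second variable. -/
def homRComp (s : S) {a b c : A} (f : a ⟶ b) (g : b ⟶ c) :
    θ.homR s (f ≫ g) ⟶ θ.homR s f ≫ θ.homR s g :=
  ⟨((ρ_ (𝟙 s)).inv, 𝟙 (f ≫ g)), ((ρ_ (𝟙 (G.obj s))).inv, 𝟙 (f ≫ g)),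
    w_comp (f := θ.homR s f) (g := θ.homR s g) (k := θ.homR s (f ≫ g)) _ _ (θ.natR_comp s f g)⟩

/-- Compatibility of the two variables. -/
def homExchange {s t : S} (g : s ⟶ t) {a b : A} (f : a ⟶ b) :
    θ.homL g a ≫ θ.homR t f ⟶ θ.homR s f ≫ θ.homL g b :=
  ⟨(interchange g f).hom, (interchange (G.map g) f).hom,
    w_exchange (f := θ.homL g a) (g := θ.homR t f) (f' := θ.homR s f) (g' := θ.homL g b)
      (interchange g f) (interchange (G.map g) f) (θ.exchange g f)⟩


/-- The square over `(g, f)`. -/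
def hom {s t : S} (g : s ⟶ t) {a b : A} (f : a ⟶ b) : θ.obj s a ⟶ θ.obj t b :=
  ⟨g ×ₘ f, G.map g ×ₘ f,
    -- The composite of the squares over `(g, 𝟙)` and `(𝟙, f)` lies over `(g ≫ 𝟙, 𝟙 ≫ f)`;
    -- conjugation by unitors places it over `(g, f)` itself.
    whiskerRightIso (P.map₂Iso (Iso.prod (ρ_ g).symm (λ_ f).symm)) (θ.app t b) ≪≫
    Hom.sq (θ.homL g a ≫ θ.homR t f) ≪≫
    whiskerLeftIso (θ.app s a) (H.map₂Iso (Iso.prod (ρ_ (G.map g)) (λ_ f)))⟩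

theorem hom_w {p q : IsoComma P H} {k : p ⟶ q} {l : p.left ⟶ q.left} {r : p.right ⟶ q.right}
    (i : l ≅ k.left) (j : k.right ≅ r) :
    P.map₂ i.hom ▷ q.arr ≫ k.sq.hom =
      (whiskerRightIso (P.map₂Iso i) q.arr ≪≫ k.sq ≪≫ whiskerLeftIso p.arr (H.map₂Iso j)).hom ≫
        p.arr ◁ H.map₂ j.inv := by
  simp only [Iso.trans_hom, whiskerRightIso_hom, whiskerLeftIso_hom, Category.assoc,
    P.map₂Iso_hom, H.map₂Iso_hom]
  rw [← whiskerLeft_comp, ← H.map₂_comp, Iso.hom_inv_id, H.map₂_id, whiskerLeft_id,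
    Category.comp_id]

/-- The square over `(g, f)` is the composite of those over `(g, 1)` and `(1, f)`. -/
def homIso {s t : S} (g : s ⟶ t) {a b : A} (f : a ⟶ b) :
    θ.hom g f ≅ θ.homL g a ≫ θ.homR t f :=
  isoMk (f := θ.hom g f) (g := θ.homL g a ≫ θ.homR t f) (Iso.prod (ρ_ g).symm (λ_ f).symm)
    (Iso.prod (ρ_ (G.map g)) (λ_ f)).symm
    (hom_w (k := θ.homL g a ≫ θ.homR t f) (Iso.prod (ρ_ g).symm (λ_ f).symm)
    (Iso.prod (ρ_ (G.map g)) (λ_ f)))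

/-- The pseudonatural transformation. -/
def toTrans : P ⟶ (prodMap G (Pseudofunctor.id A)).comp H where
  app x := θ.app x.1 x.2
  naturality {x y} k := (θ.hom k.1 k.2).sq
  naturality_naturality {x y k l} γ := by
    refine hom₂_w_of_eq ((θ.homIso k.1 k.2).hom ≫ θ.homL₂ γ.1 x.2 ▷ θ.homR y.1 k.2 ≫
      θ.homL l.1 x.2 ◁ θ.homR₂ y.1 γ.2 ≫ (θ.homIso l.1 l.2).inv) (Prod.ext ?_ ?_) (Prod.ext ?_ ?_)
    · change (ρ_ k.1).inv ≫ γ.1 ▷ 𝟙 y.1 ≫ l.1 ◁ 𝟙 (𝟙 y.1) ≫ (ρ_ l.1).hom = γ.1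
      simp
    · change (λ_ k.2).inv ≫ 𝟙 (𝟙 x.2) ▷ k.2 ≫ 𝟙 x.2 ◁ γ.2 ≫ (λ_ l.2).hom = γ.2
      simp
    · change (ρ_ (G.map k.1)).inv ≫ G.map₂ γ.1 ▷ 𝟙 _ ≫ G.map l.1 ◁ 𝟙 (𝟙 _) ≫
        (ρ_ (G.map l.1)).hom = G.map₂ γ.1
      simp
    · change (λ_ k.2).inv ≫ 𝟙 (𝟙 x.2) ▷ k.2 ≫ 𝟙 x.2 ◁ γ.2 ≫ (λ_ l.2).hom = γ.2
      simp
  naturality_id x := by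
    refine naturality_id_of_w (θ.hom (𝟙 x.1) (𝟙 x.2)).sq
      ((prodMap G (Pseudofunctor.id A)).mapId x).hom ?_
    refine hom₂_w_of_eq ((θ.homIso (𝟙 x.1) (𝟙 x.2)).hom ≫ θ.homLId x.1 x.2 ▷ θ.homR x.1 (𝟙 x.2) ≫
      (λ_ _).hom ≫ θ.homRId x.1 x.2) (Prod.ext ?_ ?_) (Prod.ext ?_ ?_)
    · change (ρ_ (𝟙 x.1)).inv ≫ 𝟙 (𝟙 x.1) ▷ 𝟙 x.1 ≫ (λ_ (𝟙 x.1)).hom ≫ 𝟙 _ = 𝟙 _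
      simp [unitors_equal]
    · change (λ_ (𝟙 x.2)).inv ≫ 𝟙 (𝟙 x.2) ▷ 𝟙 x.2 ≫ (λ_ (𝟙 x.2)).hom ≫ 𝟙 _ = 𝟙 _
      simp
    · change (ρ_ (G.map (𝟙 x.1))).inv ≫ (G.mapId x.1).hom ▷ 𝟙 _ ≫ (λ_ (𝟙 _)).hom ≫ 𝟙 _ =
        (G.mapId x.1).hom
      simp [unitors_equal]
    · change (λ_ (𝟙 x.2)).inv ≫ 𝟙 (𝟙 x.2) ▷ 𝟙 x.2 ≫ (λ_ (𝟙 x.2)).hom ≫ 𝟙 _ = 𝟙 _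
      simp
  naturality_comp {x y z} k l := by
    refine naturality_comp_of_w (θ.hom k.1 k.2) (θ.hom l.1 l.2) (θ.hom (k.1 ≫ l.1) (k.2 ≫ l.2)).sq
      ((prodMap G (Pseudofunctor.id A)).mapComp k l).hom ?_
    -- The pasting splits the composite in each variable, interchanges the inner pair `(1, k.2)` and
    -- `(l.1, 1)`, and regroups. By coherence the components reduce to the composition constraints.
    refine hom₂_w_of_eq (f := θ.hom (k.1 ≫ l.1) (k.2 ≫ l.2)) (g := θ.hom k.1 k.2 ≫ θ.hom l.1 l.2)
      ((θ.homIso (k.1 ≫ l.1) (k.2 ≫ l.2)).hom ≫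
      θ.homLComp k.1 l.1 x.2 ▷ θ.homR z.1 (k.2 ≫ l.2) ≫
      (θ.homL k.1 x.2 ≫ θ.homL l.1 x.2) ◁ θ.homRComp z.1 k.2 l.2 ≫ (α_ _ _ _).hom ≫
      θ.homL k.1 x.2 ◁ ((α_ _ _ _).inv ≫ θ.homExchange l.1 k.2 ▷ θ.homR z.1 l.2 ≫ (α_ _ _ _).hom) ≫
      (α_ _ _ _).inv ≫ (θ.homIso k.1 k.2).inv ▷ _ ≫ θ.hom k.1 k.2 ◁ (θ.homIso l.1 l.2).inv)
      (Prod.ext ?_ ?_) (Prod.ext ?_ ?_)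
    · change (ρ_ (k.1 ≫ l.1)).inv ≫ 𝟙 (k.1 ≫ l.1) ▷ 𝟙 z.1 ≫ (k.1 ≫ l.1) ◁ (ρ_ (𝟙 z.1)).inv ≫
        (α_ _ _ _).hom ≫ k.1 ◁ ((α_ _ _ _).inv ≫ ((ρ_ l.1).hom ≫ (λ_ l.1).inv) ▷ 𝟙 z.1 ≫
        (α_ _ _ _).hom) ≫ (α_ _ _ _).inv ≫ (ρ_ k.1).hom ▷ _ ≫ k.1 ◁ (ρ_ l.1).hom = 𝟙 (k.1 ≫ l.1)
      bicategory
    · change (λ_ (k.2 ≫ l.2)).inv ≫ (λ_ (𝟙 x.2)).inv ▷ (k.2 ≫ l.2) ≫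
        (𝟙 x.2 ≫ 𝟙 x.2) ◁ 𝟙 (k.2 ≫ l.2) ≫
        (α_ _ _ _).hom ≫ 𝟙 x.2 ◁ ((α_ _ _ _).inv ≫ ((λ_ k.2).hom ≫ (ρ_ k.2).inv) ▷ l.2 ≫
        (α_ _ _ _).hom) ≫ (α_ _ _ _).inv ≫ (λ_ k.2).hom ▷ _ ≫ k.2 ◁ (λ_ l.2).hom = 𝟙 (k.2 ≫ l.2)
      bicategory
    · change (ρ_ (G.map (k.1 ≫ l.1))).inv ≫ (G.mapComp k.1 l.1).hom ▷ 𝟙 (G.obj z.1) ≫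
        (G.map k.1 ≫ G.map l.1) ◁ (ρ_ (𝟙 (G.obj z.1))).inv ≫
        (α_ _ _ _).hom ≫ G.map k.1 ◁ ((α_ _ _ _).inv ≫
        ((ρ_ (G.map l.1)).hom ≫ (λ_ (G.map l.1)).inv) ▷ 𝟙 (G.obj z.1) ≫
        (α_ _ _ _).hom) ≫ (α_ _ _ _).inv ≫ (ρ_ (G.map k.1)).hom ▷ _ ≫
        G.map k.1 ◁ (ρ_ (G.map l.1)).hom = (G.mapComp k.1 l.1).hom
      bicategory
    · change (λ_ (k.2 ≫ l.2)).inv ≫ (λ_ (𝟙 x.2)).inv ▷ (k.2 ≫ l.2) ≫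
        (𝟙 x.2 ≫ 𝟙 x.2) ◁ 𝟙 (k.2 ≫ l.2) ≫
        (α_ _ _ _).hom ≫ 𝟙 x.2 ◁ ((α_ _ _ _).inv ≫ ((λ_ k.2).hom ≫ (ρ_ k.2).inv) ▷ l.2 ≫
        (α_ _ _ _).hom) ≫ (α_ _ _ _).inv ≫ (λ_ k.2).hom ▷ _ ≫ k.2 ◁ (λ_ l.2).hom = 𝟙 (k.2 ≫ l.2)
      bicategory

end ProdTrans
end ProdTrans

/-! ### From transformations of curried pseudofunctors to transformations on the product. -/

section OfCurry
open CategoryTheory.Prod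
variable {S : Type u₁} [Bicategory.{w₁, v₁} S] {T : Type u₂} [Bicategory.{w₂, v₂} T]
  {A : Type u₃} [Bicategory.{w₃, v₃} A] {K : Type u₄} [Bicategory.{w₄, v₄} K]

/-- The pseudofunctor `s ↦ P(s, -)` into `[A, K]_PS`. -/
def curryRight (P : S × A ⥤ᵖ K) : S ⥤ᵖ (A ⥤ᵖ K) :=
  curry ((Bicategory.Prod.swap A S).toPseudofunctor.comp P)

/-- The components of an invertible modification. -/
def modificationIsoApp {F F' : A ⥤ᵖ K} {θ θ' : F ⟶ F'} (m : θ ≅ θ') (a : A) :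
    θ.app a ≅ θ'.app a where
  hom := m.hom.as.app a
  inv := m.inv.as.app a
  hom_inv_id := congrArg (fun m => m.as.app a) m.hom_inv_id
  inv_hom_id := congrArg (fun m => m.as.app a) m.inv_hom_id

/-- The constraints of curried and composite pseudofunctors carry redundant identity 2-cells. This
lemma and the next one for composites replace them by the simplified constraints inside an axiom. -/
theorem naturality_congr_id {x y : K} {u : x ⟶ y} {k : x ⟶ x} {h : y ⟶ y} {m m' : h ⟶ 𝟙 y}
    {n n' : k ⟶ 𝟙 x} (e₁ : m = m') (e₂ : n = n') (i : k ≫ u ≅ u ≫ h)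
    (e : i.hom ≫ u ◁ m = n ▷ u ≫ (λ_ u).hom ≫ (ρ_ u).inv) :
    i.hom ≫ u ◁ m' = n' ▷ u ≫ (λ_ u).hom ≫ (ρ_ u).inv := by
  subst e₁ e₂; exact e

theorem naturality_congr_comp {x y z x' y' z' : K} {u : x ⟶ x'} {u' : y ⟶ y'} {u'' : z ⟶ z'}
    {k : x ⟶ y} {l : y ⟶ z} {kl : x ⟶ z} {k' : x' ⟶ y'} {l' : y' ⟶ z'} {kl' : x' ⟶ z'}
    {m m' : kl' ⟶ k' ≫ l'} {n n' : kl ⟶ k ≫ l} (e₁ : m = m') (e₂ : n = n')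
    (i : kl ≫ u'' ≅ u ≫ kl') (j : l ≫ u'' ≅ u' ≫ l') (j' : k ≫ u' ≅ u ≫ k')
    (e : i.hom ≫ u ◁ m = n ▷ u'' ≫ (α_ _ _ _).hom ≫ k ◁ j.hom ≫ (α_ _ _ _).inv ≫
      j'.hom ▷ l' ≫ (α_ _ _ _).hom) :
    i.hom ≫ u ◁ m' = n' ▷ u'' ≫ (α_ _ _ _).hom ≫ k ◁ j.hom ≫ (α_ _ _ _).inv ≫
      j'.hom ▷ l' ≫ (α_ _ _ _).hom := by
  subst e₁ e₂; exact e

/-- Exchanging the factors reverses the interchange isomorphism, up to identity 2-cells introduced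
by composing with the swap. -/
theorem mapSquare_swap (P : S × A ⥤ᵖ K) {s t : S} (g : s ⟶ t) {a b : A} (f : a ⟶ b) :
    (mapSquare ((Bicategory.Prod.swap A S).toPseudofunctor.comp P) (interchange f g)).hom =
      (mapSquare P (interchange g f)).inv := by
  have e : ((P.mapComp (𝟙 s ×ₘ f) (g ×ₘ 𝟙 b)).inv ≫ P.map₂ (𝟙 ((𝟙 s ×ₘ f) ≫ (g ×ₘ 𝟙 b)))) ≫
      P.map₂ (interchange g f).inv ≫ (P.map₂ (𝟙 ((g ×ₘ 𝟙 a) ≫ (𝟙 t ×ₘ f))) ≫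
        (P.mapComp (g ×ₘ 𝟙 a) (𝟙 t ×ₘ f)).hom) =
      ((P.mapComp (𝟙 s ×ₘ f) (g ×ₘ 𝟙 b)).inv ≫ P.map₂ (interchange g f).inv) ≫
        (P.mapComp (g ×ₘ 𝟙 a) (𝟙 t ×ₘ f)).hom := by
    simp only [P.map₂_id, Category.comp_id, Category.id_comp, Category.assoc]
  exact e

/-- The modification axiom is stated with the interchange squares of the swapped product, which are
the inverses of the wanted ones; cancelling them on both sides gives the exchange axiom. -/
theorem exchange_of_modification {x y x' y' X Y X' Y' : K} {g : x ⟶ y} {t : y ⟶ y'} {r : x ⟶ x'}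
    {g' : x' ⟶ y'} {G : X ⟶ Y} {T : Y ⟶ Y'} {R : X ⟶ X'} {G' : X' ⟶ Y'} {u : x ⟶ X} {v : y ⟶ Y}
    {u' : x' ⟶ X'} {v' : y' ⟶ Y'} {m : g ≫ t ≅ r ≫ g'} {m' : r ≫ g' ⟶ g ≫ t} (hm : m' = m.inv)
    {n : G ≫ T ≅ R ≫ G'} {n' : R ≫ G' ⟶ G ≫ T} (hn : n' = n.inv) (p : g ≫ v ≅ u ≫ G)
    (q : t ≫ v' ≅ v ≫ T) (p' : g' ≫ v' ≅ u' ≫ G') (q' : r ≫ u' ≅ u ≫ R)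
    (h : r ◁ p'.hom ≫ (α_ _ _ _).inv ≫ q'.hom ▷ G' ≫ (α_ _ _ _).hom ≫ u ◁ n' ≫ (α_ _ _ _).inv =
      ((α_ _ _ _).inv ≫ m' ▷ v' ≫ (α_ _ _ _).hom ≫ g ◁ q.hom ≫ (α_ _ _ _).inv) ≫ p.hom ▷ T) :
    g ◁ q.hom ≫ (α_ _ _ _).inv ≫ p.hom ▷ T ≫ (α_ _ _ _).hom ≫ u ◁ n.hom ≫ (α_ _ _ _).inv =
      ((α_ _ _ _).inv ≫ m.hom ▷ v' ≫ (α_ _ _ _).hom ≫ r ◁ p'.hom ≫ (α_ _ _ _).inv) ≫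
        q'.hom ▷ G' := by
  subst hm hn
  simp only [Category.assoc] at h ⊢
  rw [← cancel_mono (α_ _ _ _).hom, ← cancel_mono (u ◁ n.inv), ← cancel_mono (α_ _ _ _).inv]
  simp only [Category.assoc, Iso.inv_hom_id, Iso.inv_hom_id_assoc, Category.comp_id,
    whiskerLeft_hom_inv_assoc, Iso.hom_inv_id, h, Iso.hom_inv_id_assoc, hom_inv_whiskerRight_assoc]

variable {P : S × A ⥤ᵖ K} {H : T × A ⥤ᵖ K} {G : S ⥤ᵖ T}

/-- Uncurrying of pseudonatural transformations. -/
def ProdTrans.ofCurry (η : curryRight P ⟶ G.comp (curryRight H)) : ProdTrans P H G where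
  app s a := (η.app s).app a
  natL g a := modificationIsoApp (η.naturality g) a
  natR s _ _ f := (η.app s).naturality f
  natL_naturality γ a := congrArg (fun m => m.as.app a) (η.naturality_naturality γ)
  natR_naturality s _ _ _ _ γ := (η.app s).naturality_naturality γ
  natL_id s a := by
    have e₁ : H.map₂ (((G.mapId s).hom, 𝟙 (𝟙 a)) : (G.map (𝟙 s) ×ₘ 𝟙 a) ⟶ 𝟙 (G.obj s, a)) ≫
        H.map₂ (𝟙 (𝟙 (G.obj s, a))) ≫ H.map₂ (𝟙 (𝟙 (G.obj s, a))) ≫ (H.mapId (G.obj s, a)).hom =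
        H.map₂ (((G.mapId s).hom, 𝟙 (𝟙 a)) : (G.map (𝟙 s) ×ₘ 𝟙 a) ⟶ 𝟙 (G.obj s, a)) ≫
        (H.mapId (G.obj s, a)).hom := by simp only [map₂_id_comp_mapId]
    have e₂ : P.map₂ (𝟙 (𝟙 (s, a))) ≫ P.map₂ (𝟙 (𝟙 (s, a))) ≫ (P.mapId (s, a)).hom =
        (P.mapId (s, a)).hom := by simp only [map₂_id_comp_mapId]
    have h := congrArg (fun m => m.as.app a) (η.naturality_id s)
    exact naturality_congr_id e₁ e₂ _ h
  natR_id s a := by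
    have e₁ : H.map₂ (𝟙 (𝟙 (G.obj s, a))) ≫ H.map₂ (𝟙 (𝟙 (G.obj s, a))) ≫
        (H.mapId (G.obj s, a)).hom = (H.mapId (G.obj s, a)).hom := by
      simp only [map₂_id_comp_mapId]
    have e₂ : P.map₂ (𝟙 (𝟙 (s, a))) ≫ P.map₂ (𝟙 (𝟙 (s, a))) ≫ (P.mapId (s, a)).hom =
        (P.mapId (s, a)).hom := by simp only [map₂_id_comp_mapId]
    exact naturality_congr_id e₁ e₂ _ ((η.app s).naturality_id a)
  natL_comp {s t r} g h a := by
    have e₁ : H.map₂ (((G.mapComp g h).hom, 𝟙 (𝟙 a)) : (G.map (g ≫ h) ×ₘ 𝟙 a) ⟶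
        ((G.map g ≫ G.map h) ×ₘ 𝟙 a)) ≫ H.map₂ ((𝟙 (G.map g ≫ G.map h), (ρ_ (𝟙 a)).inv) :
          ((G.map g ≫ G.map h) ×ₘ 𝟙 a) ⟶ (G.map g ×ₘ 𝟙 a) ≫ (G.map h ×ₘ 𝟙 a)) ≫
        H.map₂ (𝟙 ((G.map g ×ₘ 𝟙 a) ≫ (G.map h ×ₘ 𝟙 a))) ≫
        (H.mapComp (G.map g ×ₘ 𝟙 a) (G.map h ×ₘ 𝟙 a)).hom =
      H.map₂ (((G.mapComp g h).hom, (λ_ (𝟙 a)).inv) : (G.map (g ≫ h) ×ₘ 𝟙 a) ⟶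
        (G.map g ×ₘ 𝟙 a) ≫ (G.map h ×ₘ 𝟙 a)) ≫
        (H.mapComp (G.map g ×ₘ 𝟙 a) (G.map h ×ₘ 𝟙 a)).hom := by
      rw [H.map₂_id, Category.id_comp, ← H.map₂_comp_assoc]
      congr 2
      exact Prod.ext (Category.comp_id _) ((Category.id_comp _).trans (by rw [unitors_inv_equal]))
    have e₂ : P.map₂ ((𝟙 (g ≫ h), (ρ_ (𝟙 a)).inv) : ((g ≫ h) ×ₘ 𝟙 a) ⟶
          (g ×ₘ 𝟙 a) ≫ (h ×ₘ 𝟙 a)) ≫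
        P.map₂ (𝟙 ((g ×ₘ 𝟙 a) ≫ (h ×ₘ 𝟙 a))) ≫ (P.mapComp (g ×ₘ 𝟙 a) (h ×ₘ 𝟙 a)).hom =
      P.map₂ ((𝟙 (g ≫ h), (λ_ (𝟙 a)).inv) : ((g ≫ h) ×ₘ 𝟙 a) ⟶ (g ×ₘ 𝟙 a) ≫ (h ×ₘ 𝟙 a)) ≫
        (P.mapComp (g ×ₘ 𝟙 a) (h ×ₘ 𝟙 a)).hom := by
      rw [P.map₂_id, Category.id_comp, unitors_inv_equal]
    exact naturality_congr_comp e₁ e₂ _ _ _ (congrArg (fun m => m.as.app a) (η.naturality_comp g h))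
  natR_comp s {a b c} f g := by
    have e₁ : H.map₂ (((λ_ (𝟙 (G.obj s))).inv, 𝟙 (f ≫ g)) : (𝟙 (G.obj s) ×ₘ (f ≫ g)) ⟶
        (𝟙 (G.obj s) ×ₘ f) ≫ (𝟙 (G.obj s) ×ₘ g)) ≫
        H.map₂ (𝟙 ((𝟙 (G.obj s) ×ₘ f) ≫ (𝟙 (G.obj s) ×ₘ g))) ≫
        (H.mapComp (𝟙 (G.obj s) ×ₘ f) (𝟙 (G.obj s) ×ₘ g)).hom =
      H.map₂ (((ρ_ (𝟙 (G.obj s))).inv, 𝟙 (f ≫ g)) : (𝟙 (G.obj s) ×ₘ (f ≫ g)) ⟶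
        (𝟙 (G.obj s) ×ₘ f) ≫ (𝟙 (G.obj s) ×ₘ g)) ≫
        (H.mapComp (𝟙 (G.obj s) ×ₘ f) (𝟙 (G.obj s) ×ₘ g)).hom := by
      rw [H.map₂_id, Category.id_comp, unitors_inv_equal]
    have e₂ : P.map₂ (((λ_ (𝟙 s)).inv, 𝟙 (f ≫ g)) : (𝟙 s ×ₘ (f ≫ g)) ⟶
          (𝟙 s ×ₘ f) ≫ (𝟙 s ×ₘ g)) ≫ P.map₂ (𝟙 ((𝟙 s ×ₘ f) ≫ (𝟙 s ×ₘ g))) ≫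
        (P.mapComp (𝟙 s ×ₘ f) (𝟙 s ×ₘ g)).hom =
      P.map₂ (((ρ_ (𝟙 s)).inv, 𝟙 (f ≫ g)) : (𝟙 s ×ₘ (f ≫ g)) ⟶ (𝟙 s ×ₘ f) ≫ (𝟙 s ×ₘ g)) ≫
        (P.mapComp (𝟙 s ×ₘ f) (𝟙 s ×ₘ g)).hom := by
      rw [P.map₂_id, Category.id_comp, unitors_inv_equal]
    exact naturality_congr_comp e₁ e₂ _ _ _ ((η.app s).naturality_comp f g)
  exchange {s t} g {a b} f := by
    -- Compatibility of the two variables is the statement that the naturality cells of `η` are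
    -- modifications.
    exact exchange_of_modification (mapSquare_swap P g f) (mapSquare_swap H (G.map g) f) _ _ _ _
      ((η.naturality g).hom.as.naturality f)

end OfCurry

/-! ### The Yoneda lemma for transformations out of a representable. -/

section Yoneda
variable {A : Type u₁} [Bicategory.{w₁, v₁} A] {a : A} {F : A ⥤ᵖ Cat.{w₁, v₁}}

/-- Evaluation at the identity. -/
def yonedaEval (F : A ⥤ᵖ Cat.{w₁, v₁}) (a : A) : (corep a ⟶ F) ⥤ F.obj a where
  obj θ := (θ.app a).toFunctor.obj (𝟙 a : a ⟶ a)
  map Γ := (Γ.as.app a).toNatTrans.app (𝟙 a : a ⟶ a)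

/-- The pseudonatural transformation determined by an element, as a functor. -/
def yonedaTransFunctor (F : A ⥤ᵖ Cat.{w₁, v₁}) (a : A) : F.obj a ⥤ (corep a ⟶ F) where
  obj u := yonedaTrans F u
  map m :=
    { as :=
      { app := fun _ => NatTrans.toCatHom₂
          { app := fun f => (F.map f).toFunctor.map m
            naturality := fun _ _ γ => ((F.map₂ γ).toNatTrans.naturality m).symm }
        naturality := fun {b _} g => cat_hom₂_ext fun (f : a ⟶ b) =>
          (F.mapComp f g).hom.toNatTrans.naturality m } }
  map_id u := Pseudofunctor.StrongTrans.homCategory.ext fun b => cat_hom₂_ext fun (f : a ⟶ b) =>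
    (F.map f).toFunctor.map_id u
  map_comp m n := Pseudofunctor.StrongTrans.homCategory.ext fun b =>
    cat_hom₂_ext fun (f : a ⟶ b) => (F.map f).toFunctor.map_comp m n

section
variable (θ : corep a ⟶ F)

/-- The functor `f ↦ θ f`. -/
def transFunctor (b : A) : (a ⟶ b) ⥤ F.obj b := (θ.app b).toFunctor

/-- The isomorphism `θ (h ≫ g) ≅ (F g) (θ h)`. -/
def transIso {b c : A} (h : a ⟶ b) (g : b ⟶ c) :
    (transFunctor θ c).obj (h ≫ g) ≅ (F.map g).toFunctor.obj ((transFunctor θ b).obj h) :=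
  (Cat.Hom.toNatIso (θ.naturality g)).app h

theorem transIso_naturality_left {b c : A} {h h' : a ⟶ b} (γ : h ⟶ h') (g : b ⟶ c) :
    (transFunctor θ c).map (γ ▷ g) ≫ (transIso θ h' g).hom =
      (transIso θ h g).hom ≫ (F.map g).toFunctor.map ((transFunctor θ b).map γ) :=
  (θ.naturality g).hom.toNatTrans.naturality γ

theorem transIso_naturality_right {b c : A} (h : a ⟶ b) {g g' : b ⟶ c} (γ : g ⟶ g') :
    (transFunctor θ c).map (h ◁ γ) ≫ (transIso θ h g').hom =
      (transIso θ h g).hom ≫ (F.map₂ γ).toNatTrans.app ((transFunctor θ b).obj h) :=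
  congrArg (fun m => m.toNatTrans.app h) (θ.naturality_naturality γ)

theorem transIso_comp {b c d : A} (h : a ⟶ b) (g : b ⟶ c) (k : c ⟶ d) :
    (transIso θ h (g ≫ k)).hom ≫ (F.mapComp g k).hom.toNatTrans.app ((transFunctor θ b).obj h) =
      (transFunctor θ d).map (α_ h g k).inv ≫ (transIso θ (h ≫ g) k).hom ≫
        (F.map k).toFunctor.map (transIso θ h g).hom := by
  have e : (transIso θ h (g ≫ k)).hom ≫
      (F.mapComp g k).hom.toNatTrans.app ((transFunctor θ b).obj h) =
      (transFunctor θ d).map (α_ h g k).inv ≫ 𝟙 _ ≫ (transIso θ (h ≫ g) k).hom ≫ 𝟙 _ ≫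
        (F.map k).toFunctor.map (transIso θ h g).hom ≫ 𝟙 _ :=
    congrArg (fun m => m.toNatTrans.app h) (θ.naturality_comp g k)
  simpa only [Category.id_comp, Category.comp_id] using e

/-- The isomorphism `θ f ≅ (F f) (θ 1)`. -/
def yonedaIsoApp {b : A} (f : a ⟶ b) :
    (transFunctor θ b).obj f ≅ (F.map f).toFunctor.obj ((transFunctor θ a).obj (𝟙 a)) :=
  (transFunctor θ b).mapIso (λ_ f).symm ≪≫ transIso θ (𝟙 a) f

theorem yonedaIsoApp_hom {b : A} (f : a ⟶ b) : (yonedaIsoApp θ f).hom =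
    (transFunctor θ b).map (λ_ f).inv ≫ (transIso θ (𝟙 a) f).hom := rfl

theorem yonedaIsoApp_naturality {b : A} {f f' : a ⟶ b} (γ : f ⟶ f') :
    (transFunctor θ b).map γ ≫ (yonedaIsoApp θ f').hom =
      (yonedaIsoApp θ f).hom ≫ (F.map₂ γ).toNatTrans.app ((transFunctor θ a).obj (𝟙 a)) := by
  rw [yonedaIsoApp_hom, yonedaIsoApp_hom, Category.assoc, ← transIso_naturality_right,
    ← Functor.map_comp_assoc, ← Functor.map_comp_assoc, leftUnitor_inv_naturality]

/-- This is the modification axiom for `yonedaIso`; it is the composition axiom of `θ` at `𝟙 a`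
followed by `f` and `g`, corrected by naturality along the unitor of `f`. -/
theorem yonedaIsoApp_comp {b c : A} (f : a ⟶ b) (g : b ⟶ c) :
    (yonedaIsoApp θ (f ≫ g)).hom ≫
        (F.mapComp f g).hom.toNatTrans.app ((transFunctor θ a).obj (𝟙 a)) =
      (transIso θ f g).hom ≫ (F.map g).toFunctor.map (yonedaIsoApp θ f).hom := by
  rw [yonedaIsoApp_hom, yonedaIsoApp_hom, Category.assoc, transIso_comp, Functor.map_comp,
    ← reassoc_of% (transIso_naturality_left θ (λ_ f).inv g), ← Functor.map_comp_assoc]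
  congr 2
  simp

/-- Every pseudonatural transformation `corep a ⟶ F` is determined by an element. -/
def yonedaIso : θ ≅ yonedaTrans F ((transFunctor θ a).obj (𝟙 a)) :=
  Pseudofunctor.StrongTrans.isoMk
    (fun _ => Cat.Hom.isoMk (NatIso.ofComponents (fun f => yonedaIsoApp θ f)
      (fun γ => yonedaIsoApp_naturality θ γ)))
    (fun {b _} g => cat_hom₂_ext fun (f : a ⟶ b) => yonedaIsoApp_comp θ f g)

end

/-- The components of a modification. -/
def transMap {θ θ' : corep a ⟶ F} (Γ : θ ⟶ θ') {b : A} (f : a ⟶ b) :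
    (transFunctor θ b).obj f ⟶ (transFunctor θ' b).obj f :=
  (Γ.as.app b).toNatTrans.app f

theorem yonedaIsoApp_modification {θ θ' : corep a ⟶ F} (Γ : θ ⟶ θ') {b : A} (f : a ⟶ b) :
    transMap Γ f ≫ (yonedaIsoApp θ' f).hom =
      (yonedaIsoApp θ f).hom ≫ (F.map f).toFunctor.map (transMap Γ (𝟙 a)) := by
  have h : transMap Γ (𝟙 a ≫ f) ≫ (transIso θ' (𝟙 a) f).hom =
      (transIso θ (𝟙 a) f).hom ≫ (F.map f).toFunctor.map (transMap Γ (𝟙 a)) :=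
    congrArg (fun m => m.toNatTrans.app (𝟙 a)) (Γ.as.naturality f)
  have h' : (transFunctor θ b).map (λ_ f).inv ≫ transMap Γ (𝟙 a ≫ f) =
      transMap Γ f ≫ (transFunctor θ' b).map (λ_ f).inv :=
    (Γ.as.app b).toNatTrans.naturality (λ_ f).inv
  rw [yonedaIsoApp_hom, yonedaIsoApp_hom, Category.assoc, ← h, reassoc_of% h']

/-- The inverse sends `u` to its Yoneda transformation. One comparison is `yonedaIso`; the other is
the identity constraint of `F`. -/
theorem isEquivalence_yonedaEval (F : A ⥤ᵖ Cat.{w₁, v₁}) (a : A) :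
    (yonedaEval F a).IsEquivalence :=
  (CategoryTheory.Equivalence.mk (yonedaEval F a) (yonedaTransFunctor F a)
    (NatIso.ofComponents yonedaIso fun Γ => Pseudofunctor.StrongTrans.homCategory.ext fun b =>
      cat_hom₂_ext fun (f : a ⟶ b) => yonedaIsoApp_modification Γ f)
    (NatIso.ofComponents (fun u => (Cat.Hom.toNatIso (F.mapId a)).app u)
      (fun m => (F.mapId a).hom.toNatTrans.naturality m))).isEquivalence_functor

end Yoneda

/-! ### The Yoneda embedding is locally an equivalence; pointwise representations assemble. -/

section Coyoneda
open Bicategory.Opposite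
variable {A : Type u₁} [Bicategory.{w₁, v₁} A]

variable (A) in
/-- The pseudofunctor `a ↦ A(a, -)`. -/
def coyoneda : Aᵒᵖ ⥤ᵖ (A ⥤ᵖ Cat.{w₁, v₁}) := curryRight (homPseudofunctor A)

/-- A value of `coyoneda` acts by `h ↦ 𝟙 ≫ h ≫ f`, so it is not `corep` on the nose; the universal
element `𝟙` provides the comparison. -/
theorem isUniversalElement_coyoneda (x : Aᵒᵖ) :
    IsUniversalElement ((coyoneda A).obj x) (a := x.unop) (𝟙 x.unop) := by
  intro b
  exact Functor.isEquivalence_of_iso (F := 𝟭 (x.unop ⟶ b))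
    (NatIso.ofComponents (fun f => (λ_ f).symm ≪≫ whiskerLeftIso (𝟙 x.unop) (λ_ f).symm) (by
    intro f g γ
    have e : γ ≫ (λ_ g).inv ≫ 𝟙 x.unop ◁ (λ_ g).inv = ((λ_ f).inv ≫ 𝟙 x.unop ◁ (λ_ f).inv) ≫
        𝟙 (𝟙 x.unop) ▷ (𝟙 x.unop ≫ f) ≫ 𝟙 x.unop ◁ 𝟙 x.unop ◁ γ := by simp
    exact e))

theorem isEquivalence_unopFunctor (x y : Aᵒᵖ) : (unopFunctor x y).IsEquivalence :=
  (CategoryTheory.Equivalence.mk (unopFunctor x y) (opFunctor y.unop x.unop)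
    (Iso.refl _) (Iso.refl _)).isEquivalence_functor

/-- Up to isomorphism, the functor on hom categories followed by restriction along `e` and
evaluation at the identity just unwraps opposite 1-cells. That composite and the last two functors
are equivalences, so the first one is too. -/
theorem isEquivalence_coyoneda_mapFunctor (x y : Aᵒᵖ) :
    ((coyoneda A).mapFunctor x y).IsEquivalence := by
  let e := yonedaTrans ((coyoneda A).obj x) (a := x.unop) (𝟙 x.unop)
  have he : IsEquiv e := (isUniversalElement_coyoneda x).isEquiv_yonedaTrans
  have h₁ := he.precomp_isEquivalence ((coyoneda A).obj y)
  have h₂ := isEquivalence_yonedaEval ((coyoneda A).obj y) x.unop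
  have h₃ := isEquivalence_unopFunctor x y
  -- This composite is the value of `e` at the identity, since 1-cells act in the hom pseudofunctor
  -- by composition on both sides.
  let w : x.unop ⟶ x.unop := 𝟙 x.unop ≫ 𝟙 x.unop ≫ 𝟙 x.unop
  let j : w ≅ 𝟙 x.unop := λ_ _ ≪≫ λ_ _
  let i : unopFunctor x y ≅ (coyoneda A).mapFunctor x y ⋙
      precomp ((coyoneda A).obj y) e ⋙ yonedaEval ((coyoneda A).obj y) x.unop :=
    NatIso.ofComponents (fun f => (ρ_ f.unop).symm ≪≫
      whiskerLeftIso f.unop (j.symm ≪≫ (ρ_ w).symm)) (by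
      intro f g γ
      have e : γ.unop2 ≫ (ρ_ g.unop).inv ≫ g.unop ◁ (j.inv ≫ (ρ_ w).inv) =
        ((ρ_ f.unop).inv ≫ f.unop ◁ (j.inv ≫ (ρ_ w).inv)) ≫
          γ.unop2 ▷ (w ≫ 𝟙 x.unop) ≫ g.unop ◁ w ◁ 𝟙 (𝟙 x.unop) := by
        have := whisker_exchange γ.unop2 (j.inv ≫ (ρ_ w).inv)
        rw [whiskerLeft_id, whiskerLeft_id, Category.comp_id, Category.assoc, this,
          rightUnitor_inv_naturality_assoc]
      exact e)
  have h₄ := Functor.isEquivalence_trans (precomp ((coyoneda A).obj y) e)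
    (yonedaEval ((coyoneda A).obj y) x.unop)
  exact @Functor.isEquivalence_of_comp_right _ _ _ _ _ _ _ _ h₄
    (@Functor.isEquivalence_of_iso _ _ _ _ _ _ i h₃)

/-- A pseudofunctor `S → Aᵒᵖ` regarded as a pseudofunctor `Sᵒᵖ → A`. -/
def leftOp {S : Type u₂} [Bicategory.{w₂, v₂} S] (G : S ⥤ᵖ Aᵒᵖ) : Sᵒᵖ ⥤ᵖ A where
  obj s := (G.obj s.unop).unop
  map f := (G.map f.unop).unop
  map₂ η := (G.map₂ η.unop2).unop2
  map₂_id f := congrArg Hom2.unop2 (G.map₂_id f.unop)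
  map₂_comp η θ := congrArg Hom2.unop2 (G.map₂_comp η.unop2 θ.unop2)
  mapId s := (G.mapId s.unop).unop2
  mapComp f g := (G.mapComp g.unop f.unop).unop2
  map₂_whisker_left f _ _ η := congrArg Hom2.unop2 (G.map₂_whisker_right η.unop2 f.unop)
  map₂_whisker_right η h := congrArg Hom2.unop2 (G.map₂_whisker_left h.unop η.unop2)
  map₂_associator f g h := congrArg Hom2.unop2 (map₂_associator_inv G h.unop g.unop f.unop)
  map₂_left_unitor f := congrArg Hom2.unop2 (G.map₂_right_unitor f.unop)
  map₂_right_unitor f := congrArg Hom2.unop2 (G.map₂_left_unitor f.unop)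

theorem rightOp_leftOp {S : Type u₂} [Bicategory.{w₂, v₂} S] (G : S ⥤ᵖ Aᵒᵖ) :
    rightOp (leftOp G) = G := rfl

/-- If each `D(s, -)` is represented by some `a s`, then `s ↦ a s` extends to a pseudofunctor
representing `D`. -/
theorem exists_equivalence_homFrom {S : Type u₂} [Bicategory.{w₂, v₂} S]
    (D : S × A ⥤ᵖ Cat.{w₁, v₁}) (a : S → A) (u : ∀ s, ((curryRight D).obj s).obj (a s))
    (hu : ∀ s, IsUniversalElement ((curryRight D).obj s) (u s)) :
    ∃ E : Sᵒᵖ ⥤ᵖ A, Nonempty (Bicategory.Equivalence D (homFrom E)) := by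
  let e (s : S) := (hu s).isEquiv_yonedaTrans.choose
  let e' (s : S) := (isUniversalElement_coyoneda (op (a s))).isEquiv_yonedaTrans.choose
  let η (s : S) : (curryRight D).obj s ⟶ (coyoneda A).obj (op (a s)) := (e s).inv ≫ (e' s).hom
  have hη (s : S) : IsEquiv (η s) := (isEquiv_inv (e s)).comp (isEquiv_hom (e' s))
  -- Postcomposing `η s` with images of 1-cells is an equivalence because `coyoneda` is a local
  -- equivalence and precomposition with the equivalence `η s` is one. This makes the representing
  -- objects pseudofunctorial in `s`.
  have huniv (s : S) : (IsoComma.mk s (op (a s)) (η s) :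
      IsoComma (curryRight D) (coyoneda A)).IsUniversal := fun z => by
    have h₁ := isEquivalence_coyoneda_mapFunctor (op (a s)) z
    have h₂ := (hη s).precomp_isEquivalence ((coyoneda A).obj z)
    exact Functor.isEquivalence_trans ((coyoneda A).mapFunctor (op (a s)) z)
      (precomp ((coyoneda A).obj z) (η s))
  let G := universalFunctor (fun s => op (a s)) η huniv
  let θ := (ProdTrans.ofCurry (H := homPseudofunctor A) (G := G)
    (universalUnit (fun s => op (a s)) η huniv)).toTrans
  -- The component of `θ` at `(s, b)` is the component at `b` of the given equivalence `η s`.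
  have hθ : IsEquiv θ := isEquiv_of_pointwise θ fun x => (hη x.1).app x.2
  refine ⟨leftOp G, ?_⟩
  rw [homFrom, rightOp_leftOp]
  exact ⟨hθ.choose⟩

end Coyoneda

/-! ### Representability of each `D(s, -)` from the factorization through `R`. -/

section Discrete
open CategoryTheory.Prod Bicategory.Opposite
variable {S : Type u₁} [Bicategory.{w₁, v₁} S] {A : Type u₂} [Bicategory.{w₂, v₂} A]
  {B : Type u₃} [Bicategory.{w₃, v₃} B]

/-- The functor `B(x, R -)` compared with the slices of `B(-, R -) ∘ (E × 1)`. -/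
def corepCompTrans {X : Type u₄} [Bicategory.{w₄, v₄} X] (E : X ⥤ᵖ Bᵒᵖ) (R : A ⥤ᵖ B) (x : X) :
    PreTrans (R.comp (corep (E.obj x).unop))
      (sliceRight ((prodMap E (Pseudofunctor.id A)).comp (homTo R)) x) where
  app a := 𝟙 (Cat.of ((E.obj x).unop ⟶ R.obj a))
  naturality {a b} f := Cat.Hom.isoMk (NatIso.ofComponents
    -- The slice acts by composing on the left with `E.map (𝟙 x)`, which `E.mapId` identifies with
    -- an identity 1-cell.
    (fun (h : (E.obj x).unop ⟶ R.obj a) => (λ_ (h ≫ R.map f)).symm ≪≫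
      whiskerRightIso (E.mapId x).unop2.symm (h ≫ R.map f)) (by
      intro (h : (E.obj x).unop ⟶ R.obj a) (k : (E.obj x).unop ⟶ R.obj a) γ
      have e : γ ▷ R.map f ≫ (λ_ (k ≫ R.map f)).inv ≫ (E.mapId x).inv.unop2 ▷ (k ≫ R.map f) =
          ((λ_ (h ≫ R.map f)).inv ≫ (E.mapId x).inv.unop2 ▷ (h ≫ R.map f)) ≫
            (E.map (𝟙 x)).unop ◁ γ ▷ R.map f := by
        rw [Category.assoc, ← whisker_exchange, leftUnitor_inv_naturality_assoc]
        rfl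
      exact e))
  naturality_naturality {a b f g} γ := cat_hom₂_ext fun (h : (E.obj x).unop ⟶ R.obj a) => by
    have e : h ◁ R.map₂ γ ≫ (λ_ (h ≫ R.map g)).inv ≫
        (E.mapId x).inv.unop2 ▷ (h ≫ R.map g) =
      ((λ_ (h ≫ R.map f)).inv ≫ (E.mapId x).inv.unop2 ▷ (h ≫ R.map f)) ≫
        (E.map₂ (𝟙 (𝟙 x))).unop2 ▷ (h ≫ R.map f) ≫ (E.map (𝟙 x)).unop ◁ h ◁ R.map₂ γ := by
      rw [E.map₂_id, unop2_id, id_whiskerRight, Category.id_comp, Category.assoc,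
        ← whisker_exchange, leftUnitor_inv_naturality_assoc]
      rfl
    exact e

/-- The slices of the restriction to the discrete 2-category are the slices. -/
def restrictDiscreteTrans {K : Type u₄} [Bicategory.{w₄, v₄} K] (D : S × A ⥤ᵖ K) (s : S) :
    PreTrans (sliceRight (restrictDiscrete D) ⟨⟨s⟩⟩) ((curryRight D).obj s) where
  app a := 𝟙 (D.obj (s, a))
  naturality f := ρ_ (D.map (𝟙 s ×ₘ f)) ≪≫ (λ_ (D.map (𝟙 s ×ₘ f))).symm
  naturality_naturality {a b f g} γ := by
    let γ' : (𝟙 s ×ₘ f) ⟶ (𝟙 s ×ₘ g) := (𝟙 (𝟙 s), γ)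
    have e : D.map₂ γ' ▷ 𝟙 (D.obj (s, b)) ≫
        (ρ_ (D.map (𝟙 s ×ₘ g))).hom ≫ (λ_ (D.map (𝟙 s ×ₘ g))).inv =
      ((ρ_ (D.map (𝟙 s ×ₘ f))).hom ≫ (λ_ (D.map (𝟙 s ×ₘ f))).inv) ≫
        𝟙 (D.obj (s, a)) ◁ D.map₂ γ' := by simp
    exact e

/-- The unit of the biadjunction at `D' s` is a universal element of `B(D' s, R -)`, and the
factorization transports it to `D(s, -)`. Fixing `s` involves no 1-cell of `S` but its identity, so
the discrete restriction suffices. -/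
theorem FactorsThrough.exists_isUniversalElement {D : S × A ⥤ᵖ Cat.{w₃, v₃}} {R : A ⥤ᵖ B}
    (hD : FactorsThrough D R) (hR : IsRightBiadjoint R) (s : S) :
    ∃ (a : A) (u : ((curryRight D).obj s).obj a), IsUniversalElement ((curryRight D).obj s) u := by
  obtain ⟨D', ⟨e⟩⟩ := hD
  obtain ⟨E, ⟨h⟩⟩ := hR
  have h₁ := (h.isUniversalElement (D'.obj ⟨⟨s⟩⟩).unop).map (corepCompTrans D' R ⟨⟨s⟩⟩)
    fun b => isEquiv_id _
  have h₂ := h₁.map (.ofTrans (preWhisker (Bicategory.Prod.sectR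
    (⟨⟨s⟩⟩ : LocallyDiscrete (Discrete S)) A).toPseudofunctor e.inv))
    fun b => (isEquiv_inv e).app (⟨⟨s⟩⟩, b)
  exact ⟨_, _, h₂.map (restrictDiscreteTrans D s) fun b => isEquiv_id _⟩

end Discrete

end BiLift

theorem mainTheorem2
    {S : Type v} [Bicategory.{v, v} S] [Bicategory.Strict S]
    {A : Type u₁} [Bicategory.{v, v} A] [Bicategory.Strict A]
    {B : Type u₂} [Bicategory.{v, v} B] [Bicategory.Strict B]
    {C : Type u₃} [Bicategory.{v, v} C] [Bicategory.Strict C]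
    (W : S ⥤ᵖ Cat.{v, v})
    (R : A ⥤ᵖ B) (hR : BiLift.IsRightBiadjoint R)
    (J : A ⥤ᵖ C)
    (D : C → (S × A ⥤ᵖ Cat.{v, v}))
    (hD : ∀ y : C, BiLift.FactorsThrough (D y) R)
    (hW : ∀ y : C, BiLift.IsWeightedBilimitFamily W (D y) (J.comp (BiLift.corep y))) :
    (∀ y : C, ∃ 𝒜 : Sᵒᵖ ⥤ᵖ A,
      Nonempty (Bicategory.Equivalence (D y) (BiLift.homFrom 𝒜))) ∧
    ∀ 𝒜 : C → (Sᵒᵖ ⥤ᵖ A),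
      (∀ y : C, Nonempty (Bicategory.Equivalence (D y) (BiLift.homFrom (𝒜 y)))) →
      (BiLift.IsRightBiadjoint J ↔
        ∀ y : C, ∃ G : A, BiLift.IsWeightedBicolimit W (𝒜 y) G) ∧
      ∀ G : C → A, (∀ y : C, BiLift.IsWeightedBicolimit W (𝒜 y) (G y)) →
        ∃ L : C ⥤ᵖ A, (∀ y : C, L.obj y = G y) ∧ Nonempty (BiLift.Biadjunction L J) := by
  refine ⟨fun y => ?_, fun 𝒜 h𝒜 => ?_⟩
  · choose a u hu using (hD y).exists_isUniversalElement hR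
    exact BiLift.exists_equivalence_homFrom (D y) a u hu
  -- For fixed `y` and `a`: a universal element of `C(y, J -)` at `a` exists if and only if `a` is
  -- the weighted bicolimit of `𝒜 y`.
  have key (y : C) (a : A) := BiLift.exists_isUniversalElement_iff_isWeightedBicolimit (hW y)
    (h𝒜 y).some a
  have ext (G : C → A) (hG : ∀ y : C, BiLift.IsWeightedBicolimit W (𝒜 y) (G y)) :
      ∃ L : C ⥤ᵖ A, (∀ y : C, L.obj y = G y) ∧ Nonempty (BiLift.Biadjunction L J) := by
    choose u hu using fun y => (key y (G y)).2 (hG y)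
    exact BiLift.exists_biadjunction G u hu
  -- If `J` has a left biadjoint `L`, the unit at `y` is universal, so `L y` is the bicolimit.
  -- Conversely, any choice of bicolimits extends to a left biadjoint by `ext`.
  refine ⟨⟨fun ⟨L, ⟨h⟩⟩ y => ⟨L.obj y, (key y _).1 ⟨_, h.isUniversalElement y⟩⟩, fun h => ?_⟩, ext⟩
  choose G hG using h
  obtain ⟨L, -, h⟩ := ext G hG
  exact ⟨L, h⟩
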